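/- Consider the Hamiltonian of the symmetric restricted three-body problem on the unit sphere (angular velocity $1$, masses $m_1=m_2=\tfrac12$), in the rotating frame and in the stereographic projection from the south pole. Put $q_{m_1}=(-(\sqrt2-1),0)$, $q_{m_2}=(\sqrt2-1,0)$, with antipodal points $\bar q_{m_1}=(\sqrt2+1,0)$, $\bar q_{m_2}=(-(\sqrt2+1),0)$, and, for $q\in\mathbb R^2\setminus\{q_{m_1},q_{m_2},\bar q_{m_1},\bar q_{m_2}\}$ and $p\in\mathbb R^2$, $$H(q,p)=\frac{(|q|^2+1)^2|p|^2}{8}+q_2p_1-q_1p_2+V_1(q)+V_2(q),\qquad V_i(q)=-\frac{n_i(q)}{|q-q_{m_i}|\,|q-\bar q_{m_i}|},$$ $$n_1(q)=-q_1-\tfrac12(|q|^2-1),\qquad n_2(q)=q_1-\tfrac12(|q|^2-1).$$ Let $L_1=(0,0)$, so that $H(L_1)=-1$, let $c<H(L_1)$ and $i\in\{1,2\}$, and let $j$ be the index with $\{i,j\}=\{1,2\}$. Let $\Sigma_c^{m_i}$ be the component of $H^{-1}(c)$ whose projection to the $q$-plane has $q_{m_i}$ in its closure. Let $T^*S^2=\{(\xi,\eta)\in\mathbb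 R^3\times\mathbb R^3:\ |\xi|=1,\ \langle\xi,\eta\rangle=0\}$ with $\xi=(\xi_0,\xi_1,\xi_2)$, Liouville form $\lambda=\sum_k\eta_k\,d\xi_k$ and symplectic form $\omega=d\lambda$. With $x=-p$ and $y=q-q_{m_i}$, map $(q,p)$ to $(\xi,\eta)\in T^*S^2$ by $$\xi_0=\frac{|x|^2-1}{|x|^2+1},\quad \xi_k=\frac{2x_k}{|x|^2+1},\quad \eta_0=\langle x,y\rangle,\quad \eta_k=\frac{|x|^2+1}{2}\,y_k-\langle x,y\rangle x_k\qquad(k=1,2).$$ Conversely put $q=q_{m_i}+y$ with $y_k=\eta_k(1-\xi_0)+\xi_k\eta_0$. In these variables $|q-q_{m_i}|\,(H-c)$ extends over the collision fiber $\xi=(1,0,0)$ as $$\tilde E=|\eta|\Big(\frac{(|q|^2+1)^2(1+\xi_0)}{8}+q_1\xi_2-q_2\xi_1+(1-\xi_0)\big(V_j(q)-c\big)\Big)-\frac{n_i(q)}{|q-\bar q_{m_i}|},$$ defined where $q\notin\{q_{m_j},\bar q_{m_1},\bar q_{m_2}\}$. The regularized component $\widetilde\Sigma_c^{m_i}\subset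 T^*S^2$ is the connected component of $\{\tilde E=0\}$ that contains the image of $\Sigma_c^{m_i}$. **Theorem.** For every $c<H(L_1)$ and each $i\in\{1,2\}$: 1. $\widetilde\Sigma_c^{m_i}$ is a compact smooth hypersurface in $T^*S^2$. 2. $\widetilde\Sigma_c^{m_i}$ is fiberwise star-shaped: it does not meet the zero section, every open ray from the origin in every fiber of $T^*S^2$ meets it exactly once, and the Liouville vector field $\eta\,\partial_\eta$ is nowhere tangent to it. 3. $\widetilde\Sigma_c^{m_i}$ is of contact type: there is a smooth $1$-form $\alpha$ on it with $d\alpha=\omega|_{\widetilde\Sigma_c^{m_i}}$ and $\alpha(v)\neq0$ for every nonzero $v\in\ker\big(\omega|_{\widetilde\Sigma_c^{m_i}}\big)$. 4. $\widetilde\Sigma_c^{m_i}$ is diffeomorphic to the unit cotangent bundle $\{(\xi,\eta)\in T^*S^2:|\eta|=1\}$ of $S^2$, and to $\mathbb RP^3$. -/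

import Mathlib

open Set Filter Topology
open scoped Manifold ContDiff RealInnerProductSpace

noncomputable section

namespace CurvedThreeBody

/-! ### Smooth submanifolds and diffeomorphisms -/

section Smooth

/-- `S` is an embedded smooth `k`-dimensional submanifold (without boundary) of the normed space
`V`: near each of its points, a diffeomorphism between open subsets of `V` straightens `S` to a
`k`-dimensional linear subspace. -/
def IsSubmanifold {V : Type*} [NormedAddCommGroup V] [NormedSpace ℝ V] (k : ℕ) (S : Set V) :
    Prop :=
  ∀ x ∈ S, ∃ (φ : OpenPartialHomeomorph V V) (W : Submodule ℝ V),
    x ∈ φ.source ∧ ContDiffOn ℝ ∞ φ φ.source ∧ ContDiffOn ℝ ∞ φ.symm φ.target ∧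
      Module.finrank ℝ W = k ∧ φ '' (S ∩ φ.source) = (W : Set V) ∩ φ.target

/-- The tangent vectors of `S` at `x`: velocities at `x` of smooth curves that run in `S`. -/
def tangentVectors {V : Type*} [NormedAddCommGroup V] [NormedSpace ℝ V] (S : Set V) (x : V) :
    Set V :=
  {v | ∃ γ : ℝ → V, ContDiff ℝ ∞ γ ∧ γ 0 = x ∧ (∀ᶠ t in 𝓝 (0 : ℝ), γ t ∈ S) ∧ HasDerivAt γ v 0}

variable {E : Type*} [NormedAddCommGroup E] [NormedSpace ℝ E]
  {H : Type*} [TopologicalSpace H] (I : ModelWithCorners ℝ E H)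
  {X : Type*} [TopologicalSpace X] [ChartedSpace H X]
  {E' : Type*} [NormedAddCommGroup E'] [NormedSpace ℝ E']
  {H' : Type*} [TopologicalSpace H'] (J : ModelWithCorners ℝ E' H')
  {Y : Type*} [TopologicalSpace Y] [ChartedSpace H' Y]

/-- `f` is smooth on the subset `A` of the manifold `X`: near every point of `A` it agrees on `A`
with a smooth map that is defined on an open set of `X`. -/
def SmoothOnSubset (f : X → Y) (A : Set X) : Prop :=
  ∀ x ∈ A, ∃ (U : Set X) (g : X → Y), IsOpen U ∧ x ∈ U ∧ ContMDiffOn I J ∞ g U ∧ EqOn f g (A ∩ U)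

/-- The subsets `A ⊆ X` and `B ⊆ Y` of two manifolds are diffeomorphic. -/
def AreDiffeomorphic (A : Set X) (B : Set Y) : Prop :=
  ∃ (f : X → Y) (g : Y → X), MapsTo f A B ∧ MapsTo g B A ∧ LeftInvOn g f A ∧ RightInvOn g f B ∧
    SmoothOnSubset I J f A ∧ SmoothOnSubset J I g B

end Smooth

/-! ### Real projective space -/

/-- The group `{1, -1}` is finite. -/
instance finite_signs : Finite (Metric.sphere (0 : ℝ) 1) := by
  have h : (Metric.sphere (0 : ℝ) 1) ⊆ {1, -1} := by
    intro x hx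
    have hx' : |x| = 1 := by simpa using hx
    rcases (abs_eq (zero_le_one' ℝ)).1 hx' with h | h <;> simp [h]
  exact ((Set.finite_singleton (-1 : ℝ)).insert 1).subset h

/-- The action of `{1, -1}` on the unit sphere of `ℝ⁴` by multiplication is free. -/
instance signs_free :
    IsCancelSMul (Metric.sphere (0 : ℝ) 1) (Metric.sphere (0 : EuclideanSpace ℝ (Fin 4)) 1) where
  left_cancel' a b c h := by simpa using congrArg (fun z => a⁻¹ • z) h
  right_cancel' a b c h := by
    have h' : (a : ℝ) • (c : EuclideanSpace ℝ (Fin 4)) = (b : ℝ) • (c : EuclideanSpace ℝ (Fin 4)) :=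
      congrArg Subtype.val h
    have hc : (c : EuclideanSpace ℝ (Fin 4)) ≠ 0 := ne_zero_of_mem_unit_sphere c
    exact Subtype.ext (smul_left_injective ℝ hc h')

/-- Real projective 3-space `ℝP³ = S³ / {±1}`, with Mathlib's quotient topology and quotient
smooth structure. -/
abbrev RealProjectiveThreeSpace : Type :=
  MulAction.orbitRel.Quotient (Metric.sphere (0 : ℝ) 1)
    (Metric.sphere (0 : EuclideanSpace ℝ (Fin 4)) 1)

/-! ### The cotangent bundle of the round 2-sphere -/

/-- `ℝ³`, with coordinates `ξ 0, ξ 1, ξ 2`. -/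
abbrev Space := EuclideanSpace ℝ (Fin 3)

/-- `T*S²`, identified with `TS²` by the round metric: pairs `(ξ, η)` with `|ξ| = 1`, `⟪ξ, η⟫ = 0`.
The Liouville form is then `∑ η_i dξ_i`. -/
def cotangentSphere : Set (Space × Space) := {z | ‖z.1‖ = 1 ∧ ⟪z.1, z.2⟫ = 0}

/-- The unit cotangent bundle of `S²`. -/
def unitCotangentSphere : Set (Space × Space) := {z | z ∈ cotangentSphere ∧ ‖z.2‖ = 1}

/-- The canonical symplectic form `∑ dη_i ∧ dξ_i` (to be restricted to `T*S²`). -/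
def symplecticForm (v w : Space × Space) : ℝ := ⟪v.2, w.1⟫ - ⟪w.2, v.1⟫

/-- A smooth hypersurface of the 4-manifold `T*S²`. -/
def IsHypersurface (S : Set (Space × Space)) : Prop := S ⊆ cotangentSphere ∧ IsSubmanifold 3 S

/-- A subset of `T*S²` is fiberwise star-shaped: it misses the zero section, each open
ray from the origin in each cotangent fiber meets it exactly once, and the fiberwise radial
Liouville vector field `η ∂_η` is nowhere tangent to it. -/
def IsFiberwiseStarShaped (S : Set (Space × Space)) : Prop :=
  (∀ z ∈ S, z.2 ≠ 0) ∧
  (∀ z ∈ unitCotangentSphere, ∃! r : ℝ, 0 < r ∧ (z.1, r • z.2) ∈ S) ∧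
  (∀ z ∈ S, ((0 : Space), z.2) ∉ tangentVectors S z)

/-- `S ⊆ T*S²` is of contact type: there is a smooth 1-form `α` on `S` (given by its
extension to a neighborhood) with `dα = ω|_S` which is nonzero on every nonzero vector of the
characteristic line field `ker ω|_S`. -/
def IsContactType (S : Set (Space × Space)) : Prop :=
  ∃ (U : Set (Space × Space)) (α : Space × Space → (Space × Space →L[ℝ] ℝ)),
    IsOpen U ∧ S ⊆ U ∧ ContDiffOn ℝ ∞ α U ∧
    (∀ z ∈ S, ∀ v ∈ tangentVectors S z, ∀ w ∈ tangentVectors S z,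
      fderiv ℝ α z v w - fderiv ℝ α z w v = symplecticForm v w) ∧
    (∀ z ∈ S, ∀ v ∈ tangentVectors S z, v ≠ 0 →
      (∀ w ∈ tangentVectors S z, symplecticForm v w = 0) → α z v ≠ 0)

/-! ### The restricted three-body problem on the sphere

The two primaries are indexed by `i : Fin 2`; `i = 0` is `m₁`, `i = 1` is `m₂`. Positions are in
the stereographic projection of the sphere from the south pole, in the rotating frame. -/

/-- The plane `ℝ²`; the coordinates `q₁, q₂` are `q 0, q 1`. -/
abbrev Plane := EuclideanSpace ℝ (Fin 2)

/-- The side of the primary: `m₁` is on the negative, `m₂` on the positive `q₁`-axis. -/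
def side (i : Fin 2) : ℝ := ![-1, 1] i

/-- The other primary. -/
def other (i : Fin 2) : Fin 2 := 1 - i

/-- The positions `(∓(√2 - 1), 0)` of the primaries. -/
def primary (i : Fin 2) : Plane := !₂[side i * (√2 - 1), 0]

/-- The positions `(±(√2 + 1), 0)` of the antipodes of the primaries. -/
def antipode (i : Fin 2) : Plane := !₂[-(side i * (√2 + 1)), 0]

/-- The numerator in the potential of a primary. -/
def potentialNum (i : Fin 2) (q : Plane) : ℝ := side i * q 0 - (‖q‖ ^ 2 - 1) / 2

/-- The potential of a primary, `-(1/2) cot` of the spherical distance to it. -/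
def potential (i : Fin 2) (q : Plane) : ℝ :=
  -(potentialNum i q / (dist q (primary i) * dist q (antipode i)))

/-- The configurations at which the problem is defined. -/
def configurations : Set Plane := {q | ∀ i, q ≠ primary i ∧ q ≠ antipode i}

/-- The Hamiltonian of the third body, as a function of `z = (q, p)`. -/
def hamiltonian (z : Plane × Plane) : ℝ :=
  (‖z.1‖ ^ 2 + 1) ^ 2 * ‖z.2‖ ^ 2 / 8 + (z.1 1 * z.2 0 - z.1 0 * z.2 1)
    + potential 0 z.1 + potential 1 z.1

/-- The first Lagrange point, over the north pole. -/
def lagrangePoint : Plane × Plane := (0, 0)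

/-- The energy level `H⁻¹(c)`. -/
def energyLevel (c : ℝ) : Set (Plane × Plane) := {z | z.1 ∈ configurations ∧ hamiltonian z = c}

/-- The component of `H⁻¹(c)` around a primary: the points whose connected component
in `H⁻¹(c)` has a projection to the `q`-plane that accumulates at the primary. -/
def energyComponent (i : Fin 2) (c : ℝ) : Set (Plane × Plane) :=
  {z ∈ energyLevel c | primary i ∈ closure (Prod.fst '' connectedComponentIn (energyLevel c) z)}

/-! ### Moser regularization -/

/-- The canonical map `(q, p) ↦ (ξ, η)` into `T*S²`: with `x = -p` and `y = q - q_{m_i}`, the point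
`ξ` is the inverse stereographic projection of `x` from the pole `(1, 0, 0)`, and `η dξ = y dx`. -/
def moserMap (i : Fin 2) (z : Plane × Plane) : Space × Space :=
  let x : Plane := -z.2
  let y : Plane := z.1 - primary i
  (!₂[(‖x‖ ^ 2 - 1) / (‖x‖ ^ 2 + 1), 2 * x 0 / (‖x‖ ^ 2 + 1), 2 * x 1 / (‖x‖ ^ 2 + 1)],
    !₂[⟪x, y⟫, (‖x‖ ^ 2 + 1) / 2 * y 0 - ⟪x, y⟫ * x 0, (‖x‖ ^ 2 + 1) / 2 * y 1 - ⟪x, y⟫ * x 1])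

/-- The position `q = q_{m_i} + y`, `y_k = η_k (1 - ξ_0) + ξ_k η_0`, as a function of `(ξ, η)`;
it extends smoothly to the collision fiber over `ξ = (1, 0, 0)`, with the value `q_{m_i}`. -/
def position (i : Fin 2) (w : Space × Space) : Plane :=
  primary i + !₂[w.2 1 * (1 - w.1 0) + w.1 1 * w.2 0, w.2 2 * (1 - w.1 0) + w.1 2 * w.2 0]

/-- The regularized Hamiltonian `Ẽ`, that is, `|q - q_{m_i}| (H - c)` in the variables `(ξ, η)`:
there `|y| |x|² = (1 + ξ_0) |η|`, `|y| x_k = ξ_k |η|` and `|y| = (1 - ξ_0) |η|`. -/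
def regularizedHamiltonian (i : Fin 2) (c : ℝ) (w : Space × Space) : ℝ :=
  let q := position i w
  ‖w.2‖ * ((‖q‖ ^ 2 + 1) ^ 2 * (1 + w.1 0) / 8 + (q 0 * w.1 2 - q 1 * w.1 1)
      + (1 - w.1 0) * (potential (other i) q - c))
    - potentialNum i q / dist q (antipode i)

/-- The zero level of `Ẽ` in `T*S²`, off the singularities that are not regularized (the other
primary and the two antipodes). -/
def regularizedLevel (i : Fin 2) (c : ℝ) : Set (Space × Space) :=
  {w ∈ cotangentSphere | (position i w ≠ primary (other i) ∧ ∀ j, position i w ≠ antipode j) ∧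
    regularizedHamiltonian i c w = 0}

/-- The Moser-regularized component of the energy level around a primary: the connected component
of `{Ẽ = 0}` that contains the image of the component of `H⁻¹(c)`. -/
def regularizedComponent (i : Fin 2) (c : ℝ) : Set (Space × Space) :=
  ⋃ z ∈ energyComponent i c, connectedComponentIn (regularizedLevel i c) (moserMap i z)

end CurvedThreeBody

end

/-!
Below the critical energy the motion near a primary is confined to the half of the unit disc around
it: on the boundary of this half disc the effective potential is at least `-1`, the energy of the
Lagrange point (`neg_one_le_hamiltonian`). Over the half disc, off the collision fiber, the
regularized Hamiltonian is `|q - q_m| (H - c)`. A ray in a cotangent fiber of `S²` corresponds to a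
fixed momentum and a position that leaves the primary along a straight line. So the whole theorem
rests on one inequality: wherever `H < -1` in the half disc, `H` is strictly increasing along
`q - q_m` at fixed momentum (`radial_derivative_pos`).

To prove the inequality, the momentum is replaced by the velocity `Q` in the rotating frame. The
derivative is then a quadratic polynomial in `Q`, and the energy bounds `|Q|²`. The linear term in
`Q` is absorbed by the inequality of arithmetic and geometric means. The distances to the primaries
and their antipodes are rational in elliptic coordinates `m`, `n` and one radical `l`. After
clearing denominators the claim reads `P + l R ≥ 0` with polynomials `P` and `R` on the unit square,
and both have nonnegative Bernstein coefficients (`evenPart_nonneg`, `oddPart_nonneg`).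

Consequently each ray meets the zero level over the half disc exactly once and transversally: the
regularized Hamiltonian is negative at the zero section, positive where the ray leaves the half
disc, and increasing at its zeros (`existsUnique_radius`). Such a radial level (`IsRadialLevel`) is
a hypersurface by the inverse function theorem. It is star-shaped, the Liouville form is a contact
form on it because the Liouville field is transverse to it, and the radial projection is a
diffeomorphism to the unit cotangent bundle. The latter is the rotation group, and the quaternions
identify it with `ℝP³` (`areDiffeomorphic_realProjectiveThreeSpace`).

It remains to see that the level over the half disc is the regularized component
(`regularizedComponent_eq`). It is connected, being an image of the unit cotangent bundle, and it is
open and closed in the whole level, which has no points over the boundary of the half disc. The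
Moser map takes the energy component into it. The energy component is not empty, because a curve in
the level that tends to the collision fiber has positions that tend to the primary.
-/

noncomputable section

namespace CurvedThreeBody

/-! ### Regular level sets in normed spaces -/

section Straightening

variable {V V' G : Type*} [NormedAddCommGroup V] [NormedSpace ℝ V] [CompleteSpace V]
  [NormedAddCommGroup V'] [NormedSpace ℝ V']
  [NormedAddCommGroup G] [NormedSpace ℝ G]

/-- The smooth inverse function theorem, with a neighborhood on which the map and its inverse
are smooth. -/
theorem exists_smooth_openPartialHomeomorph {f : V → V'} {O : Set V} (hO : IsOpen O)
    (hf : ContDiffOn ℝ ∞ f O) {x : V} (hx : x ∈ O) (e : V ≃L[ℝ] V')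
    (he : HasFDerivAt f (e : V →L[ℝ] V') x) :
    ∃ Φ : OpenPartialHomeomorph V V', (∀ z, Φ z = f z) ∧ x ∈ Φ.source ∧ Φ.source ⊆ O ∧
      ContDiffOn ℝ ∞ Φ Φ.source ∧ ContDiffOn ℝ ∞ Φ.symm Φ.target := by
  have hfx : ContDiffAt ℝ ∞ f x := hf.contDiffAt (hO.mem_nhds hx)
  have hne : (∞ : WithTop ℕ∞) ≠ 0 := by simp
  have hdf : ContinuousOn (fderiv ℝ f) O := hf.continuousOn_fderiv_of_isOpen hO (by simp)
  obtain ⟨O', hO'⟩ : ∃ O', O' = O ∩ fderiv ℝ f ⁻¹' range ((↑) : (V ≃L[ℝ] V') → V →L[ℝ] V') :=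
    ⟨_, rfl⟩
  have hO'o : IsOpen O' := by
    rw [hO']; exact hdf.isOpen_inter_preimage hO ContinuousLinearEquiv.isOpen
  let Φ₀ := hfx.toOpenPartialHomeomorph f he hne
  have hΦ₀ : ∀ z, Φ₀ z = f z := fun z => rfl
  let Φ := Φ₀.restrOpen O' hO'o
  have hΦ : ∀ z, Φ z = f z := fun z => rfl
  have hsrc : Φ.source = Φ₀.source ∩ O' := rfl
  have hsub : Φ.source ⊆ O := by rw [hsrc, hO']; exact fun z hz => hz.2.1
  refine ⟨Φ, hΦ, ?_, hsub, ?_, ?_⟩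
  · rw [hsrc]
    refine ⟨hfx.mem_toOpenPartialHomeomorph_source he hne, ?_⟩
    rw [hO']; exact ⟨hx, e, he.fderiv.symm⟩
  · exact (hf.mono hsub).congr fun z _ => hΦ z
  · intro y hy
    have hs : Φ.symm y ∈ Φ.source := Φ.map_target hy
    have hs' := hs
    rw [hsrc, hO'] at hs'
    obtain ⟨e', he'⟩ := hs'.2.2
    have hc : ContDiffAt ℝ ∞ f (Φ.symm y) := hf.contDiffAt (hO.mem_nhds (hsub hs))
    refine (Φ.contDiffAt_symm (f₀' := e') hy ?_ hc).contDiffWithinAt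
    rw [he']; exact (hc.differentiableAt hne).hasFDerivAt

variable [FiniteDimensional ℝ G]

/-- Near a regular zero `x` of `F`, the zero set of `F` is straightened to the kernel of the
derivative of `F` at `x` by a diffeomorphism whose derivative at `x` is the identity, namely
`z ↦ z + R (F z - F'(x) z)` with a right inverse `R` of `F'(x)`. -/
theorem exists_straightening {F : V → G} {O : Set V} (hO : IsOpen O) (hF : ContDiffOn ℝ ∞ F O)
    {x : V} (hx : x ∈ O) (hsurj : Function.Surjective (fderiv ℝ F x)) :
    ∃ Φ : OpenPartialHomeomorph V V, x ∈ Φ.source ∧ Φ.source ⊆ O ∧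
      ContDiffOn ℝ ∞ Φ Φ.source ∧ ContDiffOn ℝ ∞ Φ.symm Φ.target ∧
      (∀ z, fderiv ℝ F x (Φ z) = F z) ∧ HasFDerivAt Φ (ContinuousLinearMap.id ℝ V) x := by
  obtain ⟨L, hL⟩ : ∃ L, L = fderiv ℝ F x := ⟨_, rfl⟩
  rw [← hL] at hsurj
  obtain ⟨R₀, hR₀⟩ := LinearMap.exists_rightInverse_of_surjective (L : V →ₗ[ℝ] G)
    (LinearMap.range_eq_top.2 hsurj)
  obtain ⟨R, hR'⟩ : ∃ R : G →L[ℝ] V, R = LinearMap.toContinuousLinearMap R₀ := ⟨_, rfl⟩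
  have hR : ∀ y, L (R y) = y := fun y => by
    rw [hR']; exact LinearMap.congr_fun hR₀ y
  obtain ⟨f, hf⟩ : ∃ f : V → V, f = fun z => z + R (F z - L z) := ⟨_, rfl⟩
  have hfs : ContDiffOn ℝ ∞ f O := by
    rw [hf]
    exact contDiffOn_id.add (R.contDiff.comp_contDiffOn (hF.sub L.contDiff.contDiffOn))
  have hFx : HasFDerivAt F L x := by
    rw [hL]
    exact ((hF.contDiffAt (hO.mem_nhds hx)).differentiableAt (by simp)).hasFDerivAt
  have hfx : HasFDerivAt f (ContinuousLinearMap.id ℝ V) x := by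
    have := (hasFDerivAt_id (𝕜 := ℝ) x).add (R.hasFDerivAt.comp x (hFx.sub L.hasFDerivAt))
    rw [hf]
    refine this.congr_fderiv ?_
    ext v; simp
  obtain ⟨Φ, h1, h2, h3, h4, h5⟩ := exists_smooth_openPartialHomeomorph hO hfs hx
    (ContinuousLinearEquiv.refl ℝ V) (by simpa using hfx)
  have h1' : (Φ : V → V) = f := funext h1
  refine ⟨Φ, h2, h3, h4, h5, fun z => ?_, ?_⟩
  · rw [← hL, h1, hf]; simp [hR]
  · rw [h1']; exact hfx

theorem isSubmanifold_of_regular [FiniteDimensional ℝ V] {F : V → G} {O S : Set V} (hO : IsOpen O)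
    (hF : ContDiffOn ℝ ∞ F O) (hS : S = {z ∈ O | F z = 0})
    (hsurj : ∀ x ∈ S, Function.Surjective (fderiv ℝ F x)) {d : ℕ}
    (hd : Module.finrank ℝ V = d + Module.finrank ℝ G) : IsSubmanifold d S := by
  intro x hxS
  have hx : x ∈ O := by rw [hS] at hxS; exact hxS.1
  obtain ⟨Φ, h1, h2, h3, h4, h5, -⟩ := exists_straightening hO hF hx (hsurj x hxS)
  refine ⟨Φ, LinearMap.ker (fderiv ℝ F x : V →ₗ[ℝ] G), h1, h3, h4, ?_, ?_⟩
  · have := LinearMap.finrank_range_add_finrank_ker (fderiv ℝ F x : V →ₗ[ℝ] G)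
    rw [LinearMap.range_eq_top.2 (hsurj x hxS), finrank_top] at this
    omega
  · ext y
    constructor
    · rintro ⟨z, ⟨hz, hzs⟩, rfl⟩
      rw [hS] at hz
      exact ⟨by simp [h5, hz.2], Φ.map_source hzs⟩
    · rintro ⟨hy, hyt⟩
      refine ⟨Φ.symm y, ⟨?_, Φ.map_target hyt⟩, Φ.right_inv hyt⟩
      rw [hS]
      refine ⟨h2 (Φ.map_target hyt), ?_⟩
      rw [← h5, Φ.right_inv hyt]
      simpa using hy

theorem mem_tangentVectors_iff {F : V → G} {O S : Set V} (hO : IsOpen O)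
    (hF : ContDiffOn ℝ ∞ F O) (hS : S = {z ∈ O | F z = 0}) {x : V} (hxS : x ∈ S)
    (hsurj : Function.Surjective (fderiv ℝ F x)) {v : V} :
    v ∈ tangentVectors S x ↔ fderiv ℝ F x v = 0 := by
  have hx : x ∈ O ∧ F x = 0 := by rw [hS] at hxS; exact hxS
  have hFx : HasFDerivAt F (fderiv ℝ F x) x :=
    ((hF.contDiffAt (hO.mem_nhds hx.1)).differentiableAt (by simp)).hasFDerivAt
  constructor
  · rintro ⟨γ, -, h0, hγ, hv⟩
    rw [← h0] at hFx
    have h1 : HasDerivAt (F ∘ γ) (fderiv ℝ F (γ 0) v) 0 := hFx.comp_hasDerivAt 0 hv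
    have h2 : (F ∘ γ) =ᶠ[𝓝 0] fun _ => 0 := by
      filter_upwards [hγ] with t ht
      rw [hS] at ht; exact ht.2
    rw [← h0]
    exact h1.unique ((hasDerivAt_const 0 (0 : G)).congr_of_eventuallyEq h2)
  · intro hv
    obtain ⟨Φ, h1, h2, h3, h4, h5, h6⟩ := exists_straightening hO hF hx.1 hsurj
    have ht : Φ x ∈ Φ.target := Φ.map_source h1
    -- A curve in `Φ x + ℝ v` with velocity `v` at time `0`; the sine keeps it in the target of `Φ`
    -- for all times.
    have hcont : Tendsto (fun s : ℝ => Φ x + s • v) (𝓝 0) (𝓝 (Φ x)) := by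
      have : Continuous fun s : ℝ => Φ x + s • v := by fun_prop
      simpa using this.tendsto 0
    obtain ⟨ε, hε, hball⟩ := Metric.eventually_nhds_iff.1
      (hcont.eventually (Φ.open_target.mem_nhds ht))
    obtain ⟨g, hg⟩ : ∃ g : ℝ → V, g = fun t => Φ x + (ε / 2 * Real.sin (t / (ε / 2))) • v :=
      ⟨_, rfl⟩
    have hg0 : g 0 = Φ x := by simp [hg]
    have hgt : ∀ t, g t ∈ Φ.target := fun t => by
      rw [hg]
      refine hball ?_
      rw [dist_zero_right, Real.norm_eq_abs, abs_mul, abs_of_pos (half_pos hε)]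
      have := Real.abs_sin_le_one (t / (ε / 2))
      nlinarith
    have hgs : ContDiff ℝ ∞ g := by
      rw [hg]
      exact contDiff_const.add ((contDiff_const.mul
        (Real.contDiff_sin.comp (contDiff_id.div_const _))).smul contDiff_const)
    have hgd : HasDerivAt g v 0 := by
      have h7 : HasDerivAt (fun t : ℝ => ε / 2 * Real.sin (t / (ε / 2))) 1 0 := by
        have := ((Real.hasDerivAt_sin (0 / (ε / 2))).comp (0 : ℝ)
          ((hasDerivAt_id (0 : ℝ)).div_const (ε / 2))).const_mul (ε / 2)
        refine this.congr_deriv ?_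
        simp; field_simp
      have := (h7.smul_const v).const_add (Φ x)
      rw [hg]; simpa using this
    refine ⟨Φ.symm ∘ g, h4.comp_contDiff hgs hgt, ?_, .of_forall fun t => ?_, ?_⟩
    · simp [hg0, Φ.left_inv h1]
    · rw [hS]
      refine ⟨h2 (Φ.map_target (hgt t)), ?_⟩
      rw [← h5, Function.comp, Φ.right_inv (hgt t), hg]
      simp [hv, h5, hx.2]
    · have h8 : HasFDerivAt Φ.symm (ContinuousLinearMap.id ℝ V) (g 0) := by
        rw [hg0]
        have := Φ.hasFDerivAt_symm (f' := ContinuousLinearEquiv.refl ℝ V) ht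
          (by rw [Φ.left_inv h1]; simpa using h6)
        simpa using this
      simpa using h8.comp_hasDerivAt 0 hgd

end Straightening

/-! ### Radial level sets in the cotangent bundle of the sphere -/

/-- `S` is the zero level in `T*S²` of a smooth function `E` on an open set `Ω` off the zero
section, `E` is strictly increasing along the fibers at its zeros, and each open ray from the
origin of a fiber contains exactly one zero. -/
structure IsRadialLevel (Ω : Set (Space × Space)) (E : Space × Space → ℝ)
    (S : Set (Space × Space)) : Prop where
  isOpen : IsOpen Ω
  contDiffOn : ContDiffOn ℝ ∞ E Ω
  ne_zero : ∀ z ∈ Ω, z.2 ≠ 0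
  eq : S = {z | z ∈ cotangentSphere ∧ z ∈ Ω ∧ E z = 0}
  radial_pos : ∀ z ∈ S, 0 < fderiv ℝ E z (0, z.2)
  existsUnique : ∀ z ∈ unitCotangentSphere, ∃! r : ℝ, 0 < r ∧ (z.1, r • z.2) ∈ S

/-- The defining function of a level set of `E` in `T*S²`. -/
def levelMap (E : Space × Space → ℝ) (z : Space × Space) : ℝ × ℝ × ℝ :=
  (⟪z.1, z.1⟫ - 1, ⟪z.1, z.2⟫, E z)

theorem mem_cotangentSphere_iff {z : Space × Space} :
    z ∈ cotangentSphere ↔ ⟪z.1, z.1⟫ = 1 ∧ ⟪z.1, z.2⟫ = 0 := by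
  rw [real_inner_self_eq_norm_sq]
  refine and_congr_left fun _ => ?_
  rw [pow_eq_one_iff_of_nonneg (norm_nonneg _) two_ne_zero]

theorem smul_mem_cotangentSphere {z : Space × Space} (hz : z ∈ cotangentSphere) (r : ℝ) :
    (z.1, r • z.2) ∈ cotangentSphere :=
  ⟨hz.1, by simp [inner_smul_right, hz.2]⟩

namespace IsRadialLevel

variable {Ω S : Set (Space × Space)} {E : Space × Space → ℝ} (h : IsRadialLevel Ω E S)
include h

theorem subset : S ⊆ Ω := by rw [h.eq]; exact fun z hz => hz.2.1

theorem eq_levelMap : S = {z ∈ Ω | levelMap E z = 0} := by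
  rw [h.eq]
  ext z
  simp only [mem_ofPred_eq, mem_cotangentSphere_iff, levelMap, Prod.mk_eq_zero, sub_eq_zero]
  tauto

theorem contDiffOn_levelMap : ContDiffOn ℝ ∞ (levelMap E) Ω := by
  have h1 : ContDiff ℝ ∞ fun z : Space × Space => ⟪z.1, z.1⟫ - 1 :=
    (contDiff_fst.inner ℝ contDiff_fst).sub contDiff_const
  have h2 : ContDiff ℝ ∞ fun z : Space × Space => ⟪z.1, z.2⟫ := contDiff_fst.inner ℝ contDiff_snd
  exact h1.contDiffOn.prodMk (h2.contDiffOn.prodMk h.contDiffOn)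

theorem fderiv_levelMap {z : Space × Space} (hz : z ∈ S) (v : Space × Space) :
    fderiv ℝ (levelMap E) z v
      = (2 * ⟪z.1, v.1⟫, ⟪z.1, v.2⟫ + ⟪v.1, z.2⟫, fderiv ℝ E z v) := by
  have hE : HasFDerivAt E (fderiv ℝ E z) z :=
    ((h.contDiffOn.contDiffAt (h.isOpen.mem_nhds (h.subset hz))).differentiableAt
      (by simp)).hasFDerivAt
  have h1 := ((hasFDerivAt_fst (𝕜 := ℝ) (p := z)).inner ℝ
    (hasFDerivAt_fst (𝕜 := ℝ) (p := z))).sub_const 1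
  have h2 := (hasFDerivAt_fst (𝕜 := ℝ) (p := z)).inner ℝ (hasFDerivAt_snd (𝕜 := ℝ) (p := z))
  have h3 : HasFDerivAt (levelMap E) _ z := h1.prodMk (h2.prodMk hE)
  rw [h3.fderiv]
  ext <;> simp [real_inner_comm]
  ring

theorem surjective_fderiv {z : Space × Space} (hz : z ∈ S) :
    Function.Surjective (fderiv ℝ (levelMap E) z) := by
  rintro ⟨a, b, c⟩
  have hz' := hz
  rw [h.eq] at hz'
  have h2 := hz'.1.2
  have h3 := (h.radial_pos z hz).ne'
  obtain ⟨t, ht⟩ : ∃ t, t = (c - fderiv ℝ E z ((a / 2) • z.1, b • z.1)) / fderiv ℝ E z (0, z.2) :=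
    ⟨_, rfl⟩
  refine ⟨((a / 2) • z.1, b • z.1) + t • ((0 : Space), z.2), ?_⟩
  rw [h.fderiv_levelMap hz, map_add, map_smul, ht]
  ext
  · simp [inner_smul_right, hz'.1.1]; ring
  · simp [inner_smul_right, inner_smul_left, inner_add_right, hz'.1.1, h2]
  · simp only [smul_eq_mul]; field_simp; ring

theorem isHypersurface : IsHypersurface S := by
  refine ⟨by rw [h.eq]; exact fun z hz => hz.1, ?_⟩
  refine isSubmanifold_of_regular h.isOpen h.contDiffOn_levelMap h.eq_levelMap
    (fun x hx => h.surjective_fderiv hx) ?_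
  simp

theorem mem_tangentVectors {z : Space × Space} (hz : z ∈ S) {v : Space × Space} :
    v ∈ tangentVectors S z ↔
      ⟪z.1, v.1⟫ = 0 ∧ ⟪z.1, v.2⟫ + ⟪v.1, z.2⟫ = 0 ∧ fderiv ℝ E z v = 0 := by
  rw [mem_tangentVectors_iff h.isOpen h.contDiffOn_levelMap h.eq_levelMap hz
    (h.surjective_fderiv hz), h.fderiv_levelMap hz]
  simp

theorem isFiberwiseStarShaped : IsFiberwiseStarShaped S := by
  refine ⟨fun z hz => h.ne_zero z (h.subset hz), h.existsUnique, fun z hz hv => ?_⟩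
  exact (h.radial_pos z hz).ne' ((h.mem_tangentVectors hz).1 hv).2.2

/-- The Liouville form `η dξ` is a contact form: a characteristic vector that it annihilates is
`ω`-orthogonal to the whole tangent space of `T*S²`, because the Liouville field is transverse to
the hypersurface, and `ω` is nondegenerate on `T*S²`. -/
theorem isContactType : IsContactType S := by
  let α : Space × Space →L[ℝ] (Space × Space →L[ℝ] ℝ) :=
    ((innerSL ℝ).comp (ContinuousLinearMap.snd ℝ Space Space)).flip.comp
      (ContinuousLinearMap.fst ℝ Space Space) |>.flip
  have hα : ∀ z v : Space × Space, α z v = ⟪z.2, v.1⟫ := fun z v => by simp [α]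
  refine ⟨univ, α, isOpen_univ, subset_univ _, α.contDiff.contDiffOn, ?_, ?_⟩
  · intro z _ v _ w _
    rw [α.hasFDerivAt.fderiv]
    simp [hα, symplecticForm]
  · intro z hz v hv hv0 hker hαv
    rw [hα] at hαv
    have hz' := hz
    rw [h.eq] at hz'
    have h2 := hz'.1.2
    obtain ⟨hv1, hv2, -⟩ := (h.mem_tangentVectors hz).1 hv
    have h3 := (h.radial_pos z hz).ne'
    have hall : ∀ w : Space × Space, ⟪z.1, w.1⟫ = 0 → ⟪z.1, w.2⟫ + ⟪w.1, z.2⟫ = 0 →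
        symplecticForm v w = 0 := by
      intro w hw1 hw2
      have := hker (w - (fderiv ℝ E z w / fderiv ℝ E z (0, z.2)) • ((0 : Space), z.2)) ?_
      · simpa [symplecticForm, inner_sub_left, inner_smul_left, hαv] using this
      · rw [h.mem_tangentVectors hz, map_sub, map_smul]
        refine ⟨by simp [hw1], by simp [inner_sub_right, inner_smul_right, h2, hw2], ?_⟩
        simp only [smul_eq_mul]; field_simp; ring
    have hv1' : v.1 = 0 := by
      have := hall (0, v.1) (by simp) (by simp [hv1])
      simpa [symplecticForm] using this
    have hv2' : v.2 = 0 := by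
      rw [hv1', inner_zero_left, add_zero] at hv2
      have := hall (v.2, -(⟪v.2, z.2⟫ • z.1)) hv2 (by simp [inner_smul_right, hz'.1.1])
      simpa [symplecticForm, hv1'] using this
    exact hv0 (Prod.ext hv1' hv2')

end IsRadialLevel

/-! ### Compositions of diffeomorphisms and the radial projection -/

section Diffeomorphic

variable {E : Type*} [NormedAddCommGroup E] [NormedSpace ℝ E]
  {H : Type*} [TopologicalSpace H] {I : ModelWithCorners ℝ E H}
  {X : Type*} [TopologicalSpace X] [ChartedSpace H X]
  {E' : Type*} [NormedAddCommGroup E'] [NormedSpace ℝ E']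
  {H' : Type*} [TopologicalSpace H'] {J : ModelWithCorners ℝ E' H'}
  {Y : Type*} [TopologicalSpace Y] [ChartedSpace H' Y]
  {E'' : Type*} [NormedAddCommGroup E''] [NormedSpace ℝ E'']
  {H'' : Type*} [TopologicalSpace H''] {K : ModelWithCorners ℝ E'' H''}
  {Z : Type*} [TopologicalSpace Z] [ChartedSpace H'' Z]

theorem SmoothOnSubset.comp {f : X → Y} {g : Y → Z} {A : Set X} {B : Set Y}
    (hg : SmoothOnSubset J K g B) (hf : SmoothOnSubset I J f A) (h : MapsTo f A B) :
    SmoothOnSubset I K (g ∘ f) A := by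
  intro x hx
  obtain ⟨U, f', hU, hxU, hf', hff'⟩ := hf x hx
  obtain ⟨V, g', hV, hxV, hg', hgg'⟩ := hg (f x) (h hx)
  refine ⟨U ∩ f' ⁻¹' V, g' ∘ f', hf'.continuousOn.isOpen_inter_preimage hU hV,
    ⟨hxU, ?_⟩, hg'.comp (hf'.mono inter_subset_left) inter_subset_right, ?_⟩
  · rw [mem_preimage, ← hff' ⟨hx, hxU⟩]; exact hxV
  · rintro y ⟨hyA, hyU, hyV⟩
    have := hff' ⟨hyA, hyU⟩
    rw [mem_preimage, ← this] at hyV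
    simp only [Function.comp]
    rw [← this]; exact hgg' ⟨h hyA, hyV⟩

theorem SmoothOnSubset.continuousOn {f : X → Y} {A : Set X} (hf : SmoothOnSubset I J f A) :
    ContinuousOn f A := by
  intro x hx
  obtain ⟨U, f', hU, hxU, hf', hff'⟩ := hf x hx
  have h1 : ContinuousWithinAt f' (A ∩ U) x :=
    (hf'.continuousOn x hxU).mono inter_subset_right
  have h2 : ContinuousWithinAt f (A ∩ U) x := h1.congr hff' (hff' ⟨hx, hxU⟩)
  exact (continuousWithinAt_inter (hU.mem_nhds hxU)).1 h2

theorem AreDiffeomorphic.trans {A : Set X} {B : Set Y} {C : Set Z}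
    (h₁ : AreDiffeomorphic I J A B) (h₂ : AreDiffeomorphic J K B C) : AreDiffeomorphic I K A C := by
  obtain ⟨f, g, hf, hg, hgf, hfg, sf, sg⟩ := h₁
  obtain ⟨f', g', hf', hg', hgf', hfg', sf', sg'⟩ := h₂
  refine ⟨f' ∘ f, g ∘ g', hf'.comp hf, hg.comp hg', ?_, ?_, sf'.comp sf hf, sg.comp sg' hg'⟩
  · intro x hx; simp only [Function.comp]; rw [hgf' (hf hx), hgf hx]
  · intro x hx; simp only [Function.comp]; rw [hfg (hg' hx), hfg' hx]

end Diffeomorphic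

theorem isCompact_unitCotangentSphere : IsCompact unitCotangentSphere := by
  have h : IsClosed unitCotangentSphere := by
    have : unitCotangentSphere = {z : Space × Space | ‖z.1‖ = 1} ∩ {z | ⟪z.1, z.2⟫ = 0}
        ∩ {z | ‖z.2‖ = 1} := rfl
    rw [this]
    exact ((isClosed_eq (by fun_prop) continuous_const).inter
      (isClosed_eq (by fun_prop) continuous_const)).inter
        (isClosed_eq (by fun_prop) continuous_const)
  refine (isCompact_closedBall (0 : Space × Space) 1).of_isClosed_subset h fun z hz => ?_
  rw [mem_closedBall_zero_iff, Prod.norm_def]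
  exact max_le hz.1.1.le hz.2.le

namespace IsRadialLevel

variable {Ω S : Set (Space × Space)} {E : Space × Space → ℝ} (h : IsRadialLevel Ω E S)
include h

/-- Near a point of the unit cotangent bundle, the radius at which a ray meets the level set
extends to a smooth function, by the implicit function theorem for `(u, r) ↦ E (u.1, r u.2)`. -/
theorem exists_smooth_radius {u₀ : Space × Space} {r₀ : ℝ}
    (hr₀ : 0 < r₀) (hS : (u₀.1, r₀ • u₀.2) ∈ S) :
    ∃ (U : Set (Space × Space)) (ρ : Space × Space → ℝ), IsOpen U ∧ u₀ ∈ U ∧ ContDiffOn ℝ ∞ ρ U ∧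
      ∀ u ∈ unitCotangentSphere ∩ U, 0 < ρ u ∧ (u.1, ρ u • u.2) ∈ S := by
  obtain ⟨j, hj⟩ : ∃ j : (Space × Space) × ℝ → Space × Space, j = fun a => (a.1.1, a.2 • a.1.2) :=
    ⟨_, rfl⟩
  have hjs : ContDiff ℝ ∞ j := by
    rw [hj]
    exact (contDiff_fst.fst).prodMk (contDiff_snd.smul contDiff_fst.snd)
  obtain ⟨O, hO⟩ : ∃ O, O = j ⁻¹' Ω := ⟨_, rfl⟩
  have hOo : IsOpen O := by rw [hO]; exact h.isOpen.preimage hjs.continuous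
  obtain ⟨Ψ, hΨ⟩ : ∃ Ψ : (Space × Space) × ℝ → (Space × Space) × ℝ, Ψ = fun a => (a.1, E (j a)) :=
    ⟨_, rfl⟩
  have hΨs : ContDiffOn ℝ ∞ Ψ O := by
    rw [hΨ]
    exact contDiffOn_fst.prodMk (h.contDiffOn.comp hjs.contDiffOn
      fun a ha => by rw [hO] at ha; exact ha)
  have hj₀ : j (u₀, r₀) = (u₀.1, r₀ • u₀.2) := by rw [hj]
  have ha : (u₀, r₀) ∈ O := by rw [hO, mem_preimage, hj₀]; exact h.subset hS
  obtain ⟨D, hD⟩ : ∃ D, D = fderiv ℝ Ψ (u₀, r₀) := ⟨_, rfl⟩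
  have hΨd : HasFDerivAt Ψ D (u₀, r₀) := by
    rw [hD]
    exact ((hΨs.contDiffAt (hOo.mem_nhds ha)).differentiableAt (by simp)).hasFDerivAt
  have hDv : ∀ v, D v = (v.1, fderiv ℝ E (j (u₀, r₀)) (v.1.1, r₀ • v.1.2 + v.2 • u₀.2)) := by
    obtain ⟨j', h1, hj'⟩ : ∃ j', HasFDerivAt (𝕜 := ℝ) j j' (u₀, r₀) ∧
        ∀ v, j' v = (v.1.1, r₀ • v.1.2 + v.2 • u₀.2) := by
      rw [hj]
      exact ⟨_, ((hasFDerivAt_fst (𝕜 := ℝ) (p := (u₀, r₀))).fst).prodMk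
        ((hasFDerivAt_snd (𝕜 := ℝ) (p := (u₀, r₀))).smul
          (hasFDerivAt_fst (𝕜 := ℝ) (p := (u₀, r₀))).snd), fun v => by simp⟩
    have hE : HasFDerivAt E (fderiv ℝ E (j (u₀, r₀))) (j (u₀, r₀)) := by
      have : j (u₀, r₀) ∈ Ω := by rw [hO] at ha; exact ha
      exact ((h.contDiffOn.contDiffAt (h.isOpen.mem_nhds this)).differentiableAt
        (by simp)).hasFDerivAt
    have h2 : HasFDerivAt Ψ ((ContinuousLinearMap.fst ℝ _ ℝ).prod
        ((fderiv ℝ E (j (u₀, r₀))).comp j')) (u₀, r₀) := by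
      rw [hΨ]
      exact (hasFDerivAt_fst (𝕜 := ℝ) (p := (u₀, r₀))).prodMk (hE.comp (u₀, r₀) h1)
    intro v
    rw [hΨd.unique h2]
    simp [hj']
  have hc : 0 < fderiv ℝ E (j (u₀, r₀)) (0, u₀.2) := by
    have := h.radial_pos _ hS
    rw [hj₀]
    rw [show ((0 : Space), (u₀.1, r₀ • u₀.2).2) = r₀ • ((0 : Space), u₀.2) by simp,
      map_smul] at this
    exact (mul_pos_iff_of_pos_left hr₀).1 this
  have hinj : Function.Injective D := by
    rw [injective_iff_map_eq_zero]
    rintro ⟨v, s⟩ hv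
    rw [hDv] at hv
    have hv0 : v = 0 := congrArg Prod.fst hv
    subst hv0
    have h2 := congrArg Prod.snd hv
    simp only [Prod.fst_zero, Prod.snd_zero, smul_zero, zero_add] at h2
    rw [show ((0 : Space), s • u₀.2) = s • ((0 : Space), u₀.2) by simp, map_smul] at h2
    have : s = 0 := (mul_eq_zero.1 h2).resolve_right hc.ne'
    simp [this]
  let e : ((Space × Space) × ℝ) ≃L[ℝ] ((Space × Space) × ℝ) :=
    (LinearEquiv.ofInjectiveEndo (D : (Space × Space) × ℝ →ₗ[ℝ] (Space × Space) × ℝ)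
      hinj).toContinuousLinearEquiv
  have he : (e : (Space × Space) × ℝ →L[ℝ] (Space × Space) × ℝ) = D := by ext v <;> rfl
  obtain ⟨Φ, h1, h2, h3, -, h5⟩ :=
    exists_smooth_openPartialHomeomorph hOo hΨs ha e (by rw [he]; exact hΨd)
  have hE0 : ∀ {z}, z ∈ S → E z = 0 := fun hz => by rw [h.eq] at hz; exact hz.2.2
  have hΦ₀ : Φ (u₀, r₀) = (u₀, 0) := by rw [h1, hΨ]; simp [hj₀, hE0 hS]
  have hi : Continuous fun u : Space × Space => (u, (0 : ℝ)) := by fun_prop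
  obtain ⟨T, hT⟩ : ∃ T, T = (fun u : Space × Space => (u, (0 : ℝ))) ⁻¹' Φ.target := ⟨_, rfl⟩
  have hTo : IsOpen T := by rw [hT]; exact Φ.open_target.preimage hi
  obtain ⟨ρ, hρ⟩ : ∃ ρ : Space × Space → ℝ, ρ = fun u => (Φ.symm (u, 0)).2 := ⟨_, rfl⟩
  have hρs : ContDiffOn ℝ ∞ ρ T := by
    rw [hρ]
    exact (contDiff_snd (𝕜 := ℝ) (E := Space × Space) (F := ℝ)).comp_contDiffOn
      (h5.comp (contDiff_id.prodMk contDiff_const).contDiffOn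
        fun u hu => by rw [hT] at hu; exact hu)
  refine ⟨T ∩ ρ ⁻¹' Ioi 0, ρ, hρs.continuousOn.isOpen_inter_preimage hTo isOpen_Ioi, ⟨?_, ?_⟩,
    hρs.mono inter_subset_left, ?_⟩
  · rw [hT, mem_preimage, ← hΦ₀]; exact Φ.map_source h2
  · rw [mem_preimage, hρ]
    show 0 < (Φ.symm (u₀, 0)).2
    rw [← hΦ₀, Φ.left_inv h2]; exact hr₀
  · rintro u ⟨hu, huT, huρ⟩
    refine ⟨huρ, ?_⟩
    rw [hT] at huT
    have h6 := Φ.right_inv huT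
    have h7 : Φ.symm (u, 0) ∈ O := h3 (Φ.map_target huT)
    rw [h1, hΨ] at h6
    have h8 : (Φ.symm (u, 0)).1 = u := congrArg Prod.fst h6
    have h9 : E (j (Φ.symm (u, 0))) = 0 := congrArg Prod.snd h6
    have h10 : j (Φ.symm (u, 0)) = (u.1, ρ u • u.2) := by rw [hj, hρ]; simp only [h8]
    rw [hO, mem_preimage, h10] at h7
    rw [h10] at h9
    rw [h.eq]
    exact ⟨smul_mem_cotangentSphere hu.1 _, h7, h9⟩

/-- The radius at which the rays of the unit cotangent bundle meet the level set. -/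
theorem exists_radius : ∃ ρ : Space × Space → ℝ,
    (∀ u ∈ unitCotangentSphere, 0 < ρ u ∧ (u.1, ρ u • u.2) ∈ S ∧
      ∀ r, 0 < r → (u.1, r • u.2) ∈ S → r = ρ u) ∧
    SmoothOnSubset 𝓘(ℝ, Space × Space) 𝓘(ℝ, ℝ) ρ unitCotangentSphere := by
  choose! ρ hρ hρ' using h.existsUnique
  refine ⟨ρ, fun u hu => ⟨(hρ u hu).1, (hρ u hu).2, fun r h0 hr => hρ' u hu r ⟨h0, hr⟩⟩, ?_⟩
  intro u hu
  obtain ⟨U, σ, hU, huU, hσ, hσS⟩ := h.exists_smooth_radius (hρ u hu).1 (hρ u hu).2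
  exact ⟨U, σ, hU, huU, hσ.contMDiffOn, fun w hw => (hρ' w hw.1 _ (hσS w hw)).symm⟩

/-- The radial projection is a diffeomorphism to the unit cotangent bundle. -/
theorem areDiffeomorphic_unitCotangentSphere :
    AreDiffeomorphic 𝓘(ℝ, Space × Space) 𝓘(ℝ, Space × Space) S unitCotangentSphere := by
  obtain ⟨ρ, hρ, hρs⟩ := h.exists_radius
  have hS : ∀ {z}, z ∈ S → z ∈ cotangentSphere ∧ z.2 ≠ 0 := fun {z} hz =>
    ⟨by rw [h.eq] at hz; exact hz.1, h.ne_zero z (h.subset hz)⟩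
  have hf : ∀ {z}, z ∈ S → (z.1, ‖z.2‖⁻¹ • z.2) ∈ unitCotangentSphere := fun {z} hz =>
    ⟨smul_mem_cotangentSphere (hS hz).1 _, by
      have := norm_ne_zero_iff.2 (hS hz).2
      rw [norm_smul, norm_inv, norm_norm, inv_mul_cancel₀ this]⟩
  refine ⟨fun z => (z.1, ‖z.2‖⁻¹ • z.2), fun u => (u.1, ρ u • u.2), fun z hz => hf hz,
    fun u hu => (hρ u hu).2.1, fun z hz => ?_, fun u hu => ?_, fun z hz => ?_, fun u hu => ?_⟩
  · have h0 := norm_pos_iff.2 (hS hz).2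
    have := (hρ _ (hf hz)).2.2 ‖z.2‖ h0 (by simpa [smul_smul, h0.ne'] using hz)
    simp only
    rw [← this, smul_smul, mul_inv_cancel₀ h0.ne', one_smul]
  · have h0 := (hρ u hu).1
    have h1 : ‖u.2‖ = 1 := hu.2
    simp only [norm_smul, h1, Real.norm_eq_abs, abs_of_pos h0, smul_smul, mul_one,
      inv_mul_cancel₀ h0.ne', one_smul]
  · refine ⟨{z | z.2 ≠ 0}, _, isOpen_ne.preimage continuous_snd, (hS hz).2, ?_, fun w _ => rfl⟩
    refine ContDiffOn.contMDiffOn fun w hw => ?_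
    have : ContDiffAt ℝ ∞ (fun z : Space × Space => ‖z.2‖) w := contDiffAt_snd.norm ℝ hw
    exact (contDiffAt_fst.prodMk
      ((this.inv (norm_ne_zero_iff.2 hw)).smul contDiffAt_snd)).contDiffWithinAt
  · obtain ⟨U, σ, hU, huU, hσ, hσρ⟩ := hρs u hu
    refine ⟨U, fun u => (u.1, σ u • u.2), hU, huU, ?_, fun w hw => by simp only [hσρ hw]⟩
    exact (contDiff_fst.contDiffOn.prodMk
      (hσ.contDiffOn.smul contDiff_snd.contDiffOn)).contMDiffOn

theorem exists_continuousOn_radius : ∃ ρ : Space × Space → ℝ,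
    ContinuousOn ρ unitCotangentSphere ∧
    (fun u => (u.1, ρ u • u.2)) '' unitCotangentSphere = S := by
  obtain ⟨ρ, hρ, hρs⟩ := h.exists_radius
  refine ⟨ρ, hρs.continuousOn, ?_⟩
  ext z
  constructor
  · rintro ⟨u, hu, rfl⟩; exact (hρ u hu).2.1
  · intro hz
    have h0 := norm_pos_iff.2 (h.ne_zero z (h.subset hz))
    have hz' := hz
    rw [h.eq] at hz'
    have hu : (z.1, ‖z.2‖⁻¹ • z.2) ∈ unitCotangentSphere :=
      ⟨smul_mem_cotangentSphere hz'.1 _, by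
        rw [norm_smul, norm_inv, norm_norm, inv_mul_cancel₀ h0.ne']⟩
    refine ⟨_, hu, ?_⟩
    have := (hρ _ hu).2.2 ‖z.2‖ h0 (by simpa [smul_smul, h0.ne'] using hz)
    simp only
    rw [← this, smul_smul, mul_inv_cancel₀ h0.ne', one_smul]

theorem isCompact : IsCompact S := by
  obtain ⟨ρ, hρ, hS⟩ := h.exists_continuousOn_radius
  rw [← hS]
  exact isCompact_unitCotangentSphere.image_of_continuousOn
    (continuousOn_fst.prodMk (hρ.smul continuousOn_snd))

end IsRadialLevel

/-! ### Rotations and quaternions -/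

/-- The first two columns of the rotation matrix of a quaternion `x`; the third column is their
cross product. -/
def rotationFrame (x : EuclideanSpace ℝ (Fin 4)) : Space × Space :=
  (!₂[x 0 ^ 2 + x 1 ^ 2 - x 2 ^ 2 - x 3 ^ 2, 2 * (x 1 * x 2 + x 0 * x 3),
      2 * (x 1 * x 3 - x 0 * x 2)],
    !₂[2 * (x 1 * x 2 - x 0 * x 3), x 0 ^ 2 - x 1 ^ 2 + x 2 ^ 2 - x 3 ^ 2,
      2 * (x 2 * x 3 + x 0 * x 1)])

/-- The matrix `4 x xᵀ` of a unit quaternion `x`, recovered from the first two columns `ξ`, `η` of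
its rotation matrix. -/
def quaternionMatrix (w : Space × Space) : Matrix (Fin 4) (Fin 4) ℝ :=
  let ξ := w.1
  let η := w.2
  let ζ : Fin 3 → ℝ := ![ξ 1 * η 2 - ξ 2 * η 1, ξ 2 * η 0 - ξ 0 * η 2, ξ 0 * η 1 - ξ 1 * η 0]
  !![1 + ξ 0 + η 1 + ζ 2, η 2 - ζ 1, ζ 0 - ξ 2, ξ 1 - η 0;
    η 2 - ζ 1, 1 + ξ 0 - η 1 - ζ 2, η 0 + ξ 1, ζ 0 + ξ 2;
    ζ 0 - ξ 2, η 0 + ξ 1, 1 - ξ 0 + η 1 - ζ 2, ζ 1 + η 2;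
    ξ 1 - η 0, ζ 0 + ξ 2, ζ 1 + η 2, 1 - ξ 0 - η 1 + ζ 2]

theorem contDiff_rotationFrame : ContDiff ℝ ∞ rotationFrame := by
  refine ContDiff.prodMk ?_ ?_ <;>
  · rw [contDiff_euclidean]
    intro i
    fin_cases i <;> simp <;> fun_prop

theorem contDiff_quaternionMatrix (i j : Fin 4) :
    ContDiff ℝ ∞ fun w : Space × Space => quaternionMatrix w i j := by
  fin_cases i <;> fin_cases j <;> simp [quaternionMatrix] <;> fun_prop

theorem norm_sq_space (v : Space) : ‖v‖ ^ 2 = v 0 ^ 2 + v 1 ^ 2 + v 2 ^ 2 := by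
  rw [EuclideanSpace.real_norm_sq_eq, Fin.sum_univ_three]

theorem mem_cotangentSphere_iff_coord {w : Space × Space} : w ∈ cotangentSphere ↔
    w.1 0 ^ 2 + w.1 1 ^ 2 + w.1 2 ^ 2 = 1 ∧
      w.1 0 * w.2 0 + w.1 1 * w.2 1 + w.1 2 * w.2 2 = 0 := by
  have h' : ⟪w.1, w.2⟫ = w.1 0 * w.2 0 + w.1 1 * w.2 1 + w.1 2 * w.2 2 := by
    simp [PiLp.inner_apply, Fin.sum_univ_three]; ring
  show ‖w.1‖ = 1 ∧ ⟪w.1, w.2⟫ = 0 ↔ _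
  rw [← norm_sq_space, h', pow_eq_one_iff_of_nonneg (norm_nonneg _) two_ne_zero]

theorem mem_unitCotangentSphere_iff {w : Space × Space} : w ∈ unitCotangentSphere ↔
    w.1 0 ^ 2 + w.1 1 ^ 2 + w.1 2 ^ 2 = 1 ∧ w.2 0 ^ 2 + w.2 1 ^ 2 + w.2 2 ^ 2 = 1 ∧
      w.1 0 * w.2 0 + w.1 1 * w.2 1 + w.1 2 * w.2 2 = 0 := by
  show w ∈ cotangentSphere ∧ ‖w.2‖ = 1 ↔ _
  rw [mem_cotangentSphere_iff_coord, ← pow_eq_one_iff_of_nonneg (norm_nonneg w.2) two_ne_zero,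
    norm_sq_space]
  tauto

theorem mem_sphere_iff {x : EuclideanSpace ℝ (Fin 4)} :
    x ∈ Metric.sphere (0 : EuclideanSpace ℝ (Fin 4)) 1 ↔
      x 0 ^ 2 + x 1 ^ 2 + x 2 ^ 2 + x 3 ^ 2 = 1 := by
  rw [mem_sphere_zero_iff_norm, ← pow_eq_one_iff_of_nonneg (norm_nonneg x) two_ne_zero,
    EuclideanSpace.real_norm_sq_eq, Fin.sum_univ_four]

theorem rotationFrame_mem {x : EuclideanSpace ℝ (Fin 4)}
    (hx : x ∈ Metric.sphere (0 : EuclideanSpace ℝ (Fin 4)) 1) :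
    rotationFrame x ∈ unitCotangentSphere := by
  rw [mem_sphere_iff] at hx
  rw [mem_unitCotangentSphere_iff]
  have h : (x 0 ^ 2 + x 1 ^ 2 + x 2 ^ 2 + x 3 ^ 2) ^ 2 = 1 := by rw [hx, one_pow]
  simp only [rotationFrame]
  refine ⟨?_, ?_, ?_⟩
  · simp; linear_combination h
  · simp; linear_combination h
  · simp; ring

theorem rotationFrame_neg (x : EuclideanSpace ℝ (Fin 4)) :
    rotationFrame (-x) = rotationFrame x := by
  simp [rotationFrame]

/-- The rank one identities of `4 x xᵀ`, for the columns `ξ`, `η`, `ξ × η` of a rotation matrix. -/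
theorem quaternionMatrix_mul {w : Space × Space} (hw : w ∈ unitCotangentSphere) (i j l : Fin 4) :
    quaternionMatrix w j i * quaternionMatrix w l i
      = quaternionMatrix w j l * quaternionMatrix w i i := by
  rw [mem_unitCotangentSphere_iff] at hw
  obtain ⟨h1, h2, h3⟩ := hw
  obtain ⟨ξ, η⟩ := w
  simp only at h1 h2 h3
  obtain ⟨a, ha⟩ : ∃ a, a = ξ 0 := ⟨_, rfl⟩
  obtain ⟨b, hb⟩ : ∃ a, a = ξ 1 := ⟨_, rfl⟩
  obtain ⟨c, hc⟩ : ∃ a, a = ξ 2 := ⟨_, rfl⟩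
  obtain ⟨d, hd⟩ : ∃ a, a = η 0 := ⟨_, rfl⟩
  obtain ⟨e, he⟩ : ∃ a, a = η 1 := ⟨_, rfl⟩
  obtain ⟨f, hf⟩ : ∃ a, a = η 2 := ⟨_, rfl⟩
  rw [← ha, ← hb, ← hc] at h1
  rw [← hd, ← he, ← hf] at h2
  rw [← ha, ← hb, ← hc, ← hd, ← he, ← hf] at h3
  obtain ⟨u, hu⟩ : ∃ u, u = b * f - c * e := ⟨_, rfl⟩
  obtain ⟨v, hv⟩ : ∃ v, v = c * d - a * f := ⟨_, rfl⟩
  obtain ⟨t, ht⟩ : ∃ t, t = a * e - b * d := ⟨_, rfl⟩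
  -- the remaining relations between the entries of a rotation matrix
  have h4 : u ^ 2 + v ^ 2 + t ^ 2 = 1 := by
    rw [hu, hv, ht]
    linear_combination (d ^ 2 + e ^ 2 + f ^ 2) * h1 + h2 - (a * d + b * e + c * f) * h3
  have h5 : a * u + b * v + c * t = 0 := by rw [hu, hv, ht]; ring
  have h6 : d * u + e * v + f * t = 0 := by rw [hu, hv, ht]; ring
  have hA : (!![a, d, u; b, e, v; c, f, t]).transpose * !![a, d, u; b, e, v; c, f, t] = 1 := by
    ext i j
    fin_cases i <;> fin_cases j <;> simp [Matrix.mul_apply, Fin.sum_univ_three] <;> linarith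
  rw [mul_eq_one_comm] at hA
  have hr : ∀ i j, (!![a, d, u; b, e, v; c, f, t] * (!![a, d, u; b, e, v; c, f, t]).transpose) i j
      = (1 : Matrix (Fin 3) (Fin 3) ℝ) i j := fun i j => by rw [hA]
  have r00 := hr 0 0
  have r01 := hr 0 1
  have r02 := hr 0 2
  have r11 := hr 1 1
  have r12 := hr 1 2
  have r22 := hr 2 2
  simp [Matrix.mul_apply, Fin.sum_univ_three] at r00 r01 r02 r11 r12 r22
  clear hA hr
  have c1 : a = e * t - f * v := by
    rw [hv, ht]; linear_combination (-a) * h2 + d * h3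
  have c2 : b = f * u - d * t := by
    rw [hu, ht]; linear_combination (-b) * h2 + e * h3
  have c3 : c = d * v - e * u := by
    rw [hu, hv]; linear_combination (-c) * h2 + f * h3
  have c4 : d = v * c - t * b := by
    rw [hv, ht]; linear_combination (-d) * h1 + a * h3
  have c5 : e = t * a - u * c := by
    rw [hu, ht]; linear_combination (-e) * h1 + b * h3
  have c6 : f = u * b - v * a := by
    rw [hu, hv]; linear_combination (-f) * h1 + c * h3
  have hM : quaternionMatrix (ξ, η) = !![1 + a + e + t, f - v, u - c, b - d;
      f - v, 1 + a - e - t, d + b, u + c;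
      u - c, d + b, 1 - a + e - t, v + f;
      b - d, u + c, v + f, 1 - a - e + t] := by
    rw [hu, hv, ht, ha, hb, hc, hd, he, hf]; rfl
  rw [hM]
  clear hM ha hb hc hd he hf
  fin_cases i <;> fin_cases j <;> fin_cases l <;> simp <;> linarith

/-! ### Projective space and the unit cotangent bundle -/

/-- The unit sphere of `ℝ⁴`. -/
abbrev ThreeSphere : Type := Metric.sphere (0 : EuclideanSpace ℝ (Fin 4)) 1

/-- The `i`-th column of `4 x xᵀ`, which is a multiple of `x`. -/
def quaternionColumn (i : Fin 4) (w : Space × Space) : EuclideanSpace ℝ (Fin 4) :=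
  WithLp.toLp 2 fun j => quaternionMatrix w j i

theorem contDiff_quaternionColumn (i : Fin 4) : ContDiff ℝ ∞ (quaternionColumn i) := by
  rw [contDiff_euclidean]
  exact fun j => contDiff_quaternionMatrix j i

theorem norm_sq_quaternionColumn {w : Space × Space} (hw : w ∈ unitCotangentSphere) (i : Fin 4) :
    ‖quaternionColumn i w‖ ^ 2 = 4 * quaternionMatrix w i i := by
  have h : ∑ j, quaternionMatrix w j j = 4 := by
    simp [quaternionMatrix, Fin.sum_univ_four]; ring
  rw [EuclideanSpace.real_norm_sq_eq, ← h, Finset.sum_mul]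
  exact Finset.sum_congr rfl fun j _ => by
    rw [← quaternionMatrix_mul hw i j j, sq]; rfl

theorem rotationFrame_normalize {w : Space × Space} (hw : w ∈ unitCotangentSphere) {i : Fin 4}
    (hi : quaternionColumn i w ≠ 0) :
    rotationFrame (‖quaternionColumn i w‖⁻¹ • quaternionColumn i w) = w := by
  obtain ⟨x, hx⟩ : ∃ x, x = ‖quaternionColumn i w‖⁻¹ • quaternionColumn i w := ⟨_, rfl⟩
  have hn := norm_pos_iff.2 hi
  have hM := norm_sq_quaternionColumn hw i
  have h : ∀ j l, x j * x l = quaternionMatrix w j l / 4 := by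
    intro j l
    have h1 : x j * x l
        = quaternionMatrix w j i * quaternionMatrix w l i / ‖quaternionColumn i w‖ ^ 2 := by
      rw [hx]; simp [quaternionColumn]; field_simp
    have h2 : quaternionMatrix w i i ≠ 0 := fun h0 => by
      rw [h0] at hM; exact (pow_pos hn 2).ne' (by simpa using hM)
    rw [h1, quaternionMatrix_mul hw, hM]
    field_simp
  rw [← hx]
  have h00 := h 0 0
  have h11 := h 1 1
  have h22 := h 2 2
  have h33 := h 3 3
  have h01 := h 0 1
  have h02 := h 0 2
  have h03 := h 0 3
  have h12 := h 1 2
  have h13 := h 1 3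
  have h23 := h 2 3
  simp [quaternionMatrix] at h00 h11 h22 h33 h01 h02 h03 h12 h13 h23
  refine Prod.ext ?_ ?_ <;>
  · ext j
    fin_cases j <;> simp [rotationFrame] <;> linarith

theorem exists_quaternionColumn_ne_zero {w : Space × Space} (hw : w ∈ unitCotangentSphere) :
    ∃ i, quaternionColumn i w ≠ 0 := by
  by_contra! h
  have h4 : ∑ j, quaternionMatrix w j j = 4 := by
    simp [quaternionMatrix, Fin.sum_univ_four]; ring
  have h0 : ∀ j, quaternionMatrix w j j = 0 := fun j => by
    have := norm_sq_quaternionColumn hw j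
    rw [h j] at this
    simpa using this.symm
  simp [h0] at h4

/-- Two unit quaternions with the same rotation agree up to sign. -/
theorem eq_or_eq_neg_of_rotationFrame_eq {x y : EuclideanSpace ℝ (Fin 4)}
    (hx : x ∈ Metric.sphere (0 : EuclideanSpace ℝ (Fin 4)) 1)
    (hy : y ∈ Metric.sphere (0 : EuclideanSpace ℝ (Fin 4)) 1)
    (h : rotationFrame x = rotationFrame y) : x = y ∨ x = -y := by
  have hM : ∀ z : EuclideanSpace ℝ (Fin 4),
      z ∈ Metric.sphere (0 : EuclideanSpace ℝ (Fin 4)) 1 →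
      ∀ i j, quaternionMatrix (rotationFrame z) i j = 4 * (z i * z j) := by
    intro z hz i j
    rw [mem_sphere_iff] at hz
    have hζ : quaternionMatrix (rotationFrame z) = !![1 + (z 0 ^ 2 + z 1 ^ 2 - z 2 ^ 2 - z 3 ^ 2)
          + (z 0 ^ 2 - z 1 ^ 2 + z 2 ^ 2 - z 3 ^ 2) + (z 0 ^ 2 - z 1 ^ 2 - z 2 ^ 2 + z 3 ^ 2),
          4 * (z 0 * z 1), 4 * (z 0 * z 2), 4 * (z 0 * z 3);
        4 * (z 0 * z 1), 1 + (z 0 ^ 2 + z 1 ^ 2 - z 2 ^ 2 - z 3 ^ 2)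
          - (z 0 ^ 2 - z 1 ^ 2 + z 2 ^ 2 - z 3 ^ 2) - (z 0 ^ 2 - z 1 ^ 2 - z 2 ^ 2 + z 3 ^ 2),
          4 * (z 1 * z 2), 4 * (z 1 * z 3);
        4 * (z 0 * z 2), 4 * (z 1 * z 2), 1 - (z 0 ^ 2 + z 1 ^ 2 - z 2 ^ 2 - z 3 ^ 2)
          + (z 0 ^ 2 - z 1 ^ 2 + z 2 ^ 2 - z 3 ^ 2) - (z 0 ^ 2 - z 1 ^ 2 - z 2 ^ 2 + z 3 ^ 2),
          4 * (z 2 * z 3);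
        4 * (z 0 * z 3), 4 * (z 1 * z 3), 4 * (z 2 * z 3),
          1 - (z 0 ^ 2 + z 1 ^ 2 - z 2 ^ 2 - z 3 ^ 2)
          - (z 0 ^ 2 - z 1 ^ 2 + z 2 ^ 2 - z 3 ^ 2) + (z 0 ^ 2 - z 1 ^ 2 - z 2 ^ 2 + z 3 ^ 2)] := by
      have h0 : 2 * (z 1 * z 2 + z 0 * z 3) * (2 * (z 2 * z 3 + z 0 * z 1))
          - 2 * (z 1 * z 3 - z 0 * z 2) * (z 0 ^ 2 - z 1 ^ 2 + z 2 ^ 2 - z 3 ^ 2)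
          = 2 * (z 1 * z 3 + z 0 * z 2) := by
        linear_combination 2 * (z 1 * z 3 + z 0 * z 2) * hz
      have h1 : 2 * (z 1 * z 3 - z 0 * z 2) * (2 * (z 1 * z 2 - z 0 * z 3))
          - (z 0 ^ 2 + z 1 ^ 2 - z 2 ^ 2 - z 3 ^ 2) * (2 * (z 2 * z 3 + z 0 * z 1))
          = 2 * (z 2 * z 3 - z 0 * z 1) := by
        linear_combination 2 * (z 2 * z 3 - z 0 * z 1) * hz
      have h2 : (z 0 ^ 2 + z 1 ^ 2 - z 2 ^ 2 - z 3 ^ 2) * (z 0 ^ 2 - z 1 ^ 2 + z 2 ^ 2 - z 3 ^ 2)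
          - 2 * (z 1 * z 2 + z 0 * z 3) * (2 * (z 1 * z 2 - z 0 * z 3))
          = z 0 ^ 2 - z 1 ^ 2 - z 2 ^ 2 + z 3 ^ 2 := by
        linear_combination (z 0 ^ 2 - z 1 ^ 2 - z 2 ^ 2 + z 3 ^ 2) * hz
      ext i j
      fin_cases i <;> fin_cases j <;> simp [quaternionMatrix, rotationFrame] <;> linarith
    rw [hζ]
    fin_cases i <;> fin_cases j <;> simp <;> linarith
  have hxy : ∀ i j, x i * x j = y i * y j := fun i j => by
    have := hM x hx i j
    rw [h, hM y hy] at this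
    linarith
  have h1 : x = ⟪x, y⟫ • y := by
    rw [mem_sphere_iff] at hx
    ext i
    simp only [PiLp.inner_apply, Fin.sum_univ_four, PiLp.smul_apply, smul_eq_mul,
      RCLike.inner_apply,
      conj_trivial]
    linear_combination (-x i) * hx + x 0 * hxy i 0 + x 1 * hxy i 1 + x 2 * hxy i 2 + x 3 * hxy i 3
  have h2 : |⟪x, y⟫| = 1 := by
    have := congrArg norm h1
    rwa [norm_smul, mem_sphere_zero_iff_norm.1 hx, mem_sphere_zero_iff_norm.1 hy, mul_one,
      Real.norm_eq_abs, eq_comm] at this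
  rcases (abs_eq zero_le_one).1 h2 with h | h <;> rw [h] at h1
  · left; simpa using h1
  · right; simpa using h1

theorem exists_rotationFrame_eq {w : Space × Space} (hw : w ∈ unitCotangentSphere) :
    ∃ x : ThreeSphere, rotationFrame x = w := by
  obtain ⟨i, hi⟩ := exists_quaternionColumn_ne_zero hw
  refine ⟨⟨_, ?_⟩, rotationFrame_normalize hw hi⟩
  rw [mem_sphere_zero_iff_norm, norm_smul, norm_inv, norm_norm,
    inv_mul_cancel₀ (norm_ne_zero_iff.2 hi)]

theorem isConnected_unitCotangentSphere : IsConnected unitCotangentSphere := by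
  have h : unitCotangentSphere
      = rotationFrame '' Metric.sphere (0 : EuclideanSpace ℝ (Fin 4)) 1 := by
    ext w
    constructor
    · intro hw
      obtain ⟨x, rfl⟩ := exists_rotationFrame_eq hw
      exact ⟨x, x.2, rfl⟩
    · rintro ⟨x, hx, rfl⟩
      exact rotationFrame_mem hx
  rw [h]
  refine (isConnected_sphere ?_ _ zero_le_one).image _
    contDiff_rotationFrame.continuous.continuousOn
  rw [← Module.finrank_eq_rank, finrank_euclideanSpace_fin]; norm_num

/-- The projection of the 3-sphere to projective space. -/
def projectiveMk (x : ThreeSphere) : RealProjectiveThreeSpace := Quotient.mk _ x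

theorem projectiveMk_eq_iff {x y : ThreeSphere} :
    projectiveMk x = projectiveMk y ↔ x = y ∨ x = -y := by
  constructor
  · intro h
    obtain ⟨a, ha⟩ := MulAction.orbitRel_apply.1 (Quotient.exact h)
    have ha' : (a : ℝ) • (y : EuclideanSpace ℝ (Fin 4)) = x := congrArg Subtype.val ha
    have h1 : |(a : ℝ)| = 1 := mem_sphere_zero_iff_norm.1 a.2
    rcases (abs_eq zero_le_one).1 h1 with h | h <;> rw [h] at ha'
    · left; ext1; rw [← ha', one_smul]
    · right; ext1; rw [← ha', neg_one_smul]; rfl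
  · rintro (rfl | rfl)
    · rfl
    · exact Quotient.sound (MulAction.orbitRel_apply.2 ⟨⟨-1, by simp⟩,
        Subtype.ext (neg_one_smul ℝ (y : EuclideanSpace ℝ (Fin 4)))⟩)

theorem isLocalHomeomorph_projectiveMk : IsLocalHomeomorph projectiveMk :=
  (isQuotientCoveringMap_quotientMk_of_properlyDiscontinuousSMul).isCoveringMap.isLocalHomeomorph

theorem surjective_projectiveMk : Function.Surjective projectiveMk := Quotient.mk_surjective

/-- A map that takes values in the sphere of `ℝ⁴` and is smooth as a map to `ℝ⁴` is smooth as a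
map to the sphere. -/
theorem contMDiffAt_threeSphere {V : Type*} [NormedAddCommGroup V] [NormedSpace ℝ V]
    {s : V → ThreeSphere} {z : V}
    (hs : ContDiffAt ℝ ∞ (fun v => (s v : EuclideanSpace ℝ (Fin 4))) z) :
    ContDiffAt ℝ ∞ (fun v => chartAt (EuclideanSpace ℝ (Fin 3)) (s z) (s v)) z := by
  have h1 : (s z : EuclideanSpace ℝ (Fin 4))
      ∈ {x | innerSL ℝ (-(s z) : EuclideanSpace ℝ (Fin 4)) x ≠ (1 : ℝ)} := by
    simp; norm_num
  have h2 : ContDiffAt ℝ ∞ (stereoToFun (-(s z) : EuclideanSpace ℝ (Fin 4))) (s z) :=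
    contDiffOn_stereoToFun.contDiffAt (IsOpen.mem_nhds (isOpen_ne.preimage
      (innerSL ℝ (-(s z) : EuclideanSpace ℝ (Fin 4))).continuous) h1)
  have h3 := ContDiffAt.comp (f := fun v => (s v : EuclideanSpace ℝ (Fin 4))) z h2 hs
  have := Fact.mk (@finrank_euclideanSpace_fin ℝ _ (3 + 1))
  have h4 := (OrthonormalBasis.fromOrthogonalSpanSingleton (𝕜 := ℝ) 3
    (ne_zero_of_mem_unit_sphere (-(s z)))).repr.contDiff (n := ∞)
  have h5 := h4.contDiffAt.comp z h3
  exact h5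

/-- The preferred chart of projective space at a point, with a lift of this point. -/
theorem exists_chartAt_eq (q : RealProjectiveThreeSpace) : ∃ x : ThreeSphere, projectiveMk x = q ∧
    chartAt (EuclideanSpace ℝ (Fin 3)) q
      = (isLocalHomeomorph_projectiveMk.localInverseAt x).trans
        (chartAt (EuclideanSpace ℝ (Fin 3)) x) :=
  ⟨_, surjective_projectiveMk.hasRightInverse.choose_spec q, rfl⟩

/-- A map on projective space is smooth if its lift to the sphere is the restriction of a smooth
map on `ℝ⁴`. -/
theorem contMDiff_of_comp_projectiveMk {V : Type*} [NormedAddCommGroup V] [NormedSpace ℝ V]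
    {f : RealProjectiveThreeSpace → V} {F : EuclideanSpace ℝ (Fin 4) → V} (hF : ContDiff ℝ ∞ F)
    (h : ∀ x, f (projectiveMk x) = F x) : ContMDiff (𝓡 3) 𝓘(ℝ, V) ∞ f := by
  intro q
  have hf : Continuous f := by
    have h1 : Continuous fun x : ThreeSphere => f (projectiveMk x) := by
      simp only [h]; exact hF.continuous.comp continuous_subtype_val
    exact continuous_coinduced_dom.2 h1
  obtain ⟨x, hx, hc⟩ := exists_chartAt_eq q
  have := Fact.mk (@finrank_euclideanSpace_fin ℝ _ (3 + 1))
  rw [contMDiffAt_iff]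
  refine ⟨hf.continuousAt, ?_⟩
  have h1 : ContMDiffAt (𝓡 3) 𝓘(ℝ, V) ∞ (fun x : ThreeSphere => F x) x :=
    hF.contMDiff.contMDiffAt.comp x contMDiff_coe_sphere.contMDiffAt
  rw [contMDiffAt_iff] at h1
  have h2 := h1.2
  subst hx
  simp only [extChartAt, hc, mfld_simps, h, Function.comp_def] at h2 ⊢
  have h3 : (isLocalHomeomorph_projectiveMk.localInverseAt x) (projectiveMk x) = x := by simp
  simpa [h, h3] using h2

/-- A map to projective space is smooth if it has local lifts to the sphere that are smooth as maps
to `ℝ⁴`. -/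
theorem contMDiffAt_projectiveMk_comp {V : Type*} [NormedAddCommGroup V] [NormedSpace ℝ V]
    {s : V → ThreeSphere} {z : V}
    (hs : ContDiffAt ℝ ∞ (fun v => (s v : EuclideanSpace ℝ (Fin 4))) z) :
    ContMDiffAt 𝓘(ℝ, V) (𝓡 3) ∞ (fun v => projectiveMk (s v)) z := by
  obtain ⟨x, hx, hc⟩ := exists_chartAt_eq (projectiveMk (s z))
  -- change the sign of the lift so that it starts at the lift used by the chart
  obtain ⟨t, ht, hts, hst⟩ : ∃ t : V → ThreeSphere, t z = x ∧
      ContDiffAt ℝ ∞ (fun v => (t v : EuclideanSpace ℝ (Fin 4))) z ∧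
      ∀ v, projectiveMk (s v) = projectiveMk (t v) := by
    rcases projectiveMk_eq_iff.1 hx with h | h
    · exact ⟨s, h.symm, hs, fun v => rfl⟩
    · exact ⟨fun v => -s v, h.symm, hs.neg, fun v => projectiveMk_eq_iff.2 (Or.inr (by simp))⟩
  have htc : ContinuousAt t z := Topology.IsInducing.subtypeVal.continuousAt_iff.2 hts.continuousAt
  have h1 := contMDiffAt_threeSphere hts
  have hmk : ContinuousAt (fun v => projectiveMk (s v)) z := by
    simp only [hst]
    exact isLocalHomeomorph_projectiveMk.continuous.continuousAt.comp htc
  rw [contMDiffAt_iff]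
  refine ⟨hmk, ?_⟩
  simp only [extChartAt, hc, mfld_simps, Function.comp_def]
  rw [contDiffWithinAt_univ]
  refine h1.congr_of_eventuallyEq ?_
  have h2 : ∀ᶠ v in 𝓝 z, t v ∈ (isLocalHomeomorph_projectiveMk.localInverseAt x).target :=
    htc.eventually ((isLocalHomeomorph_projectiveMk.localInverseAt x).open_target.mem_nhds
      (by rw [ht]; simp))
  filter_upwards [h2] with v hv
  have h3 := (isLocalHomeomorph_projectiveMk.localInverseAt x).right_inv hv
  rw [IsLocalHomeomorph.localInverseAt_symm] at h3
  simp only [chartAt_self_eq, mfld_simps]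
  rw [hst, h3, ht]

/-- The unit cotangent bundle of `S²` is diffeomorphic to `ℝP³`, because the quaternions represent
the rotations of `ℝ³` up to sign. -/
theorem areDiffeomorphic_realProjectiveThreeSpace :
    AreDiffeomorphic 𝓘(ℝ, Space × Space) (𝓡 3) unitCotangentSphere
      (univ : Set RealProjectiveThreeSpace) := by
  have : Nonempty ThreeSphere := (NormedSpace.sphere_nonempty.2 zero_le_one).to_subtype
  choose! l hl using fun w (hw : w ∈ unitCotangentSphere) => exists_rotationFrame_eq hw
  have hout : ∀ x : ThreeSphere, rotationFrame (Quotient.out (projectiveMk x) : ThreeSphere)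
      = rotationFrame x := by
    intro x
    have h : projectiveMk (Quotient.out (projectiveMk x)) = projectiveMk x := Quotient.out_eq _
    rcases projectiveMk_eq_iff.1 h with h | h
    · rw [h]
    · rw [h]; exact rotationFrame_neg x
  have hinj : ∀ x y : ThreeSphere, rotationFrame x = rotationFrame y →
      projectiveMk x = projectiveMk y := fun x y h => by
    rw [projectiveMk_eq_iff]
    rcases eq_or_eq_neg_of_rotationFrame_eq x.2 y.2 h with h | h
    · exact Or.inl (Subtype.ext h)
    · exact Or.inr (Subtype.ext h)
  refine ⟨fun w => projectiveMk (l w), fun q => rotationFrame (Quotient.out q : ThreeSphere),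
    fun _ _ => mem_univ _, fun q _ => rotationFrame_mem (Quotient.out q : ThreeSphere).2, ?_, ?_,
    ?_, ?_⟩
  · intro w hw
    exact (hout _).trans (hl w hw)
  · intro q _
    have h := hl _ (rotationFrame_mem (Quotient.out q : ThreeSphere).2)
    exact (hinj _ _ h).trans (Quotient.out_eq q)
  · intro w hw
    obtain ⟨i, hi⟩ := exists_quaternionColumn_ne_zero hw
    obtain ⟨U, hU⟩ : ∃ U, U = {w | quaternionColumn i w ≠ 0} := ⟨_, rfl⟩
    have hUo : IsOpen U := by
      rw [hU]; exact isOpen_ne.preimage (contDiff_quaternionColumn i).continuous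
    have hs : ∀ w, ∃ x : ThreeSphere, w ∈ U →
        (x : EuclideanSpace ℝ (Fin 4)) = ‖quaternionColumn i w‖⁻¹ • quaternionColumn i w := by
      intro w
      by_cases h : w ∈ U
      · rw [hU] at h
        exact ⟨⟨‖quaternionColumn i w‖⁻¹ • quaternionColumn i w, by
          rw [mem_sphere_zero_iff_norm, norm_smul, norm_inv, norm_norm,
            inv_mul_cancel₀ (norm_ne_zero_iff.2 h)]⟩, fun _ => rfl⟩
      · exact ⟨l w, fun h' => absurd h' h⟩
    choose s hs using hs
    refine ⟨U, fun w => projectiveMk (s w), hUo, by rw [hU]; exact hi, fun z hz => ?_, ?_⟩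
    · refine (contMDiffAt_projectiveMk_comp ?_).contMDiffWithinAt
      have h1 : quaternionColumn i z ≠ 0 := by rw [hU] at hz; exact hz
      have h2 := (contDiff_quaternionColumn i).contDiffAt (x := z)
      refine (((h2.norm ℝ h1).inv (norm_ne_zero_iff.2 h1)).smul h2).congr_of_eventuallyEq ?_
      filter_upwards [hUo.mem_nhds hz] with v hv using hs v hv
    · rintro z ⟨hz, hzU⟩
      refine hinj _ _ ?_
      rw [hl z hz, hs z hzU]
      rw [hU] at hzU
      exact (rotationFrame_normalize hz hzU).symm
  · intro q _
    refine ⟨univ, _, isOpen_univ, mem_univ _,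
      (contMDiff_of_comp_projectiveMk contDiff_rotationFrame hout).contMDiffOn, fun _ _ => rfl⟩

/-! ### The polynomial inequalities behind radial monotonicity -/

/-- The numerator of an upper bound for twice the kinetic energy, in the rotating frame, that is
available at energy `-1`; the denominator is `(1 + m n) (1 - m n)`. -/
def kineticBoundNum (m n : ℝ) : ℝ :=
  (n ^ 2 - (1 - m) ^ 2) * ((1 + m * n) * (1 - m * n)) + 2 * m * n ^ 2 * (1 + m)

/-- An upper bound, polynomial in `m` and `n`, for the contribution
`2 (l - m - k n) (m / l) (1 + m / l)` of the centrifugal force to the radial derivative. -/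
def centrifugalBound (k m n : ℝ) : ℝ :=
  2 * m - 2 * m ^ 2 * (m + k * n) * (2 - (1 + m ^ 2) * (1 + n ^ 2) / 2)
    - m * k * n * (3 - (1 + m ^ 2) * (1 + n ^ 2) / 2)

/-- The part of the radial monotonicity inequality that is even in the radical
`l = √((1 + m²)(1 + n²) / 2)`, after clearing denominators. -/
def evenPart (k m n : ℝ) : ℝ :=
  n * ((1 + m ^ 2) * (1 + n ^ 2) / 2 * ((1 + k) * (m + n) + (1 - k) * (m - n)) * (1 + m * n) ^ 3
      + (1 + m ^ 2) * (1 + n ^ 2) / 2 * (m + n) * (1 - m * n)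
        * ((1 - k) * (1 + m * n) ^ 2 - (1 + k) * ((m - n) * (m + n))
          - (1 - k) * ((1 + m ^ 2) * (1 + n ^ 2)))
      - (m + n) * (centrifugalBound k m n + n) * (1 + m * n) ^ 3 * (1 - m * n))
    - 20 / 9 * k * m * ((1 - m * n) * (1 + m * n)) ^ 2 * kineticBoundNum m n
    - n * (1 + k) * ((1 + m ^ 2) * (1 + n ^ 2) / 2) / 6 * (1 + m * n) ^ 2 * kineticBoundNum m n

/-- The coefficient of the radical `l` in the radial monotonicity inequality. -/
def oddPart (k m n : ℝ) : ℝ :=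
  n * ((1 + m ^ 2) * (1 + n ^ 2) * (1 + m * n) ^ 3
      + (1 + m ^ 2) * (1 + n ^ 2) * (1 - m * n)
        * (k * (1 + m * n) ^ 2 - (m - n) * (m + n) - k * (m + n) ^ 2)
      - ((1 + k) * (2 * m - 2 * m ^ 3 * (2 - (1 + m ^ 2) * (1 + n ^ 2) / 2) + n)
          - (1 - k) * m * n * (2 * m * (2 - (1 + m ^ 2) * (1 + n ^ 2) / 2)
            + (3 - (1 + m ^ 2) * (1 + n ^ 2) / 2))) * (1 + m * n) ^ 3 * (1 - m * n))
    - 20 / 9 * k * ((1 - m * n) * (1 + m * n)) ^ 2 * kineticBoundNum m n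
    - n * (m + n) / 6 * (1 + m * n) ^ 2 * kineticBoundNum m n

set_option maxHeartbeats 2000000 in
/-- All Bernstein coefficients of the even part on the unit square are nonnegative; they are
affine in `k`, hence nonnegative combinations of `5 - 12 k` and `5 k - 2`. -/
theorem evenPart_nonneg {k m n : ℝ} (hk₀ : 2 / 5 ≤ k) (hk₁ : k ≤ 5 / 12) (hm₀ : 0 ≤ m) (hm₁ : m ≤ 1)
    (hn₀ : 0 ≤ n) (hn₁ : n ≤ 1) : 0 ≤ evenPart k m n := by
  obtain ⟨a, ha⟩ : ∃ a, a = 5 - 12 * k := ⟨_, rfl⟩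
  obtain ⟨b, hb⟩ : ∃ b, b = 5 * k - 2 := ⟨_, rfl⟩
  obtain ⟨M, hM⟩ : ∃ M, M = 1 - m := ⟨_, rfl⟩
  obtain ⟨N, hN⟩ : ∃ N, N = 1 - n := ⟨_, rfl⟩
  have ha0 : 0 ≤ a := by linarith
  have hb0 : 0 ≤ b := by linarith
  have hM0 : 0 ≤ M := by linarith
  have hN0 : 0 ≤ N := by linarith
  have key : 36 * evenPart k m n =
      M^10 * ((21 * a + 51 * b) * (n * N^8) + (240 * a + 588 * b) * (n^2 * N^7)
        + (912 * a + 2256 * b) * (n^3 * N^6) + (1752 * a + 4404 * b) * (n^4 * N^5)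
        + (1989 * a + 5139 * b) * (n^5 * N^4) + (1524 * a + 4092 * b) * (n^6 * N^3)
        + (930 * a + 2562 * b) * (n^7 * N^2) + (444 * a + 1212 * b) * (n^8 * N)
        + (108 * a + 288 * b) * (n^9))
      + m * M^9 * ((160 * a + 400 * b) * (N^9) + (1788 * a + 4440 * b) * (n * N^8)
        + (8606 * a + 21326 * b) * (n^2 * N^7) + (22490 * a + 55892 * b) * (n^3 * N^6)
        + (35262 * a + 88482 * b) * (n^4 * N^5) + (35206 * a + 90130 * b) * (n^5 * N^4)
        + (24160 * a + 63868 * b) * (n^6 * N^3) + (12864 * a + 35010 * b) * (n^7 * N^2)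
        + (5324 * a + 14516 * b) * (n^8 * N) + (1164 * a + 3120 * b) * (n^9))
      + m^2 * M^8 * ((1120 * a + 2800 * b) * (N^9) + (11949 * a + 29703 * b) * (n * N^8)
        + (52906 * a + 131320 * b) * (n^2 * N^7) + (126913 * a + 316063 * b) * (n^3 * N^6)
        + (182520 * a + 459636 * b) * (n^4 * N^5) + (166439 * a + 429797 * b) * (n^5 * N^4)
        + (104984 * a + 283142 * b) * (n^6 * N^3) + (53949 * a + 151275 * b) * (n^7 * N^2)
        + (22750 * a + 63694 * b) * (n^8 * N) + (5030 * a + 13754 * b) * (n^9))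
      + m^3 * M^7 * ((3360 * a + 8400 * b) * (N^9) + (35142 * a + 87402 * b) * (n * N^8)
        + (146976 * a + 365280 * b) * (n^2 * N^7) + (323856 * a + 809094 * b) * (n^3 * N^6)
        + (412560 * a + 1049244 * b) * (n^4 * N^5) + (318612 * a + 849660 * b) * (n^5 * N^4)
        + (174354 * a + 509550 * b) * (n^6 * N^3) + (99996 * a + 306162 * b) * (n^7 * N^2)
        + (53820 * a + 157416 * b) * (n^8 * N) + (13464 * a + 37572 * b) * (n^9))
      + m^4 * M^6 * ((5600 * a + 14000 * b) * (N^9) + (57765 * a + 143727 * b) * (n * N^8)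
        + (225944 * a + 562334 * b) * (n^2 * N^7) + (438431 * a + 1101365 * b) * (n^3 * N^6)
        + (442858 * a + 1155982 * b) * (n^4 * N^5) + (226500 * a + 689352 * b) * (n^5 * N^4)
        + (113102 * a + 443300 * b) * (n^6 * N^3) + (155221 * a + 506287 * b) * (n^7 * N^2)
        + (123910 * a + 356734 * b) * (n^8 * N) + (33518 * a + 91670 * b) * (n^9))
      + m^5 * M^5 * ((5600 * a + 14000 * b) * (N^9) + (57576 * a + 143268 * b) * (n * N^8)
        + (206978 * a + 515570 * b) * (n^2 * N^7) + (330872 * a + 837806 * b) * (n^3 * N^6)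
        + (214228 * a + 604360 * b) * (n^4 * N^5) + (65496 * a + 326628 * b) * (n^5 * N^4)
        + (256886 * a + 847490 * b) * (n^6 * N^3) + (483730 * a + 1355746 * b) * (n^7 * N^2)
        + (335740 * a + 895408 * b) * (n^8 * N) + (81920 * a + 213776 * b) * (n^9))
      + m^6 * M^4 * ((3360 * a + 8400 * b) * (N^9) + (35643 * a + 88593 * b) * (n * N^8)
        + (119166 * a + 295812 * b) * (n^2 * N^7) + (166701 * a + 420339 * b) * (n^3 * N^6)
        + (155642 * a + 428594 * b) * (n^4 * N^5) + (428056 * a + 1171504 * b) * (n^5 * N^4)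
        + (1035786 * a + 2717418 * b) * (n^6 * N^3) + (1211942 * a + 3116714 * b) * (n^7 * N^2)
        + (675076 * a + 1717564 * b) * (n^8 * N) + (147276 * a + 372084 * b) * (n^9))
      + m^7 * M^3 * ((1120 * a + 2800 * b) * (N^9) + (13614 * a + 33690 * b) * (n * N^8)
        + (49876 * a + 121660 * b) * (n^2 * N^7) + (116632 * a + 281578 * b) * (n^3 * N^6)
        + (358638 * a + 881982 * b) * (n^4 * N^5) + (1020308 * a + 2541320 * b) * (n^5 * N^4)
        + (1743540 * a + 4353996 * b) * (n^6 * N^3) + (1648128 * a + 4112064 * b) * (n^7 * N^2)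
        + (808928 * a + 2013920 * b) * (n^8 * N) + (164608 * a + 408640 * b) * (n^9))
      + m^8 * M^2 * ((160 * a + 400 * b) * (N^9) + (3102 * a + 7590 * b) * (n * N^8)
        + (19396 * a + 45994 * b) * (n^2 * N^7) + (97957 * a + 232087 * b) * (n^3 * N^6)
        + (385264 * a + 929740 * b) * (n^4 * N^5) + (958462 * a + 2342782 * b) * (n^5 * N^4)
        + (1411424 * a + 3470960 * b) * (n^6 * N^3) + (1193776 * a + 2941552 * b) * (n^7 * N^2)
        + (542328 * a + 1335624 * b) * (n^8 * N) + (106688 * a + 262208 * b) * (n^9))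
      + m^9 * M * ((360 * a + 864 * b) * (n * N^8) + (5964 * a + 13956 * b) * (n^2 * N^7)
        + (44070 * a + 104334 * b) * (n^3 * N^6) + (175952 * a + 422948 * b) * (n^4 * N^5)
        + (405808 * a + 985888 * b) * (n^5 * N^4) + (550800 * a + 1346064 * b) * (n^6 * N^3)
        + (433712 * a + 1062224 * b) * (n^7 * N^2) + (188128 * a + 460384 * b) * (n^8 * N)
        + (37824 * a + 92352 * b) * (n^9))
      + m^10 * ((748 * a + 1744 * b) * (n^2 * N^7) + (7006 * a + 16594 * b) * (n^3 * N^6)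
        + (28604 * a + 68660 * b) * (n^4 * N^5) + (64164 * a + 155484 * b) * (n^5 * N^4)
        + (83640 * a + 203784 * b) * (n^6 * N^3) + (63872 * a + 155840 * b) * (n^7 * N^2)
        + (28512 * a + 69408 * b) * (n^8 * N) + (6720 * a + 16320 * b) * (n^9)) := by
    subst ha hb hM hN
    unfold evenPart centrifugalBound kineticBoundNum
    ring
  have : 0 ≤ 36 * evenPart k m n := by rw [key]; positivity
  linarith

set_option maxHeartbeats 2000000 in
/-- The same Bernstein expansion for the coefficient of the radical. -/
theorem oddPart_nonneg {k m n : ℝ} (hk₀ : 2 / 5 ≤ k) (hk₁ : k ≤ 5 / 12) (hm₀ : 0 ≤ m) (hm₁ : m ≤ 1)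
    (hn₀ : 0 ≤ n) (hn₁ : n ≤ 1) : 0 ≤ oddPart k m n := by
  obtain ⟨a, ha⟩ : ∃ a, a = 5 - 12 * k := ⟨_, rfl⟩
  obtain ⟨b, hb⟩ : ∃ b, b = 5 * k - 2 := ⟨_, rfl⟩
  obtain ⟨M, hM⟩ : ∃ M, M = 1 - m := ⟨_, rfl⟩
  obtain ⟨N, hN⟩ : ∃ N, N = 1 - n := ⟨_, rfl⟩
  have ha0 : 0 ≤ a := by linarith
  have hb0 : 0 ≤ b := by linarith
  have hM0 : 0 ≤ M := by linarith
  have hN0 : 0 ≤ N := by linarith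
  have key : 18 * oddPart k m n =
      M^9 * ((80 * a + 200 * b) * (N^8) + (766 * a + 1906 * b) * (n * N^7)
        + (2931 * a + 7272 * b) * (n^2 * N^6) + (6160 * a + 15238 * b) * (n^3 * N^5)
        + (8030 * a + 19784 * b) * (n^4 * N^4) + (6864 * a + 16812 * b) * (n^5 * N^3)
        + (3893 * a + 9458 * b) * (n^6 * N^2) + (1378 * a + 3316 * b) * (n^7 * N)
        + (234 * a + 558 * b) * (n^8))
      + m * M^8 * ((560 * a + 1400 * b) * (N^8) + (5377 * a + 13378 * b) * (n * N^7)
        + (20419 * a + 50617 * b) * (n^2 * N^6) + (42340 * a + 104476 * b) * (n^3 * N^5)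
        + (54398 * a + 133328 * b) * (n^4 * N^4) + (46193 * a + 112124 * b) * (n^5 * N^3)
        + (26489 * a + 63521 * b) * (n^6 * N^2) + (9646 * a + 22858 * b) * (n^7 * N)
        + (1690 * a + 3970 * b) * (n^8))
      + m^2 * M^7 * ((1680 * a + 4200 * b) * (N^8) + (16050 * a + 39936 * b) * (n * N^7)
        + (59169 * a + 146502 * b) * (n^2 * N^6) + (117168 * a + 287778 * b) * (n^3 * N^5)
        + (143025 * a + 346530 * b) * (n^4 * N^4) + (118080 * a + 280374 * b) * (n^5 * N^3)
        + (69813 * a + 162240 * b) * (n^6 * N^2) + (27750 * a + 63648 * b) * (n^7 * N)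
        + (5361 * a + 12264 * b) * (n^8))
      + m^3 * M^6 * ((2800 * a + 7000 * b) * (N^8) + (26531 * a + 66026 * b) * (n * N^7)
        + (92159 * a + 227621 * b) * (n^2 * N^6) + (165065 * a + 400736 * b) * (n^3 * N^5)
        + (179184 * a + 419334 * b) * (n^4 * N^4) + (142953 * a + 316356 * b) * (n^5 * N^3)
        + (99229 * a + 213055 * b) * (n^6 * N^2) + (50677 * a + 110314 * b) * (n^7 * N)
        + (11854 * a + 26422 * b) * (n^8))
      + m^4 * M^5 * ((2800 * a + 7000 * b) * (N^8) + (26606 * a + 66206 * b) * (n * N^7)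
        + (84173 * a + 206504 * b) * (n^2 * N^6) + (125174 * a + 292718 * b) * (n^3 * N^5)
        + (110355 * a + 222678 * b) * (n^4 * N^4) + (109356 * a + 193638 * b) * (n^5 * N^3)
        + (132076 * a + 260974 * b) * (n^6 * N^2) + (93064 * a + 200296 * b) * (n^7 * N)
        + (24811 * a + 55738 * b) * (n^8))
      + m^5 * M^4 * ((1680 * a + 4200 * b) * (N^8) + (16815 * a + 41790 * b) * (n * N^7)
        + (48615 * a + 117021 * b) * (n^2 * N^6) + (61011 * a + 126300 * b) * (n^3 * N^5)
        + (69880 * a + 102220 * b) * (n^4 * N^4) + (161194 * a + 292330 * b) * (n^5 * N^3)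
        + (246176 * a + 519278 * b) * (n^6 * N^2) + (171503 * a + 384140 * b) * (n^7 * N)
        + (44274 * a + 102084 * b) * (n^8))
      + m^6 * M^3 * ((560 * a + 1400 * b) * (N^8) + (6838 * a + 16924 * b) * (n * N^7)
        + (22003 * a + 50986 * b) * (n^2 * N^6) + (44812 * a + 87502 * b) * (n^3 * N^5)
        + (120965 * a + 233642 * b) * (n^4 * N^4) + (279560 * a + 593984 * b) * (n^5 * N^3)
        + (352960 * a + 792268 * b) * (n^6 * N^2) + (217358 * a + 502268 * b) * (n^7 * N)
        + (52472 * a + 123320 * b) * (n^8))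
      + m^7 * M^2 * ((80 * a + 200 * b) * (N^8) + (1789 * a + 4390 * b) * (n * N^7)
        + (9997 * a + 22615 * b) * (n^2 * N^6) + (40903 * a + 87424 * b) * (n^3 * N^5)
        + (128866 * a + 280546 * b) * (n^4 * N^4) + (253876 * a + 571924 * b) * (n^5 * N^3)
        + (278010 * a + 642348 * b) * (n^6 * N^2) + (155564 * a + 365552 * b) * (n^7 * N)
        + (35920 * a + 85360 * b) * (n^8))
      + m^8 * M * ((252 * a + 612 * b) * (n * N^7) + (3324 * a + 7536 * b) * (n^2 * N^6)
        + (19038 * a + 42588 * b) * (n^3 * N^5) + (59677 * a + 135130 * b) * (n^4 * N^4)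
        + (107002 * a + 246676 * b) * (n^5 * N^3) + (106760 * a + 250040 * b) * (n^6 * N^2)
        + (55784 * a + 132272 * b) * (n^7 * N) + (13008 * a + 31104 * b) * (n^8))
      + m^9 * ((410 * a + 926 * b) * (n^2 * N^6) + (3033 * a + 6888 * b) * (n^3 * N^5)
        + (9724 * a + 22336 * b) * (n^4 * N^4) + (16772 * a + 39056 * b) * (n^5 * N^3)
        + (15976 * a + 37696 * b) * (n^6 * N^2) + (8448 * a + 20160 * b) * (n^7 * N)
        + (2400 * a + 5760 * b) * (n^8)) := by
    subst ha hb hM hN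
    unfold oddPart kineticBoundNum
    ring
  have : 0 ≤ 18 * oddPart k m n := by rw [key]; positivity
  linarith

/-! ### Radial monotonicity in elliptic coordinates -/

/-- Twice the derivative of the potential along `q - q_m`, in elliptic coordinates. -/
def radialForce (k l m n : ℝ) : ℝ :=
  (1 + k) * l * (((1 - m * n) ^ 2 + k * (m - n) * ((1 + k) * l - (m + n))) / (1 - m * n) ^ 3
    + (k * (1 + m * n) ^ 2 - (k * ((1 + k) * l) + (m - n)) * (m + n)) / (1 + m * n) ^ 3)

/-- Multiplied by a positive factor, the radial monotonicity inequality becomes polynomial; its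
factor `(1 + k) l + (m + n)` removes the pole at the primary, because
`((1 + k) l + (m + n)) ((1 + k) l - (m + n)) = (1 - m n)²`. -/
theorem even_add_odd {k l m n : ℝ} (hk : k ^ 2 = 1 - 2 * k)
    (hl : l ^ 2 = (1 + m ^ 2) * (1 + n ^ 2) / 2) (hB : 1 - m * n ≠ 0) (hA : 1 + m * n ≠ 0)
    (hn : n ≠ 0) :
    n * (1 + m * n) ^ 3 * (1 - m * n) * ((1 + k) * l + (m + n)) *
      (l * radialForce k l m n - centrifugalBound k m n - n
        - (20 / 9 * k * ((l + m) * ((1 + k) * l - (m + n))) / n + l / 6)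
          * (kineticBoundNum m n / ((1 + m * n) * (1 - m * n))))
      = evenPart k m n + l * oddPart k m n := by
  obtain ⟨A, hA'⟩ : ∃ A, A = 1 + m * n := ⟨_, rfl⟩
  obtain ⟨B, hB'⟩ : ∃ B, B = 1 - m * n := ⟨_, rfl⟩
  obtain ⟨b, hb⟩ : ∃ b, b = m + n := ⟨_, rfl⟩
  obtain ⟨a, ha⟩ : ∃ a, a = m - n := ⟨_, rfl⟩
  obtain ⟨K, hK⟩ : ∃ K, K = kineticBoundNum m n := ⟨_, rfl⟩
  obtain ⟨L, hL⟩ : ∃ L, L = (1 + m ^ 2) * (1 + n ^ 2) / 2 := ⟨_, rfl⟩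
  obtain ⟨C, hC⟩ : ∃ C, C = centrifugalBound k m n := ⟨_, rfl⟩
  have hBb : ((1 + k) * l + b) * ((1 + k) * l - b) = B ^ 2 := by
    rw [hb, hB']; linear_combination (1 + k) ^ 2 * hl + (1 + m ^ 2) * (1 + n ^ 2) / 2 * hk
  have h1 : A ^ 3 * B * ((1 + k) * l + b) * (l * radialForce k l m n)
      = (1 + k) * l ^ 2 * (((1 + k) * l + b) + k * a) * A ^ 3
        + (1 + k) * l ^ 2 * B * ((1 + k) * l + b) * (k * A ^ 2 - (k * ((1 + k) * l) + a) * b) := by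
    have : (B ^ 2 + k * a * ((1 + k) * l - b)) / B ^ 3 * (B * ((1 + k) * l + b))
        = ((1 + k) * l + b) + k * a := by
      have hB0 : B ≠ 0 := by rwa [hB']
      field_simp
      linear_combination k * a * hBb
    have h2 : A ^ 3 * ((k * A ^ 2 - (k * ((1 + k) * l) + a) * b) / A ^ 3)
        = (k * A ^ 2 - (k * ((1 + k) * l) + a) * b) := by
      have hA0 : A ≠ 0 := by rwa [hA']
      field_simp
    unfold radialForce
    rw [← hA', ← hB', ← ha, ← hb]
    linear_combination (1 + k) * l ^ 2 * A ^ 3 * this + (1 + k) * l ^ 2 * B * ((1 + k) * l + b) * h2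
  have h3 : n * A ^ 3 * B * ((1 + k) * l + b) *
      ((20 / 9 * k * ((l + m) * ((1 + k) * l - b)) / n + l / 6) * (K / (A * B)))
      = (20 / 9 * k * (l + m) * B ^ 2 + n * ((1 + k) * l + b) * l / 6) * K * A ^ 2 := by
    have hB0 : B ≠ 0 := by rwa [hB']
    have hA0 : A ≠ 0 := by rwa [hA']
    field_simp
    linear_combination (20 * 6 * k * (l + m) * K) * hBb
  have hev : evenPart k m n = n * (L * ((1 + k) * b + (1 - k) * a) * A ^ 3
      + L * b * B * ((1 - k) * A ^ 2 - (1 + k) * (a * b) - (1 - k) * (2 * L))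
      - b * (C + n) * A ^ 3 * B) - 20 / 9 * k * m * (B * A) ^ 2 * K
      - n * (1 + k) * L / 6 * A ^ 2 * K := by
    rw [hL, hA', hB', ha, hb, hC, hK]; unfold evenPart; ring
  have hod : oddPart k m n = n * (2 * L * A ^ 3 + 2 * L * B * (k * A ^ 2 - a * b - k * b ^ 2)
      - (1 + k) * (C + n) * A ^ 3 * B) - 20 / 9 * k * (B * A) ^ 2 * K - n * b / 6 * A ^ 2 * K := by
    have : (1 + k) * C = (1 + k) * (2 * m - 2 * m ^ 3 * (2 - L))
          - (1 - k) * m * n * (2 * m * (2 - L) + (3 - L)) := by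
      rw [hC, hL]; unfold centrifugalBound
      linear_combination (-(2 * m ^ 2 * n * (2 - (1 + m ^ 2) * (1 + n ^ 2) / 2))
        - m * n * (3 - (1 + m ^ 2) * (1 + n ^ 2) / 2)) * hk
    have h2 : (1 + k) * (C + n) = ((1 + k) * (2 * m - 2 * m ^ 3 * (2 - L) + n)
          - (1 - k) * m * n * (2 * m * (2 - L) + (3 - L))) := by
      linear_combination this
    rw [h2, hL, hA', hB', ha, hb, hK]; unfold oddPart; ring
  rw [← hL] at hl
  rw [← hA', ← hB', ← hb, ← hK, ← hC, hev, hod]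
  have e1 : n * ((1 + k) * l ^ 2 * (((1 + k) * l + b) + k * a) * A ^ 3)
      = n * (L * ((1 + k) * b + (1 - k) * a) * A ^ 3) + l * (n * (2 * L * A ^ 3)) := by
    linear_combination n * A ^ 3 * (1 + k) * (((1 + k) * l + b) + k * a) * hl
      + n * A ^ 3 * L * (l + a) * hk
  have e2 : n * ((1 + k) * l ^ 2 * B * ((1 + k) * l + b)
        * (k * A ^ 2 - (k * ((1 + k) * l) + a) * b))
      = n * (L * b * B * ((1 - k) * A ^ 2 - (1 + k) * (a * b) - (1 - k) * (2 * L)))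
        + l * (n * (2 * L * B * (k * A ^ 2 - a * b - k * b ^ 2))) := by
    linear_combination
      n * B * ((1 + k) * ((1 + k) * l * (k * A ^ 2 - a * b) + b * (k * A ^ 2 - a * b)
        - k * (1 + k) * l * b ^ 2) - (1 + k) ^ 3 * k * b * (l ^ 2 + L)) * hl
      + n * B * L * (l * (k * A ^ 2 - a * b - k * b ^ 2) + b * A ^ 2
        - L * b * (k ^ 2 + k + 2)) * hk
  linear_combination n * h1 - h3 + e1 + e2 - n * (1 + k) * A ^ 2 / 6 * K * hl

/-- The potential force along `q - q_m` dominates the centrifugal term and the kinetic terms. The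
summand `n` exceeds the `9 / 10 * n` that `elliptic_radial_pos` spends, which makes the final
inequality strict. -/
theorem radialForce_bound {k l m n : ℝ} (hk : k ^ 2 = 1 - 2 * k) (hk₀ : 0 < k)
    (hl : l ^ 2 = (1 + m ^ 2) * (1 + n ^ 2) / 2) (hl₀ : 0 < l) (hm₀ : 0 ≤ m) (hm₁ : m ≤ 1)
    (hn₀ : 0 < n) (hn₁ : n ≤ 1) (hB : 0 < 1 - m * n) :
    centrifugalBound k m n + n
      + (20 / 9 * k * ((l + m) * ((1 + k) * l - (m + n))) / n + l / 6)
          * (kineticBoundNum m n / ((1 + m * n) * (1 - m * n))) ≤ l * radialForce k l m n := by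
  have hk1 : 2 / 5 ≤ k := by nlinarith
  have hk2 : k ≤ 5 / 12 := by nlinarith
  have hA : 0 < 1 + m * n := by positivity
  have key := even_add_odd hk hl hB.ne' hA.ne' hn₀.ne'
  have hP := evenPart_nonneg hk1 hk2 hm₀ hm₁ hn₀.le hn₁
  have hQ := oddPart_nonneg hk1 hk2 hm₀ hm₁ hn₀.le hn₁
  have hpos : 0 < n * (1 + m * n) ^ 3 * (1 - m * n) * ((1 + k) * l + (m + n)) := by positivity
  have h0 : 0 ≤ n * (1 + m * n) ^ 3 * (1 - m * n) * ((1 + k) * l + (m + n)) *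
      (l * radialForce k l m n - centrifugalBound k m n - n
        - (20 / 9 * k * ((l + m) * ((1 + k) * l - (m + n))) / n + l / 6)
          * (kineticBoundNum m n / ((1 + m * n) * (1 - m * n)))) := by
    rw [key]; positivity
  linarith [nonneg_of_mul_nonneg_right h0 hpos]

/-- The denominators are replaced by tangent lines in `l²` at `l = 1`: `3 - l² ≤ 2 / l` and
`2 - l² ≤ 1 / l²`. -/
theorem centrifugal_le {k l m n : ℝ} (hk₀ : 0 < k)
    (hl : l ^ 2 = (1 + m ^ 2) * (1 + n ^ 2) / 2) (hl₀ : 0 < l) (hm₀ : 0 ≤ m) (hn₀ : 0 < n) :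
    2 * (l - m - k * n) * (m / l) * (1 + m / l) ≤ centrifugalBound k m n := by
  have h1 : 3 - l ^ 2 ≤ 2 / l := by
    rw [le_div_iff₀ hl₀]; nlinarith [mul_nonneg (sq_nonneg (l - 1)) (by linarith : 0 ≤ l + 2)]
  have h2 : 2 - l ^ 2 ≤ 1 / l ^ 2 := by
    rw [le_div_iff₀ (by positivity)]; nlinarith [sq_nonneg (l ^ 2 - 1)]
  have h3 : 2 * (l - m - k * n) * (m / l) * (1 + m / l)
      = 2 * m - 2 * m ^ 2 * (m + k * n) * (1 / l ^ 2) - m * k * n * (2 / l) := by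
    field_simp; ring
  rw [h3]; unfold centrifugalBound; rw [← hl]
  have := mul_le_mul_of_nonneg_left h2 (by positivity : 0 ≤ 2 * m ^ 2 * (m + k * n))
  have := mul_le_mul_of_nonneg_left h1 (by positivity : 0 ≤ m * k * n)
  linarith

/-- The bound for twice the available kinetic energy `-1 - U`, where the effective potential `U`
is the sum of `-m (1 + n²) / ((1 + m n) (1 - m n))` and half the centrifugal term
`-(1 - m² / l²)`. -/
theorem kinetic_le {l m n : ℝ} (hl : l ^ 2 = (1 + m ^ 2) * (1 + n ^ 2) / 2) (hl₀ : 0 < l)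
    (hm₀ : 0 ≤ m) (hm₁ : m ≤ 1) (hB : 0 < 1 - m * n) (hn₀ : 0 < n) :
    2 * m * (1 + n ^ 2) / ((1 + m * n) * (1 - m * n)) + (1 - m ^ 2 / l ^ 2) - 2
      ≤ kineticBoundNum m n / ((1 + m * n) * (1 - m * n)) := by
  have hAB : 0 < (1 + m * n) * (1 - m * n) := by positivity
  have h1 : m ^ 2 - n ^ 2 ≤ m ^ 2 / l ^ 2 := by
    rw [le_div_iff₀ (by positivity), hl]
    have : m ^ 2 ≤ 1 := by nlinarith
    nlinarith [mul_nonneg (sq_nonneg n) (sub_nonneg.2 this),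
      mul_nonneg (sq_nonneg m) (sub_nonneg.2 this),
      mul_nonneg (mul_nonneg (sq_nonneg n) (sq_nonneg n)) (sub_nonneg.2 this),
      mul_nonneg (mul_nonneg (sq_nonneg m) (sq_nonneg n)) (sub_nonneg.2 this),
      sq_nonneg (m * n), sq_nonneg n, sq_nonneg (n ^ 2), sq_nonneg (m * n ^ 2)]
  have h2 : 2 * m * (1 + n ^ 2) / ((1 + m * n) * (1 - m * n)) - 1
      - kineticBoundNum m n / ((1 + m * n) * (1 - m * n))
      = (2 * m * (1 - m * n ^ 2)) / ((1 + m * n) * (1 - m * n)) - n ^ 2 + (1 - m) ^ 2 - 1 := by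
    have : 1 - m * n ≠ 0 := hB.ne'
    have : 1 + m * n ≠ 0 := by positivity
    unfold kineticBoundNum; field_simp; ring
  have h3 : (2 * m * (1 - m * n ^ 2)) / ((1 + m * n) * (1 - m * n)) ≤ 2 * m := by
    rw [div_le_iff₀ hAB]
    nlinarith [mul_nonneg (mul_nonneg hm₀ hm₀) (mul_nonneg (sub_nonneg.2 hm₁) (sq_nonneg n))]
  linarith

/-- The Cauchy-Schwarz inequality and the inequality of arithmetic and geometric means, with weight
`s`, for the linear term with coefficients `z`. -/
theorem linear_term_ge {z₁ z₂ Q₁ Q₂ Y s : ℝ} (hs : 0 < s) (hz : z₁ ^ 2 + z₂ ^ 2 ≤ Y) :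
    -(Y / s * (Q₁ ^ 2 + Q₂ ^ 2) + s) ≤ 2 * (z₁ * Q₁ + z₂ * Q₂) := by
  have h1 : 0 ≤ (z₁ * Q₁ + z₂ * Q₂ + s) ^ 2 + (z₁ * Q₂ - z₂ * Q₁) ^ 2 := by positivity
  have h2 : (z₁ ^ 2 + z₂ ^ 2) * (Q₁ ^ 2 + Q₂ ^ 2) ≤ Y * (Q₁ ^ 2 + Q₂ ^ 2) := by gcongr
  have h3 : Y / s * (Q₁ ^ 2 + Q₂ ^ 2) + s + 2 * (z₁ * Q₁ + z₂ * Q₂)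
      = (Y * (Q₁ ^ 2 + Q₂ ^ 2) + s ^ 2 + 2 * s * (z₁ * Q₁ + z₂ * Q₂)) / s := by
    field_simp
  have h4 : 0 ≤ (Y * (Q₁ ^ 2 + Q₂ ^ 2) + s ^ 2 + 2 * s * (z₁ * Q₁ + z₂ * Q₂)) / s :=
    div_nonneg (by nlinarith) hs.le
  linarith

/-- By the Cauchy-Schwarz inequality, `(l - m - k n) / l ≥ -1 / 12`: this is half the logarithmic
derivative of the conformal factor `(1 + |q|²)²` along `q - q_m`, which may be negative. -/
theorem add_mul_le {k l m n : ℝ} (hk : k ^ 2 = 1 - 2 * k) (hk₀ : 0 < k)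
    (hl : l ^ 2 = (1 + m ^ 2) * (1 + n ^ 2) / 2) (hl₀ : 0 < l) (hm₀ : 0 ≤ m) (hm₁ : m ≤ 1)
    (hn₀ : 0 ≤ n) (hn₁ : n ≤ 1) : m + k * n ≤ 13 / 12 * l := by
  have h1 : 0 ≤ (1 - m ^ 2) * (1 - n ^ 2) :=
    mul_nonneg (by nlinarith) (by nlinarith)
  have h3 : m ^ 2 + n ^ 2 ≤ l ^ 2 := by rw [hl]; linarith
  have h4 : (m + k * n) ^ 2 ≤ (1 + k ^ 2) * (m ^ 2 + n ^ 2) := by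
    linarith [sq_nonneg (k * m - n)]
  have h5 : 1 + k ^ 2 ≤ (13 / 12) ^ 2 := by
    have : 0.414 ≤ k := by nlinarith
    rw [hk]; linarith
  have h6 : (m + k * n) ^ 2 ≤ (13 / 12 * l) ^ 2 := by
    calc _ ≤ (1 + k ^ 2) * (m ^ 2 + n ^ 2) := h4
      _ ≤ (13 / 12) ^ 2 * l ^ 2 := by gcongr
      _ = _ := by ring
  exact (abs_le_of_sq_le_sq' h6 (by positivity)).2

set_option maxHeartbeats 800000 in
/-- Radial monotonicity in elliptic coordinates. Here `q = (n t, v)` is the position, `m t` and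
`l t` are `(1 - |q|²) / 2` and `(1 + |q|²) / 2`, the primary is `(k, 0)`, and the velocity `Q` in
the rotating frame replaces the momentum: the derivative is then `d |Q|² + z · Q` plus terms without
`Q`, where `|z|²` is at most the scaled square `Y` of the distance to the primary. The linear term
is absorbed with `linear_term_ge`, and what remains is `radialForce_bound`. -/
theorem elliptic_radial_pos {k l m n t v p₁ p₂ : ℝ} (hk : k ^ 2 = 1 - 2 * k) (hk₀ : 0 < k)
    (hl : l ^ 2 = (1 + m ^ 2) * (1 + n ^ 2) / 2) (hl₀ : 0 < l) (hm₀ : 0 < m) (hm₁ : m ≤ 1)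
    (hn₀ : 0 < n) (hn₁ : n ≤ 1) (hB : 0 < 1 - m * n) (ht : (l + m) * t = 1)
    (hv : v ^ 2 + (n * t) ^ 2 = (l - m) * t)
    (hH : (2 * l * t) ^ 2 * (p₁ ^ 2 + p₂ ^ 2) / 8 + (v * p₁ - n * t * p₂)
      - m * (1 + n ^ 2) / ((1 + m * n) * (1 - m * n)) < -1) :
    0 < l * t * ((l - m) * t - k * (n * t)) * (p₁ ^ 2 + p₂ ^ 2) + (v * p₁ - (n * t - k) * p₂)
      + radialForce k l m n / 2 := by
  have hlm : 0 < l + m := by positivity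
  have ht' : t = 1 / (l + m) := by field_simp; linarith
  have ht0 : 0 < t := by rw [ht']; positivity
  obtain ⟨e, he⟩ : ∃ e, e = (l + m) / l := ⟨_, rfl⟩
  have hel : e * (l * t) = 1 := by rw [he]; field_simp; linarith
  obtain ⟨d, hd⟩ : ∃ d, d = (l - m - k * n) / l := ⟨_, rfl⟩
  obtain ⟨Q₁, hQ₁⟩ : ∃ Q, Q = l * t * p₁ + e * v := ⟨_, rfl⟩
  obtain ⟨Q₂, hQ₂⟩ : ∃ Q, Q = l * t * p₂ - e * (n * t) := ⟨_, rfl⟩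
  obtain ⟨J, hJ⟩ : ∃ J, J = Q₁ ^ 2 + Q₂ ^ 2 := ⟨_, rfl⟩
  have hJ0 : 0 ≤ J := by rw [hJ]; positivity
  obtain ⟨Y, hY⟩ : ∃ Y, Y = 2 * k * (l + m) * ((1 + k) * l - (m + n)) / l ^ 2 := ⟨_, rfl⟩
  -- with the weight `9 / 10 * n / l` in the inequality of means, the polynomials `evenPart` and
  -- `oddPart` have nonnegative Bernstein coefficients
  obtain ⟨s, hs⟩ : ∃ s, s = 9 / 10 * n / l := ⟨_, rfl⟩
  have hs0 : 0 < s := by rw [hs]; positivity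
  obtain ⟨Kh, hKh⟩ : ∃ K, K = kineticBoundNum m n / ((1 + m * n) * (1 - m * n)) := ⟨_, rfl⟩
  have heh : e ^ 2 * ((l - m) * t) = 1 - m ^ 2 / l ^ 2 := by
    rw [he, ht']; field_simp; ring
  -- the available kinetic energy
  have hJK : J ≤ Kh := by
    have h1 : J = 2 * ((2 * l * t) ^ 2 * (p₁ ^ 2 + p₂ ^ 2) / 8 + (v * p₁ - n * t * p₂))
        + (1 - m ^ 2 / l ^ 2) := by
      rw [← heh, ← hv, hJ, hQ₁, hQ₂]; linear_combination 2 * (v * p₁ - n * t * p₂) * hel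
    have h2 := kinetic_le hl hl₀ hm₀.le hm₁ hB hn₀
    have h3 : 2 * m * (1 + n ^ 2) / ((1 + m * n) * (1 - m * n))
        = 2 * (m * (1 + n ^ 2) / ((1 + m * n) * (1 - m * n))) := by ring
    rw [← hKh, h3] at h2
    linarith
  have hd1 : -(1 / 12) ≤ d := by
    have := add_mul_le hk hk₀ hl hl₀ hm₀.le hm₁ hn₀.le hn₁
    rw [hd, le_div_iff₀ hl₀]; linarith
  obtain ⟨z₁, hz₁⟩ : ∃ z, z = e * v - 2 * d * (e * v) := ⟨_, rfl⟩
  obtain ⟨z₂, hz₂⟩ : ∃ z, z = -(e * (n * t - k)) + 2 * d * (e * (n * t)) := ⟨_, rfl⟩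
  have hdx : (l - m) * t - k * (n * t) = d * (l * t) := by rw [hd]; field_simp
  have hz : z₁ ^ 2 + z₂ ^ 2 ≤ Y := by
    have hr : e ^ 2 * (v ^ 2 + (n * t - k) ^ 2) = Y := by
      have : v ^ 2 + (n * t - k) ^ 2 = (l - m) * t - 2 * k * (n * t) + k ^ 2 := by
        linear_combination hv
      rw [this, he, hY, ht']; field_simp
      linear_combination (m - l) * hk
    have h1 : z₁ ^ 2 + z₂ ^ 2 = e ^ 2 * (v ^ 2 + (n * t - k) ^ 2)
        - 4 * d ^ 2 * e ^ 2 * (l * t - (l - m) * t) := by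
      rw [hz₁, hz₂]
      linear_combination (-4 * d * e ^ 2 + 4 * d ^ 2 * e ^ 2) * hv - 4 * d * e ^ 2 * hdx
    rw [h1, hr]
    have : 0 ≤ 4 * d ^ 2 * e ^ 2 * (m * t) := by positivity
    nlinarith
  have hlin := linear_term_ge (Q₁ := Q₁) (Q₂ := Q₂) hs0 hz
  rw [← hJ] at hlin
  have hF := radialForce_bound hk hk₀ hl hl₀ hm₀.le hm₁ hn₀ hn₁ hB
  have hC := centrifugal_le hk₀ hl hl₀ hm₀.le hn₀ (k := k)
  rw [← hKh] at hF
  -- decomposition around the minimum of the kinetic energy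
  have hT : l * t * ((l - m) * t - k * (n * t)) * (p₁ ^ 2 + p₂ ^ 2) + (v * p₁ - (n * t - k) * p₂)
      = d * J + (z₁ * Q₁ + z₂ * Q₂) - d * (m / l) * (1 + m / l) := by
    have h1 : d * (m / l) * (1 + m / l) = d * (e * (m / l)) := by rw [he]; field_simp
    have h2 : e * (m / l) = e ^ 2 * (m * t) := by
      have : m / l = e * (m * t) := by rw [he, ht']; field_simp
      rw [this]; ring
    have hp₁ : p₁ = e * (Q₁ - e * v) := by rw [hQ₁]; linear_combination (-p₁) * hel
    have hp₂ : p₂ = e * (Q₂ + e * (n * t)) := by rw [hQ₂]; linear_combination (-p₂) * hel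
    have h3 : l * t * ((l - m) * t - k * (n * t)) * (p₁ ^ 2 + p₂ ^ 2)
        = d * ((l * t * p₁) ^ 2 + (l * t * p₂) ^ 2) := by rw [hdx]; ring
    have h4 : l * t * p₁ = Q₁ - e * v := by rw [hQ₁]; ring
    have h5 : l * t * p₂ = Q₂ + e * (n * t) := by rw [hQ₂]; ring
    rw [h3, h4, h5, h1, h2, hz₁, hz₂, hJ]
    rw [hp₁, hp₂]
    linear_combination (d * e ^ 2 - e ^ 2) * hv - e ^ 2 * hdx
  have hYs : l * (Y / s) = 20 / 9 * k * ((l + m) * ((1 + k) * l - (m + n))) / n := by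
    rw [hY, hs]; field_simp; ring
  rw [← hYs] at hF
  have h7 : 0 ≤ l * J * (d + 1 / 12) := mul_nonneg (by positivity) (by linarith)
  have h9 : 2 * (l - m - k * n) * (m / l) * (1 + m / l)
      = l * (2 * (d * (m / l) * (1 + m / l))) := by
    have hdl : l * d = l - m - k * n := by rw [hd]; field_simp
    rw [← hdl]; ring
  rw [h9] at hC
  have hls : l * s = 9 / 10 * n := by rw [hs]; field_simp
  rw [hT]
  clear hT hdx hH heh hv hd1 hz₁ hz₂ hQ₁ hQ₂ hel hJ hk hl hm₁ hn₁ hB ht' ht hd he hYs hY hKh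
  have hY0 : 0 ≤ Y := le_trans (by positivity) hz
  have h6 : (l * (Y / s) + l / 6) * J ≤ (l * (Y / s) + l / 6) * Kh := by gcongr
  have h8 : l * (2 * (z₁ * Q₁ + z₂ * Q₂)) ≥ l * -(Y / s * J + s) := by gcongr
  have : 0 < l * (2 * (d * J + (z₁ * Q₁ + z₂ * Q₂) - d * (m / l) * (1 + m / l)
      + radialForce k l m n / 2)) := by
    linarith
  have := (mul_pos_iff_of_pos_left hl₀).1 this
  linarith

/-! ### Radial monotonicity of the Hamiltonian -/

set_option maxHeartbeats 800000 in
/-- Radial monotonicity of the Hamiltonian: on the open half disc, off the primary `(k, 0)`,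
the derivative of the Hamiltonian at fixed momentum along `q - (k, 0)` is positive wherever the
Hamiltonian is below `-1`. -/
theorem radial_derivative_pos {x v p₁ p₂ k D₁ D₂ h n₁ n₂ : ℝ} (hk : k ^ 2 = 1 - 2 * k)
    (hk₀ : 0 < k) (hh : h = x ^ 2 + v ^ 2) (hx : 0 < x) (hh₁ : h < 1) (hD₁ : 0 < D₁)
    (hD₂ : 0 < D₂) (hn₁ : n₁ = -x - (h - 1) / 2) (hn₂ : n₂ = x - (h - 1) / 2)
    (hs₁ : D₁ ^ 2 = 2 * (1 + h) ^ 2 - 4 * n₁ ^ 2) (hs₂ : D₂ ^ 2 = 2 * (1 + h) ^ 2 - 4 * n₂ ^ 2)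
    (hH : (h + 1) ^ 2 * (p₁ ^ 2 + p₂ ^ 2) / 8 + (v * p₁ - x * p₂) - n₁ / D₁ - n₂ / D₂ < -1) :
    0 < (1 + h) / 2 * (h - k * x) * (p₁ ^ 2 + p₂ ^ 2) + (v * p₁ - (x - k) * p₂)
      + 2 * (1 + h) * (((1 + h) * (x - k) + 2 * (1 - x) * (h - k * x)) / D₁ ^ 3
        + (2 * (1 + x) * (h - k * x) - (1 + h) * (x - k)) / D₂ ^ 3) := by
  have hh0 : 0 ≤ h := by rw [hh]; positivity
  -- elliptic coordinates `m`, `n`, in which `D₁ = 2 t (1 + m n)` and `D₂ = 2 t (1 - m n)`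
  obtain ⟨t, ht⟩ : ∃ t, t = (D₁ + D₂) / 4 := ⟨_, rfl⟩
  have ht0 : 0 < t := by rw [ht]; positivity
  obtain ⟨m, hm⟩ : ∃ m, m = (1 - h) / (2 * t) := ⟨_, rfl⟩
  obtain ⟨n, hn⟩ : ∃ n, n = x / t := ⟨_, rfl⟩
  obtain ⟨l, hl⟩ : ∃ l, l = (1 + h) / (2 * t) := ⟨_, rfl⟩
  have hm0 : 0 < m := by rw [hm]; exact div_pos (by linarith) (by positivity)
  have hn0 : 0 < n := by rw [hn]; positivity
  have hl0 : 0 < l := by rw [hl]; positivity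
  have hmt : m * t = (1 - h) / 2 := by rw [hm]; field_simp
  have hnt : n * t = x := by rw [hn]; field_simp
  have hlt : l * t = (1 + h) / 2 := by rw [hl]; field_simp
  have hdiff : D₁ - D₂ = 4 * t * (m * n) := by
    have : (D₁ - D₂) * (4 * t) = 8 * x * (1 - h) := by
      rw [ht]; linear_combination hs₁ - hs₂ + (-4 * n₁ + 4 * x + 2 * (h - 1)) * hn₁
        + (4 * n₂ + 4 * x - 2 * (h - 1)) * hn₂
    have h2 : (4 * t * (m * n)) * (4 * t) = 8 * x * (1 - h) := by
      linear_combination 16 * (n * t) * hmt + 8 * (1 - h) * hnt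
    exact mul_right_cancel₀ (by positivity : (4 * t) ≠ 0) (this.trans h2.symm)
  have hA : D₁ = 2 * t * (1 + m * n) := by linarith
  have hB : D₂ = 2 * t * (1 - m * n) := by linarith
  have hB0 : 0 < 1 - m * n := by
    rw [hB] at hD₂; exact (mul_pos_iff_of_pos_left (by positivity)).1 hD₂
  have hA0 : 0 < 1 + m * n := by positivity
  have hl2 : l ^ 2 = (1 + m ^ 2) * (1 + n ^ 2) / 2 := by
    have h1 : t ^ 2 * (2 * l ^ 2) = t ^ 2 * ((1 + m ^ 2) * (1 + n ^ 2)) := by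
      rw [hA] at hs₁; rw [hB] at hs₂
      subst hn₁ hn₂
      linear_combination (-1 / 8) * hs₁ - (1 / 8) * hs₂ + 2 * (l * t + (1 + h) / 2) * hlt
        - (m * t + (1 - h) / 2) * hmt - (n * t + x) * hnt
    have := mul_left_cancel₀ (by positivity : t ^ 2 ≠ 0) h1
    linarith
  have hle : 0 ≤ (1 - m ^ 2) * (1 - n ^ 2) := by
    have h1 : t ^ 2 * ((1 - m ^ 2) * (1 - n ^ 2)) = 2 * v ^ 2 := by
      have : t ^ 2 * ((1 - m ^ 2) * (1 - n ^ 2)) = 2 * t ^ 2 * l ^ 2 - 2 * t ^ 2 * m ^ 2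
        - 2 * t ^ 2 * n ^ 2 := by rw [hl2]; ring
      rw [this]
      linear_combination 2 * (l * t + (1 + h) / 2) * hlt - 2 * (m * t + (1 - h) / 2) * hmt
        - 2 * (n * t + x) * hnt + 2 * hh
    have h2 : 0 ≤ t ^ 2 * ((1 - m ^ 2) * (1 - n ^ 2)) := by rw [h1]; positivity
    exact nonneg_of_mul_nonneg_right h2 (by positivity)
  have hm1n1 : m ≤ 1 ∧ n ≤ 1 := by
    by_contra hcon
    rw [not_and_or, not_le, not_le] at hcon
    rcases hcon with h1 | h1
    · have : n < 1 := by nlinarith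
      nlinarith [mul_pos (by nlinarith : 0 < m ^ 2 - 1) (by nlinarith : 0 < 1 - n ^ 2)]
    · have : m < 1 := by nlinarith
      nlinarith [mul_pos (by nlinarith : 0 < n ^ 2 - 1) (by nlinarith : 0 < 1 - m ^ 2)]
  have e1 : n₁ / D₁ = (m - n) / (1 + m * n) / 2 := by
    have : n₁ = t * (m - n) := by rw [hn₁]; linarith
    rw [this, hA]; field_simp
  have e2 : n₂ / D₂ = (m + n) / (1 - m * n) / 2 := by
    have : n₂ = t * (m + n) := by rw [hn₂]; linarith
    have := hB0.ne'
    rw [‹n₂ = _›, hB]; field_simp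
  have hV : n₁ / D₁ + n₂ / D₂ = m * (1 + n ^ 2) / ((1 + m * n) * (1 - m * n)) := by
    have := hB0.ne'
    rw [e1, e2]; field_simp; ring
  have hF : radialForce k l m n / 2
      = 2 * (1 + h) * (((1 + h) * (x - k) + 2 * (1 - x) * (h - k * x)) / D₁ ^ 3
        + (2 * (1 + x) * (h - k * x) - (1 + h) * (x - k)) / D₂ ^ 3) := by
    have hlm : (l + m) * t = 1 := by linarith
    have hh' : h = (l - m) * t := by linarith
    have hw : 1 + h = 2 * (l * t) := by linarith
    have hN₁ : ((1 + h) * (x - k) + 2 * (1 - x) * (h - k * x))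
        = t ^ 2 * (1 + k) * (k * (1 + m * n) ^ 2 - (k * ((1 + k) * l) + (m - n)) * (m + n)) := by
      rw [hw, hh', ← hnt]
      have e : 2 * (l * t) * (n * t - k) + 2 * (1 - n * t) * ((l - m) * t - k * (n * t))
          = t ^ 2 * (2 * l * (n - k * (l + m)) + 2 * (l + m - n) * (l - m - k * n)) := by
        linear_combination (2 * k * l * t  - 2 * t * ((l - m) - k * n)) * hlm
      rw [e]
      linear_combination t ^ 2 * (2 * k * (1 + k)) * hl2
        + t ^ 2 * (-2 * l ^ 2 + k * l * (m + n) + (m - n) ^ 2) * hk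
    have hN₂ : (2 * (1 + x) * (h - k * x) - (1 + h) * (x - k))
        = t ^ 2 * (1 + k) * ((1 - m * n) ^ 2 + k * (m - n) * ((1 + k) * l - (m + n))) := by
      rw [hw, hh', ← hnt]
      have e : 2 * (1 + n * t) * ((l - m) * t - k * (n * t)) - 2 * (l * t) * (n * t - k)
          = t ^ 2 * (2 * (l + m + n) * (l - m - k * n) - 2 * l * (n - k * (l + m))) := by
        linear_combination (-2 * k * l * t  - 2 * t * ((l - m) - k * n)) * hlm
      rw [e]
      linear_combination t ^ 2 * (2 + 2 * k) * hl2 + t ^ 2 * (m ^ 2 - n ^ 2 - l * k * (m - n)) * hk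
    have := hB0.ne'
    rw [hN₁, hN₂, hA, hB, hw]; unfold radialForce; field_simp; ring
  have key := elliptic_radial_pos (p₁ := p₁) (p₂ := p₂) (v := v) hk hk₀ hl2 hl0 hm0 hm1n1.1 hn0
    hm1n1.2 hB0 (by linarith : (l + m) * t = 1) (by rw [hnt]; linarith) (by
      rw [← hV, hnt]
      have : 2 * l * t = h + 1 := by linarith
      rw [this]; linarith)
  rw [hF, hlt, hnt, show (l - m) * t = h by linarith] at key
  exact key

/-! ### The Hamiltonian on the half disc -/

theorem side_mul_self (i : Fin 2) : side i * side i = 1 := by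
  fin_cases i <;> simp [side]

theorem side_other (i : Fin 2) : side (other i) = -side i := by
  fin_cases i <;> simp [side, other]

theorem norm_sq_plane (q : Plane) : ‖q‖ ^ 2 = q 0 ^ 2 + q 1 ^ 2 := by
  rw [EuclideanSpace.real_norm_sq_eq, Fin.sum_univ_two]

theorem hamiltonian_eq (i : Fin 2) (z : Plane × Plane) :
    hamiltonian z = (‖z.1‖ ^ 2 + 1) ^ 2 * ‖z.2‖ ^ 2 / 8 + (z.1 1 * z.2 0 - z.1 0 * z.2 1)
      + potential i z.1 + potential (other i) z.1 := by
  fin_cases i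
  · rfl
  · simp only [hamiltonian]
    show _ = _ + potential 1 z.1 + potential 0 z.1
    ring

/-- The product of the distances to a primary and to its antipode. -/
def chord (j : Fin 2) (q : Plane) : ℝ := dist q (primary j) * dist q (antipode j)

theorem chord_nonneg (j : Fin 2) (q : Plane) : 0 ≤ chord j q := by
  unfold chord; positivity

theorem chord_sq (j : Fin 2) (q : Plane) :
    chord j q ^ 2 = 2 * (1 + ‖q‖ ^ 2) ^ 2 - 4 * potentialNum j q ^ 2 := by
  have h2 : √2 ^ 2 = (2 : ℝ) := Real.sq_sqrt zero_le_two
  have hs := side_mul_self j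
  have h1 : dist q (primary j) ^ 2 = ‖q‖ ^ 2 - 2 * (side j * q 0) * (√2 - 1) + (√2 - 1) ^ 2 := by
    rw [dist_eq_norm, norm_sq_plane, norm_sq_plane]
    simp [primary]
    linear_combination (√2 - 1) ^ 2 * hs
  have h3 : dist q (antipode j) ^ 2 = ‖q‖ ^ 2 + 2 * (side j * q 0) * (√2 + 1) + (√2 + 1) ^ 2 := by
    rw [dist_eq_norm, norm_sq_plane, norm_sq_plane]
    simp [antipode]
    linear_combination (√2 + 1) ^ 2 * hs
  rw [chord, mul_pow, h1, h3, potentialNum]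
  obtain ⟨x, hx⟩ : ∃ x, x = side j * q 0 := ⟨_, rfl⟩
  obtain ⟨h, hh⟩ : ∃ h, h = ‖q‖ ^ 2 := ⟨_, rfl⟩
  rw [← hx, ← hh]
  obtain ⟨r, hr⟩ : ∃ r, r = √2 := ⟨_, rfl⟩
  rw [← hr] at h2 ⊢
  linear_combination (2 * h + r ^ 2 - 4 * x ^ 2 - 4 * x) * h2

theorem potential_eq (j : Fin 2) (q : Plane) :
    potential j q = -(potentialNum j q / chord j q) := rfl

/-- The half of the unit disc around a primary, whose boundary the motion below the critical energy
cannot cross. -/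
def halfDisc (i : Fin 2) : Set Plane := {q | 0 < side i * q 0 ∧ ‖q‖ < 1}

theorem isOpen_halfDisc (i : Fin 2) : IsOpen (halfDisc i) :=
  have h : Continuous fun q : Plane => side i * q 0 := by fun_prop
  (isOpen_lt continuous_const h).inter (isOpen_lt continuous_norm continuous_const)

/-- The closed half disc. -/
def closedHalfDisc (i : Fin 2) : Set Plane := {q | 0 ≤ side i * q 0 ∧ ‖q‖ ≤ 1}

theorem isClosed_closedHalfDisc (i : Fin 2) : IsClosed (closedHalfDisc i) :=
  have h : Continuous fun q : Plane => side i * q 0 := by fun_prop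
  (isClosed_le continuous_const h).inter (isClosed_le continuous_norm continuous_const)

theorem halfDisc_subset (i : Fin 2) : halfDisc i ⊆ closedHalfDisc i := fun _ h => ⟨h.1.le, h.2.le⟩

theorem norm_primary (i : Fin 2) : ‖primary i‖ = √2 - 1 := by
  have h1 : 0 ≤ √2 - 1 := by
    have := Real.one_lt_sqrt_two; linarith
  rw [← pow_left_inj₀ (norm_nonneg _) h1 two_ne_zero, norm_sq_plane]
  simp [primary, mul_pow]
  rw [sq, side_mul_self, one_mul]

theorem primary_mem_halfDisc (i : Fin 2) : primary i ∈ halfDisc i := by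
  have h1 := Real.one_lt_sqrt_two
  have h2 : √2 < 2 := by
    rw [Real.sqrt_lt' two_pos]; norm_num
  refine ⟨?_, by rw [norm_primary]; linarith⟩
  simpa [primary, ← mul_assoc, side_mul_self] using h1

theorem ne_primary_other {i : Fin 2} {q : Plane} (hq : q ∈ closedHalfDisc i) :
    q ≠ primary (other i) := by
  rintro rfl
  have h := hq.1
  have h1 := Real.one_lt_sqrt_two
  simp [primary, ← mul_assoc, side_mul_self, side_other] at h

theorem ne_antipode {i : Fin 2} {q : Plane} (hq : q ∈ closedHalfDisc i) (j : Fin 2) :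
    q ≠ antipode j := by
  rintro rfl
  have h := pow_le_pow_left₀ (norm_nonneg _) hq.2 2
  have h1 := Real.one_lt_sqrt_two
  rw [norm_sq_plane] at h
  simp [antipode, mul_pow] at h
  rw [sq, side_mul_self, one_mul] at h
  nlinarith

theorem chord_pos {j : Fin 2} {q : Plane} (h₁ : q ≠ primary j) (h₂ : q ≠ antipode j) :
    0 < chord j q := mul_pos (dist_pos.2 h₁) (dist_pos.2 h₂)

theorem potentialNum_pos {i : Fin 2} {q : Plane} (hq : q ∈ halfDisc i) : 0 < potentialNum i q := by
  have h := hq.1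
  have h2 : ‖q‖ ^ 2 < 1 := by
    have := hq.2; have := norm_nonneg q; nlinarith
  unfold potentialNum; linarith

theorem hamiltonian_lagrangePoint : hamiltonian lagrangePoint = -1 := by
  have h : ∀ j, potential j 0 = -(1 / 2) := fun j => by
    have h1 : potentialNum j 0 = 1 / 2 := by simp [potentialNum]; norm_num
    have h2 : chord j 0 = 1 := by
      rw [← pow_left_inj₀ (chord_nonneg _ _) zero_le_one two_ne_zero, chord_sq, h1]
      simp; norm_num
    rw [potential_eq, h1, h2, div_one]
  simp [hamiltonian, lagrangePoint, h]; norm_num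

/-- Completing the square in the momentum: the Hamiltonian is at least the effective potential. -/
theorem effective_potential_le (i : Fin 2) (q p : Plane) :
    potential i q + potential (other i) q - 2 * ‖q‖ ^ 2 / (1 + ‖q‖ ^ 2) ^ 2
      ≤ hamiltonian (q, p) := by
  have hw : 0 < 1 + ‖q‖ ^ 2 := by positivity
  have h : 0 ≤ ((1 + ‖q‖ ^ 2) / 2 * p 0 + 2 / (1 + ‖q‖ ^ 2) * q 1) ^ 2 / 2
      + ((1 + ‖q‖ ^ 2) / 2 * p 1 - 2 / (1 + ‖q‖ ^ 2) * q 0) ^ 2 / 2 := by positivity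
  have h' : ((1 + ‖q‖ ^ 2) / 2 * p 0 + 2 / (1 + ‖q‖ ^ 2) * q 1) ^ 2 / 2
      + ((1 + ‖q‖ ^ 2) / 2 * p 1 - 2 / (1 + ‖q‖ ^ 2) * q 0) ^ 2 / 2
      = (‖q‖ ^ 2 + 1) ^ 2 * (p 0 ^ 2 + p 1 ^ 2) / 8 + (q 1 * p 0 - q 0 * p 1)
        + 2 * (q 0 ^ 2 + q 1 ^ 2) / (1 + ‖q‖ ^ 2) ^ 2 := by
    field_simp; ring
  rw [hamiltonian_eq i]
  simp only
  rw [norm_sq_plane p]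
  rw [h', ← norm_sq_plane q] at h
  linarith

/-- On the boundary of the half disc the energy is at least that of the Lagrange point. -/
theorem neg_one_le_hamiltonian {i : Fin 2} {q : Plane} (hq : q ∈ closedHalfDisc i)
    (hq' : q ∉ halfDisc i) (p : Plane) : -1 ≤ hamiltonian (q, p) := by
  refine le_trans ?_ (effective_potential_le i q p)
  have hh : 0 ≤ ‖q‖ ^ 2 := sq_nonneg _
  have hh1 : ‖q‖ ^ 2 ≤ 1 := pow_le_one₀ (norm_nonneg _) hq.2
  obtain ⟨h, hh'⟩ : ∃ h, h = ‖q‖ ^ 2 := ⟨_, rfl⟩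
  rw [← hh'] at hh hh1
  rcases hq.1.eq_or_lt with h0 | h0
  · -- the two potentials coincide on the axis of symmetry
    have hn : ∀ j, side j * q 0 = 0 → potential j q = -((1 - h) / 2 / √(1 + 6 * h + h ^ 2)) := by
      intro j hj
      have hn : potentialNum j q = (1 - h) / 2 := by rw [potentialNum, hj, ← hh']; ring
      have hc : chord j q = √(1 + 6 * h + h ^ 2) := by
        rw [← Real.sqrt_sq (chord_nonneg j q), chord_sq, hn, ← hh']
        congr 1; ring
      rw [potential_eq, hn, hc]
    rw [hn i h0.symm, hn (other i) (by rw [side_other, neg_mul, ← h0, neg_zero]), ← hh']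
    have hr : 1 + h ≤ √(1 + 6 * h + h ^ 2) := Real.le_sqrt_of_sq_le (by nlinarith)
    have h1 : (1 - h) / 2 / √(1 + 6 * h + h ^ 2) ≤ (1 - h) / 2 / (1 + h) :=
      div_le_div_of_nonneg_left (by linarith) (by linarith) hr
    have h2 : 1 - (1 - h) / (1 + h) - 2 * h / (1 + h) ^ 2 = 2 * h ^ 2 / (1 + h) ^ 2 := by
      field_simp; ring
    have h3 : 0 ≤ 2 * h ^ 2 / (1 + h) ^ 2 := by positivity
    have h4 : (1 - h) / 2 / (1 + h) = (1 - h) / (1 + h) / 2 := by ring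
    linarith
  · -- the two potentials cancel on the unit circle
    have h1 : ‖q‖ = 1 := le_antisymm hq.2 (not_lt.1 fun h => hq' ⟨h0, h⟩)
    have hn : potentialNum (other i) q = -potentialNum i q := by
      simp [potentialNum, side_other, h1]
    have hc : chord (other i) q = chord i q := by
      rw [← pow_left_inj₀ (chord_nonneg _ _) (chord_nonneg _ _) two_ne_zero, chord_sq, chord_sq, hn,
        neg_sq]
    rw [potential_eq, potential_eq, hn, hc, h1, neg_div, neg_neg]
    norm_num

/-! ### The regularized Hamiltonian -/

/-- The displacement of the position from the primary; it is linear in `η`. -/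
def displacement (w : Space × Space) : Plane :=
  !₂[w.2 1 * (1 - w.1 0) + w.1 1 * w.2 0, w.2 2 * (1 - w.1 0) + w.1 2 * w.2 0]

theorem position_eq (i : Fin 2) (w : Space × Space) :
    position i w = primary i + displacement w := rfl

theorem displacement_smul (ξ η : Space) (r : ℝ) :
    displacement (ξ, r • η) = r • displacement (ξ, η) := by
  ext j; fin_cases j <;> simp [displacement] <;> ring

theorem le_one_of_mem {w : Space × Space} (hw : w ∈ cotangentSphere) : w.1 0 ≤ 1 := by
  have h := (mem_cotangentSphere_iff_coord.1 hw).1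
  nlinarith [sq_nonneg (w.1 1), sq_nonneg (w.1 2)]

theorem norm_displacement {w : Space × Space} (hw : w ∈ cotangentSphere) :
    ‖displacement w‖ = (1 - w.1 0) * ‖w.2‖ := by
  have h0 := sub_nonneg.2 (le_one_of_mem hw)
  rw [← pow_left_inj₀ (norm_nonneg _) (mul_nonneg h0 (norm_nonneg _)) two_ne_zero, mul_pow,
    norm_sq_plane, norm_sq_space]
  obtain ⟨h1, h2⟩ := mem_cotangentSphere_iff_coord.1 hw
  simp [displacement]
  linear_combination (w.2 0) ^ 2 * h1 + 2 * w.2 0 * (1 - w.1 0) * h2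

theorem dist_position_primary {w : Space × Space} (hw : w ∈ cotangentSphere) (i : Fin 2) :
    dist (position i w) (primary i) = (1 - w.1 0) * ‖w.2‖ := by
  rw [position_eq, dist_eq_norm, add_sub_cancel_left, norm_displacement hw]

/-- The momentum of a point of `T*S²` off the collision fiber: minus the stereographic projection of
`ξ`. -/
def momentum (w : Space × Space) : Plane := !₂[-(w.1 1 / (1 - w.1 0)), -(w.1 2 / (1 - w.1 0))]

/-- Off the collision fiber, the regularized Hamiltonian is `|q - q_{m_i}| (H - c)`. -/
theorem regularizedHamiltonian_eq (i : Fin 2) (c : ℝ) {w : Space × Space}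
    (hw : w ∈ cotangentSphere) (h1 : w.1 0 ≠ 1) (h2 : w.2 ≠ 0) :
    regularizedHamiltonian i c w
      = (1 - w.1 0) * ‖w.2‖ * (hamiltonian (position i w, momentum w) - c) := by
  have h0 : 1 - w.1 0 ≠ 0 := sub_ne_zero.2 h1.symm
  have h3 := norm_ne_zero_iff.2 h2
  obtain ⟨h4, -⟩ := mem_cotangentSphere_iff_coord.1 hw
  have hp : ‖momentum w‖ ^ 2 = (1 + w.1 0) / (1 - w.1 0) := by
    rw [norm_sq_plane]; simp [momentum]; field_simp; linear_combination h4
  have hV : (1 - w.1 0) * ‖w.2‖ * potential i (position i w)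
      = -(potentialNum i (position i w) / dist (position i w) (antipode i)) := by
    rw [potential, dist_position_primary hw]
    by_cases h5 : dist (position i w) (antipode i) = 0
    · simp [h5]
    · field_simp
  have hp0 : momentum w 0 = -(w.1 1 / (1 - w.1 0)) := rfl
  have hp1 : momentum w 1 = -(w.1 2 / (1 - w.1 0)) := rfl
  rw [hamiltonian_eq i, regularizedHamiltonian]
  simp only
  rw [sub_eq_add_neg _ (potentialNum i (position i w) / dist (position i w) (antipode i)), ← hV,
    hp, hp0, hp1]
  field_simp
  ring

/-- On the collision fiber, the regularized Hamiltonian is affine along the rays. -/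
theorem regularizedHamiltonian_collision (i : Fin 2) (c : ℝ) {w : Space × Space}
    (hw : w ∈ cotangentSphere) (h1 : w.1 0 = 1) :
    regularizedHamiltonian i c w = ‖w.2‖ * ((‖primary i‖ ^ 2 + 1) ^ 2 / 4)
      - potentialNum i (primary i) / dist (primary i) (antipode i) := by
  have h2 : position i w = primary i := by
    rw [← dist_eq_zero, dist_position_primary hw, h1, sub_self, zero_mul]
  have h3 : w.1 1 = 0 ∧ w.1 2 = 0 := by
    have := (mem_cotangentSphere_iff_coord.1 hw).1
    rw [h1] at this
    constructor <;> nlinarith [sq_nonneg (w.1 1), sq_nonneg (w.1 2)]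
  rw [regularizedHamiltonian, h2, h1, h3.1, h3.2]
  ring

theorem collision_term_pos (i : Fin 2) :
    0 < potentialNum i (primary i) / dist (primary i) (antipode i) :=
  div_pos (potentialNum_pos (primary_mem_halfDisc i))
    (dist_pos.2 (ne_antipode (halfDisc_subset i (primary_mem_halfDisc i)) i))

theorem contDiffAt_potential {j : Fin 2} {q : Plane} (h₁ : q ≠ primary j) (h₂ : q ≠ antipode j) :
    ContDiffAt ℝ ∞ (potential j) q := by
  have h3 : ContDiffAt ℝ ∞ (potentialNum j) q := by
    have h4 : ContDiffAt ℝ ∞ (fun q : Plane => q 0) q := by fun_prop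
    exact (contDiffAt_const.mul h4).sub
      (((contDiffAt_id.norm_sq ℝ).sub contDiffAt_const).div_const _)
  exact (h3.div ((contDiffAt_id.dist ℝ contDiffAt_const h₁).mul
    (contDiffAt_id.dist ℝ contDiffAt_const h₂)) (chord_pos h₁ h₂).ne').neg

theorem contDiff_position (i : Fin 2) : ContDiff ℝ ∞ (position i) := by
  refine contDiff_const.add ?_
  rw [contDiff_euclidean]
  intro j
  fin_cases j <;> simp <;> fun_prop

/-- Over the closed half disc, the regularized Hamiltonian is `|η| A - B` with smooth `A`, `B`. -/
theorem exists_regularizedHamiltonian_eq (i : Fin 2) (c : ℝ) : ∃ A B : Space × Space → ℝ,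
    (regularizedHamiltonian i c = fun w => ‖w.2‖ * A w - B w) ∧
    ∀ w, position i w ∈ closedHalfDisc i → ContDiffAt ℝ ∞ A w ∧ ContDiffAt ℝ ∞ B w := by
  refine ⟨_, _, rfl, fun w hq => ?_⟩
  have h1 : ∀ j : Fin 3, ContDiffAt ℝ ∞ (fun w : Space × Space => w.1 j) w := fun j => by fun_prop
  have h2 := (contDiff_position i).contDiffAt (x := w)
  have h3 : ∀ j : Fin 2, ContDiffAt ℝ ∞ (fun w : Space × Space => position i w j) w :=
    fun j => (contDiffAt_euclidean.1 h2) j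
  have h4 : ContDiffAt ℝ ∞ (fun w : Space × Space => ‖position i w‖ ^ 2) w := h2.norm_sq ℝ
  have h5 : ContDiffAt ℝ ∞ (fun w => potential (other i) (position i w)) w :=
    (contDiffAt_potential (ne_primary_other hq) (ne_antipode hq _)).comp w h2
  have h7 : ContDiffAt ℝ ∞ (fun w => dist (position i w) (antipode i)) w :=
    h2.dist ℝ contDiffAt_const (ne_antipode hq i)
  have h8 : dist (position i w) (antipode i) ≠ 0 := (dist_pos.2 (ne_antipode hq i)).ne'
  exact ⟨(((((h4.add contDiffAt_const).pow 2).mul (contDiffAt_const.add (h1 0))).div_const 8).add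
    (((h3 0).mul (h1 2)).sub ((h3 1).mul (h1 1)))).add
    ((contDiffAt_const.sub (h1 0)).mul (h5.sub contDiffAt_const)),
    (((contDiffAt_const (c := side i)).mul (h3 0)).sub
      ((h4.sub (contDiffAt_const (c := (1 : ℝ)))).div_const 2)).div h7 h8⟩

theorem contDiffAt_regularizedHamiltonian {i : Fin 2} {c : ℝ} {w : Space × Space} (hw : w.2 ≠ 0)
    (hq : position i w ∈ closedHalfDisc i) : ContDiffAt ℝ ∞ (regularizedHamiltonian i c) w := by
  obtain ⟨A, B, h, hAB⟩ := exists_regularizedHamiltonian_eq i c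
  rw [h]
  exact ((contDiffAt_snd.norm ℝ hw).mul (hAB w hq).1).sub (hAB w hq).2

theorem continuousAt_regularizedHamiltonian {i : Fin 2} {c : ℝ} {w : Space × Space}
    (hq : position i w ∈ closedHalfDisc i) : ContinuousAt (regularizedHamiltonian i c) w := by
  obtain ⟨A, B, h, hAB⟩ := exists_regularizedHamiltonian_eq i c
  rw [h]
  exact (continuousAt_snd.norm.mul (hAB w hq).1.continuousAt).sub (hAB w hq).2.continuousAt

/-! ### Derivatives along rays -/

/-- The derivative of a potential along a curve; `D² = 2 (1 + |q|²)² - 4 n²` for the product `D` of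
the distances in its denominator, so that the terms in `n² n'` cancel. -/
theorem hasDerivAt_potential {j : Fin 2} {γ : ℝ → Plane} {t n' h' : ℝ}
    (h₁ : γ t ≠ primary j) (h₂ : γ t ≠ antipode j)
    (hn : HasDerivAt (fun t => potentialNum j (γ t)) n' t)
    (hh : HasDerivAt (fun t => ‖γ t‖ ^ 2) h' t) :
    HasDerivAt (fun t => potential j (γ t))
      (2 * (1 + ‖γ t‖ ^ 2) * (potentialNum j (γ t) * h' - (1 + ‖γ t‖ ^ 2) * n')
        / chord j (γ t) ^ 3) t := by
  have hD := chord_pos h₁ h₂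
  have hs : ∀ q, chord j q = √(2 * (1 + ‖q‖ ^ 2) ^ 2 - 4 * potentialNum j q ^ 2) := fun q => by
    rw [← chord_sq, Real.sqrt_sq (chord_nonneg j q)]
  have h3 : HasDerivAt (fun t => chord j (γ t))
      ((2 * (2 * (1 + ‖γ t‖ ^ 2) * h') - 4 * (2 * potentialNum j (γ t) * n'))
        / (2 * chord j (γ t))) t := by
    have h4 : HasDerivAt (fun t => 2 * (1 + ‖γ t‖ ^ 2) ^ 2 - 4 * potentialNum j (γ t) ^ 2)
        (2 * (2 * (1 + ‖γ t‖ ^ 2) * h') - 4 * (2 * potentialNum j (γ t) * n')) t := by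
      refine ((((hh.const_add 1).pow 2).const_mul 2).sub ((hn.pow 2).const_mul 4)).congr_deriv ?_
      simp
    simp only [hs]
    exact h4.sqrt (by rw [← chord_sq]; positivity)
  refine ((hn.div h3 hD.ne').neg).congr_deriv ?_
  field_simp
  linear_combination (-n') * chord_sq j (γ t)

/-- Along the ray from the primary, with fixed momentum, the Hamiltonian is strictly increasing at
every point of the half disc with energy below the critical value. -/
theorem hasDerivAt_hamiltonian_pos {i : Fin 2} {q p : Plane} (hq : q ∈ halfDisc i)
    (hq' : q ≠ primary i) (hH : hamiltonian (q, p) < -1) :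
    ∃ d, 0 < d ∧
      HasDerivAt (fun t : ℝ => hamiltonian (primary i + t • (q - primary i), p)) d 1 := by
  obtain ⟨γ, hγ⟩ : ∃ γ : ℝ → Plane, γ = fun t => primary i + t • (q - primary i) := ⟨_, rfl⟩
  have hγ1 : γ 1 = q := by rw [hγ]; simp
  have hc := halfDisc_subset i hq
  have hs := side_mul_self i
  obtain ⟨k, hk⟩ : ∃ k, k = √2 - 1 := ⟨_, rfl⟩
  have hk0 : 0 < k := by
    have := Real.one_lt_sqrt_two; rw [hk]; linarith
  have hk2 : k ^ 2 = 1 - 2 * k := by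
    have h2 : √2 ^ 2 = (2 : ℝ) := Real.sq_sqrt zero_le_two
    rw [hk]; linear_combination h2
  have hm0 : primary i 0 = side i * k := by rw [hk]; rfl
  have hm1 : primary i 1 = 0 := rfl
  have h0 : HasDerivAt (fun t => γ t 0) (q 0 - side i * k) 1 := by
    have : (fun t => γ t 0) = fun t => side i * k + t * (q 0 - side i * k) := by
      rw [hγ]; ext t; simp [hm0]
    rw [this]
    simpa using ((hasDerivAt_id (1 : ℝ)).mul_const (q 0 - side i * k)).const_add (side i * k)
  have h1 : HasDerivAt (fun t => γ t 1) (q 1) 1 := by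
    have : (fun t => γ t 1) = fun t => t * q 1 := by
      rw [hγ]; ext t; simp [hm1]
    rw [this]
    simpa using (hasDerivAt_id (1 : ℝ)).mul_const (q 1)
  obtain ⟨a, ha⟩ : ∃ a, a = ‖q‖ ^ 2 - k * (side i * q 0) := ⟨_, rfl⟩
  have hh : HasDerivAt (fun t => ‖γ t‖ ^ 2) (2 * a) 1 := by
    simp only [norm_sq_plane]
    refine ((h0.pow 2).add (h1.pow 2)).congr_deriv ?_
    rw [hγ1, ha, norm_sq_plane]
    simp; ring
  have hn : ∀ j, HasDerivAt (fun t => potentialNum j (γ t))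
      (side j * (q 0 - side i * k) - a) 1 := fun j => by
    refine ((h0.const_mul (side j)).sub ((hh.sub_const 1).div_const 2)).congr_deriv ?_
    ring
  have hV₁ := hasDerivAt_potential (by rw [hγ1]; exact ne_primary_other hc)
    (by rw [hγ1]; exact ne_antipode hc _) (hn (other i)) hh
  have hV₂ := hasDerivAt_potential (by rw [hγ1]; exact hq')
    (by rw [hγ1]; exact ne_antipode hc _) (hn i) hh
  have hK := ((((hh.add_const 1).pow 2).mul_const (‖p‖ ^ 2)).div_const 8).add
    ((h1.mul_const (p 0)).sub (h0.mul_const (p 1)))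
  have hd := (hK.add hV₂).add hV₁
  rw [hγ1] at hd
  refine ⟨_, ?_, (hd.congr_of_eventuallyEq (.of_forall fun t => ?_))⟩
  · have hx := hq.1
    have hh1 : ‖q‖ ^ 2 < 1 := pow_lt_one₀ (norm_nonneg _) hq.2 two_ne_zero
    have hD₁ := chord_pos (ne_primary_other hc) (ne_antipode hc (other i))
    have hD₂ := chord_pos hq' (ne_antipode hc i)
    have hn₁ : potentialNum (other i) q = -(side i * q 0) - (‖q‖ ^ 2 - 1) / 2 := by
      rw [potentialNum, side_other]; ring
    have key := radial_derivative_pos (x := side i * q 0) (v := side i * q 1) (p₁ := side i * p 0)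
      (p₂ := side i * p 1) (h := ‖q‖ ^ 2) (n₂ := potentialNum i q) hk2 hk0
      (by rw [norm_sq_plane]; linear_combination (-(q 0 ^ 2 + q 1 ^ 2)) * hs) hx hh1 hD₁ hD₂ hn₁ rfl
      (chord_sq _ _) (chord_sq _ _) (by
        rw [hamiltonian_eq i, potential_eq, potential_eq] at hH
        simp only [norm_sq_plane p] at hH
        refine lt_of_eq_of_lt ?_ hH
        linear_combination ((‖q‖ ^ 2 + 1) ^ 2 * (p 0 ^ 2 + p 1 ^ 2) / 8
          + (q 1 * p 0 - q 0 * p 1)) * hs)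
    refine lt_of_lt_of_eq key ?_
    rw [hn₁, potentialNum, side_other, ha, norm_sq_plane p]
    have e1 : side i * (q 0 - side i * k) = side i * q 0 - k := by linear_combination (-k) * hs
    have e2 : -side i * (q 0 - side i * k) = -(side i * q 0) + k := by linear_combination k * hs
    have e3 : (side i * p 0) ^ 2 + (side i * p 1) ^ 2 = p 0 ^ 2 + p 1 ^ 2 := by
      linear_combination (p 0 ^ 2 + p 1 ^ 2) * hs
    have e4 : side i * q 1 * (side i * p 0) - (side i * q 0 - k) * (side i * p 1)
        = q 1 * p 0 - (q 0 - side i * k) * p 1 := by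
      linear_combination (q 1 * p 0 - q 0 * p 1) * hs
    rw [e1, e2, e3, e4]
    simp
    field_simp
    ring
  · show hamiltonian (primary i + t • (q - primary i), p) = _
    rw [hamiltonian_eq i, hγ]; rfl

/-- After its first zero the function cannot become negative, hence it cannot reach another zero
with a positive derivative. -/
theorem eq_of_deriv_pos_of_eq_zero {φ φ' : ℝ → ℝ} {a b : ℝ} (hab : a ≤ b)
    (hφ : ∀ x ∈ Icc a b, HasDerivAt φ (φ' x) x) (h : ∀ x ∈ Icc a b, φ x = 0 → 0 < φ' x)
    (ha : φ a = 0) (hb : φ b = 0) : a = b := by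
  by_contra hne
  have hlt : a < b := lt_of_le_of_ne hab hne
  have h0 : ∀ ⦃x⦄, x ∈ Icc a b → 0 ≤ φ x := by
    refine image_le_of_deriv_right_lt_deriv_boundary' (f := fun _ => (0 : ℝ)) (f' := fun _ => 0)
      (B' := φ') continuousOn_const (fun x _ => hasDerivWithinAt_const _ _ _) ha.ge
      (fun x hx => (hφ x hx).continuousAt.continuousWithinAt)
      (fun x hx => (hφ x (Ico_subset_Icc_self hx)).hasDerivWithinAt)
      (fun x hx h0 => h x (Ico_subset_Icc_self hx) h0.symm)
  have hb' : b ∈ Icc a b := right_mem_Icc.2 hab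
  have h1 := (hasDerivAt_iff_tendsto_slope_left_right.1 (hφ b hb')).1
  have h2 : φ' b ≤ 0 := by
    refine le_of_tendsto h1 ?_
    filter_upwards [Ioo_mem_nhdsLT hlt] with x hx
    rw [slope_def_field, hb, sub_zero]
    exact div_nonpos_of_nonneg_of_nonpos (h0 ⟨hx.1.le, hx.2.le⟩) (by linarith [hx.2])
  exact absurd (h b hb' hb) h2.not_gt

variable {i : Fin 2} {c : ℝ}

/-- The open set of covectors off the zero section whose position is in the half disc. -/
def regularDomain (i : Fin 2) : Set (Space × Space) := {w | w.2 ≠ 0 ∧ position i w ∈ halfDisc i}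

theorem isOpen_regularDomain (i : Fin 2) : IsOpen (regularDomain i) :=
  (isOpen_ne.preimage continuous_snd).inter
    ((isOpen_halfDisc i).preimage (contDiff_position i).continuous)

/-- The part of the zero level of the regularized Hamiltonian over the half disc. -/
def innerLevel (i : Fin 2) (c : ℝ) : Set (Space × Space) :=
  {w | w ∈ cotangentSphere ∧ w ∈ regularDomain i ∧ regularizedHamiltonian i c w = 0}

theorem regularizedHamiltonian_zero_section {w : Space × Space} (hw : w.2 = 0) :
    regularizedHamiltonian i c w < 0 := by
  have h : position i w = primary i := by
    rw [position_eq]; ext j; fin_cases j <;> simp [displacement, hw]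
  rw [regularizedHamiltonian, h, hw, norm_zero, zero_mul, zero_sub, neg_lt_zero]
  exact collision_term_pos i

/-- The regularized Hamiltonian is positive over the boundary of the half disc. -/
theorem regularizedHamiltonian_pos (hc : c < -1) {w : Space × Space} (hw : w ∈ cotangentSphere)
    (hq : position i w ∈ closedHalfDisc i) (hq' : position i w ∉ halfDisc i) :
    0 < regularizedHamiltonian i c w := by
  have h : position i w ≠ primary i := fun h => hq' (h ▸ primary_mem_halfDisc i)
  have h1 := dist_pos.2 h
  rw [dist_position_primary hw] at h1
  have h2 : w.1 0 ≠ 1 := fun h2 => by simp [h2] at h1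
  have h3 : w.2 ≠ 0 := fun h3 => by simp [h3] at h1
  rw [regularizedHamiltonian_eq i c hw h2 h3]
  exact mul_pos h1 (by linarith [neg_one_le_hamiltonian hq hq' (momentum w)])

theorem exists_hasDerivAt_ray (hc : c < -1) {w : Space × Space} (hw : w ∈ innerLevel i c) :
    ∃ d, 0 < d ∧ HasDerivAt (fun t : ℝ => regularizedHamiltonian i c (w.1, t • w.2)) d 1 := by
  obtain ⟨hw1, ⟨hw2, hw3⟩, hw4⟩ := hw
  have hn := norm_pos_iff.2 hw2
  have ht : ∀ᶠ t : ℝ in 𝓝 1, 0 < t := lt_mem_nhds one_pos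
  by_cases h : w.1 0 = 1
  · refine ⟨‖w.2‖ * ((‖primary i‖ ^ 2 + 1) ^ 2 / 4), by positivity, ?_⟩
    have h1 := (((hasDerivAt_id (1 : ℝ)).mul_const
      (‖w.2‖ * ((‖primary i‖ ^ 2 + 1) ^ 2 / 4))).sub_const
        (potentialNum i (primary i) / dist (primary i) (antipode i)))
    rw [one_mul] at h1
    refine h1.congr_of_eventuallyEq ?_
    filter_upwards [ht] with t ht
    rw [regularizedHamiltonian_collision i c (smul_mem_cotangentSphere hw1 t) h]
    simp only [norm_smul, Real.norm_eq_abs, abs_of_pos ht, id]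
    ring
  · have h0 : 0 < 1 - w.1 0 := sub_pos.2 (lt_of_le_of_ne (le_one_of_mem hw1) h)
    have h1 := regularizedHamiltonian_eq i c hw1 h hw2
    rw [hw4, eq_comm, mul_eq_zero, or_iff_right (mul_pos h0 hn).ne', sub_eq_zero] at h1
    have hne : position i w ≠ primary i := by
      rw [← dist_pos, dist_position_primary hw1]; exact mul_pos h0 hn
    obtain ⟨d, hd, hd'⟩ := hasDerivAt_hamiltonian_pos hw3 hne (h1.trans_lt hc)
    refine ⟨(1 - w.1 0) * ‖w.2‖ * d, by positivity, ?_⟩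
    have h2 := ((hasDerivAt_id (1 : ℝ)).mul_const ((1 - w.1 0) * ‖w.2‖)).mul (hd'.sub_const c)
    have h3 : position i w - primary i = displacement w := by
      rw [position_eq, add_sub_cancel_left]
    rw [h3] at h2
    refine (h2.congr_deriv ?_).congr_of_eventuallyEq ?_
    · rw [one_smul, ← position_eq, h1]; simp
    · filter_upwards [ht] with t ht
      rw [regularizedHamiltonian_eq i c (smul_mem_cotangentSphere hw1 t) h
        (smul_ne_zero ht.ne' hw2), position_eq, displacement_smul]
      simp only [norm_smul, Real.norm_eq_abs, abs_of_pos ht, id, Pi.mul_apply]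
      rw [show momentum (w.1, t • w.2) = momentum w from rfl]
      ring

theorem fderiv_radial_pos (hc : c < -1) {w : Space × Space} (hw : w ∈ innerLevel i c) :
    0 < fderiv ℝ (regularizedHamiltonian i c) w (0, w.2) := by
  obtain ⟨d, hd, hd'⟩ := exists_hasDerivAt_ray hc hw
  have h1 := ((contDiffAt_regularizedHamiltonian (c := c) hw.2.1.1
    (halfDisc_subset i hw.2.1.2)).differentiableAt (by simp)).hasFDerivAt
  have h2 : HasDerivAt (fun t : ℝ => (w.1, t • w.2)) ((0 : Space), w.2) 1 := by
    simpa using (hasDerivAt_const (1 : ℝ) w.1).prodMk ((hasDerivAt_id (1 : ℝ)).smul_const w.2)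
  have h3 : w = (w.1, (1 : ℝ) • w.2) := by rw [one_smul]
  rw [h3] at h1
  have h4 := h1.comp_hasDerivAt (1 : ℝ) h2
  rw [← h3] at h4
  rw [h4.unique hd']
  exact hd

/-! ### The zero level over the half disc -/

theorem convex_halfDisc (i : Fin 2) : Convex ℝ (halfDisc i) := by
  intro p hp q hq a b ha hb hab
  refine ⟨?_, ?_⟩
  · have h1 := hp.1
    have h2 := hq.1
    simp only [PiLp.add_apply, PiLp.smul_apply, smul_eq_mul]
    rcases ha.eq_or_lt with rfl | ha
    · rw [zero_add] at hab; subst hab; linarith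
    · nlinarith [mul_pos ha h1, mul_nonneg hb h2.le]
  · simpa using convex_ball (0 : Plane) 1 (by simpa using hp.2) (by simpa using hq.2) ha hb hab

theorem position_smul (i : Fin 2) (ξ η : Space) (r : ℝ) :
    position i (ξ, r • η) = primary i + r • displacement (ξ, η) := by
  rw [position_eq, displacement_smul]

/-- The times at which a ray from the primary is in the half disc form an interval. -/
theorem ordConnected_ray (i : Fin 2) (ξ η : Space) :
    OrdConnected {r : ℝ | position i (ξ, r • η) ∈ halfDisc i} := by
  have h := ((convex_halfDisc i).affine_preimage
    (AffineMap.lineMap (k := ℝ) (primary i) (primary i + displacement (ξ, η)))).ordConnected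
  have h2 : (AffineMap.lineMap (k := ℝ) (primary i) (primary i + displacement (ξ, η))) ⁻¹'
      halfDisc i = {r : ℝ | position i (ξ, r • η) ∈ halfDisc i} := by
    ext r
    simp [position_smul, AffineMap.lineMap_apply, add_comm]
  rwa [h2] at h

theorem continuous_ray (ξ η : Space) : Continuous fun r : ℝ => (ξ, r • η) := by fun_prop

theorem existsUnique_radius (hc : c < -1) {z : Space × Space} (hz : z ∈ unitCotangentSphere) :
    ∃! r : ℝ, 0 < r ∧ (z.1, r • z.2) ∈ innerLevel i c := by
  have hz1 : ‖z.2‖ = 1 := hz.2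
  have hz2 : z.2 ≠ 0 := norm_ne_zero_iff.1 (by rw [hz1]; exact one_ne_zero)
  have hcot : ∀ r : ℝ, (z.1, r • z.2) ∈ cotangentSphere := smul_mem_cotangentSphere hz.1
  have hord := ordConnected_ray i z.1 z.2
  obtain ⟨J, hJ⟩ : ∃ J, J = {r : ℝ | position i (z.1, r • z.2) ∈ halfDisc i} := ⟨_, rfl⟩
  rw [← hJ] at hord
  have hcont : Continuous fun r : ℝ => position i (z.1, r • z.2) :=
    (contDiff_position i).continuous.comp (continuous_ray z.1 z.2)
  have hJo : IsOpen J := by rw [hJ]; exact (isOpen_halfDisc i).preimage hcont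
  have hJ0 : (0 : ℝ) ∈ J := by
    rw [hJ]; simp [position_smul, primary_mem_halfDisc]
  refine existsUnique_of_exists_of_unique ?_ ?_
  · by_cases h : z.1 0 = 1
    · have hA : 0 < (‖primary i‖ ^ 2 + 1) ^ 2 / 4 := by positivity
      have hB := collision_term_pos i
      refine ⟨_, div_pos hB hA, hcot _, ⟨smul_ne_zero (div_pos hB hA).ne' hz2, ?_⟩, ?_⟩
      · have : position i (z.1, (potentialNum i (primary i) / dist (primary i) (antipode i)
            / ((‖primary i‖ ^ 2 + 1) ^ 2 / 4)) • z.2) = primary i := by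
          rw [← dist_eq_zero, dist_position_primary (hcot _), h, sub_self, zero_mul]
        rw [this]; exact primary_mem_halfDisc i
      · rw [regularizedHamiltonian_collision i c (hcot _) h, norm_smul, hz1, Real.norm_eq_abs,
          abs_of_pos (div_pos hB hA), mul_one, div_mul_cancel₀ _ hA.ne', sub_self]
    · have h0 : 0 < 1 - z.1 0 := sub_pos.2 (lt_of_le_of_ne (le_one_of_mem hz.1) h)
      have hbdd : BddAbove J := by
        refine ⟨2 / (1 - z.1 0), fun r hr => ?_⟩
        rw [le_div_iff₀ h0]
        rw [hJ] at hr
        have h1 : dist (position i (z.1, r • z.2)) (primary i) ≤ 2 := by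
          have h2 := (primary_mem_halfDisc i).2
          have h3 := hr.2
          rw [dist_eq_norm]
          exact (norm_sub_le _ _).trans (by linarith)
        rw [dist_position_primary (hcot r), norm_smul, hz1, mul_one, Real.norm_eq_abs] at h1
        nlinarith [le_abs_self r]
      -- the ray leaves the half disc at the supremum `R` of `J`
      obtain ⟨R, hR⟩ : ∃ R, R = sSup J := ⟨_, rfl⟩
      have hRJ : R ∉ J := by
        intro hRJ
        obtain ⟨u, hu, hsub⟩ := exists_Ico_subset_of_mem_nhds (hJo.mem_nhds hRJ) (exists_gt R)
        have h1 : (R + u) / 2 ∈ J := hsub ⟨by linarith, by linarith⟩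
        have h2 := le_csSup hbdd h1
        rw [← hR] at h2
        linarith
      have hR0 : 0 ≤ R := by rw [hR]; exact le_csSup hbdd hJ0
      have hRc : ∀ r ∈ Icc 0 R, position i (z.1, r • z.2) ∈ closedHalfDisc i := by
        have h1 : closure J ⊆ {r : ℝ | position i (z.1, r • z.2) ∈ closedHalfDisc i} :=
          closure_minimal (by rw [hJ]; exact fun r hr => halfDisc_subset i hr)
            ((isClosed_closedHalfDisc i).preimage hcont)
        rintro r ⟨hr0, hrR⟩
        rcases hrR.eq_or_lt with rfl | hrR
        · exact h1 (by rw [hR]; exact csSup_mem_closure ⟨0, hJ0⟩ hbdd)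
        · rw [hR] at hrR
          obtain ⟨s, hs, hrs⟩ := exists_lt_of_lt_csSup ⟨0, hJ0⟩ hrR
          exact h1 (subset_closure (hord.out hJ0 hs ⟨hr0, hrs.le⟩))
      have hφ : ContinuousOn (fun r : ℝ => regularizedHamiltonian i c (z.1, r • z.2)) (Icc 0 R) :=
        fun r hr => ((continuousAt_regularizedHamiltonian (hRc r hr)).comp
          (f := fun r : ℝ => (z.1, r • z.2))
          (continuous_ray z.1 z.2).continuousAt).continuousWithinAt
      have hneg : regularizedHamiltonian i c (z.1, (0 : ℝ) • z.2) < 0 :=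
        regularizedHamiltonian_zero_section (by simp)
      have hpos : 0 < regularizedHamiltonian i c (z.1, R • z.2) :=
        regularizedHamiltonian_pos hc (hcot R) (hRc R ⟨hR0, le_rfl⟩)
          (by rw [hJ] at hRJ; exact hRJ)
      obtain ⟨r, ⟨hr0, hrR⟩, hr⟩ := intermediate_value_Icc hR0 hφ ⟨hneg.le, hpos.le⟩
      have hr0' : r ≠ 0 := by rintro rfl; exact hneg.ne hr
      have hrR' : r < R := lt_of_le_of_ne hrR (by rintro rfl; exact hpos.ne' hr)
      rw [hR] at hrR'
      obtain ⟨s, hs, hrs⟩ := exists_lt_of_lt_csSup ⟨0, hJ0⟩ hrR'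
      have hrJ := hord.out hJ0 hs ⟨hr0, hrs.le⟩
      rw [hJ] at hrJ
      exact ⟨r, lt_of_le_of_ne hr0 hr0'.symm, hcot r, ⟨smul_ne_zero hr0' hz2, hrJ⟩, hr⟩
  · have main : ∀ r s : ℝ, 0 < r → (z.1, r • z.2) ∈ innerLevel i c →
        (z.1, s • z.2) ∈ innerLevel i c → r ≤ s → r = s := by
      intro r s hr hrl hsl hrs
      have hJr : r ∈ J := by rw [hJ]; exact hrl.2.1.2
      have hJs : s ∈ J := by rw [hJ]; exact hsl.2.1.2
      have hd : ∀ x ∈ Icc r s, (z.1, x • z.2) ∈ regularDomain i := fun x hx => by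
        have := hord.out hJr hJs hx
        rw [hJ] at this
        exact ⟨smul_ne_zero (hr.trans_le hx.1).ne' hz2, this⟩
      refine eq_of_deriv_pos_of_eq_zero (φ := fun x => regularizedHamiltonian i c (z.1, x • z.2))
        (φ' := fun x => fderiv ℝ (regularizedHamiltonian i c) (z.1, x • z.2) (0, z.2)) hrs ?_ ?_
        hrl.2.2 hsl.2.2
      · intro x hx
        have h1 := ((contDiffAt_regularizedHamiltonian (c := c) (hd x hx).1
          (halfDisc_subset i (hd x hx).2)).differentiableAt (by simp)).hasFDerivAt
        have h2 : HasDerivAt (fun x : ℝ => (z.1, x • z.2)) ((0 : Space), z.2) x := by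
          simpa using (hasDerivAt_const x z.1).prodMk ((hasDerivAt_id x).smul_const z.2)
        exact h1.comp_hasDerivAt x h2
      · intro x hx hx0
        have hx' := hr.trans_le hx.1
        have h1 := fderiv_radial_pos hc (w := (z.1, x • z.2)) ⟨hcot x, hd x hx, hx0⟩
        rw [show ((0 : Space), (z.1, x • z.2).2) = x • ((0 : Space), z.2) by simp, map_smul] at h1
        exact (mul_pos_iff_of_pos_left hx').1 h1
    rintro r s ⟨hr, hrl⟩ ⟨hs, hsl⟩
    rcases le_total r s with h | h
    · exact main r s hr hrl hsl h
    · exact (main s r hs hsl hrl h).symm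

theorem isRadialLevel_innerLevel (i : Fin 2) (hc : c < -1) :
    IsRadialLevel (regularDomain i) (regularizedHamiltonian i c) (innerLevel i c) where
  isOpen := isOpen_regularDomain i
  contDiffOn _ hw := (contDiffAt_regularizedHamiltonian hw.1
    (halfDisc_subset i hw.2)).contDiffWithinAt
  ne_zero _ hw := hw.1
  eq := rfl
  radial_pos _ hw := fderiv_radial_pos hc hw
  existsUnique _ hz := existsUnique_radius hc hz

/-! ### Connected components -/

theorem innerLevel_subset : innerLevel i c ⊆ regularizedLevel i c := fun _ hw =>
  ⟨hw.1, ⟨ne_primary_other (halfDisc_subset i hw.2.1.2),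
    ne_antipode (halfDisc_subset i hw.2.1.2)⟩, hw.2.2⟩

/-- A point of the regularized level over the closed half disc is over the open half disc. -/
theorem mem_innerLevel (hc : c < -1) {w : Space × Space} (hw : w ∈ regularizedLevel i c)
    (hq : position i w ∈ closedHalfDisc i) : w ∈ innerLevel i c :=
  ⟨hw.1, ⟨fun h => (regularizedHamiltonian_zero_section h).ne hw.2.2,
    by_contra fun h => (regularizedHamiltonian_pos hc hw.1 hq h).ne' hw.2.2⟩, hw.2.2⟩

theorem isPreconnected_innerLevel (hc : c < -1) : IsPreconnected (innerLevel i c) := by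
  obtain ⟨ρ, hρ, h⟩ := (isRadialLevel_innerLevel i hc).exists_continuousOn_radius
  rw [← h]
  exact isConnected_unitCotangentSphere.isPreconnected.image _
    (continuousOn_fst.prodMk (hρ.smul continuousOn_snd))

/-- The part over the half disc is a connected component of the regularized level: it is closed
because the level has no points over the boundary of the half disc. -/
theorem connectedComponentIn_regularizedLevel (hc : c < -1) {w : Space × Space}
    (hw : w ∈ innerLevel i c) :
    connectedComponentIn (regularizedLevel i c) w = innerLevel i c := by
  refine Subset.antisymm ?_
    ((isPreconnected_innerLevel hc).subset_connectedComponentIn hw innerLevel_subset)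
  have hcont := (contDiff_position i).continuous
  have hsub := connectedComponentIn_subset (regularizedLevel i c) w
  have hu : IsOpen (position i ⁻¹' halfDisc i) := (isOpen_halfDisc i).preimage hcont
  have hcl : closure (position i ⁻¹' halfDisc i) ⊆ position i ⁻¹' closedHalfDisc i :=
    closure_minimal (preimage_mono (halfDisc_subset i))
      ((isClosed_closedHalfDisc i).preimage hcont)
  have h := (isPreconnected_connectedComponentIn (F := regularizedLevel i c)
    (x := w)).subset_of_closure_inter_subset hu
    ⟨w, mem_connectedComponentIn (innerLevel_subset hw), hw.2.1.2⟩
    (fun v hv => (mem_innerLevel hc (hsub hv.2) (hcl hv.1)).2.1.2)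
  exact fun v hv => mem_innerLevel hc (hsub hv) (halfDisc_subset i (h hv))

/-- The energy component around a primary has points over the half disc, because its projection
accumulates at the primary, and no points over the boundary. -/
theorem fst_mem_halfDisc (hc : c < -1) {z : Plane × Plane} (hz : z ∈ energyComponent i c) :
    z.1 ∈ halfDisc i := by
  obtain ⟨C, hC⟩ : ∃ C, C = connectedComponentIn (energyLevel c) z := ⟨_, rfl⟩
  have hsub : C ⊆ energyLevel c := by rw [hC]; exact connectedComponentIn_subset _ _
  have hzC : z ∈ C := by rw [hC]; exact mem_connectedComponentIn hz.1
  have hpre : IsPreconnected C := by rw [hC]; exact isPreconnected_connectedComponentIn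
  have hz2 := hz.2
  rw [← hC] at hz2
  obtain ⟨q, hq, z', hz', rfl⟩ := mem_closure_iff.1 hz2 _ (isOpen_halfDisc i)
    (primary_mem_halfDisc i)
  have hu : IsOpen (Prod.fst ⁻¹' halfDisc i : Set (Plane × Plane)) :=
    (isOpen_halfDisc i).preimage continuous_fst
  have hcl : closure (Prod.fst ⁻¹' halfDisc i : Set (Plane × Plane))
      ⊆ Prod.fst ⁻¹' closedHalfDisc i :=
    closure_minimal (preimage_mono (halfDisc_subset i))
      ((isClosed_closedHalfDisc i).preimage continuous_fst)
  refine hpre.subset_of_closure_inter_subset hu ⟨z', hz', hq⟩ (fun v hv => ?_) hzC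
  by_contra h
  have h1 := neg_one_le_hamiltonian (hcl hv.1) h v.2
  have h2 : hamiltonian (v.1, v.2) = c := (hsub hv.2).2
  linarith

theorem inner_plane (x y : Plane) : ⟪x, y⟫ = x 0 * y 0 + x 1 * y 1 := by
  simp [PiLp.inner_apply, Fin.sum_univ_two]; ring

theorem moserMap_mem (i : Fin 2) {z : Plane × Plane} (hz : z ∈ energyLevel c)
    (hq : z.1 ∈ halfDisc i) : moserMap i z ∈ innerLevel i c := by
  obtain ⟨x, hx⟩ : ∃ x, x = -z.2 := ⟨_, rfl⟩
  obtain ⟨y, hy⟩ : ∃ y, y = z.1 - primary i := ⟨_, rfl⟩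
  obtain ⟨s, hs⟩ : ∃ s, s = ‖x‖ ^ 2 := ⟨_, rfl⟩
  have hs0 : 0 < s + 1 := by rw [hs]; positivity
  have hs2 : s = x 0 ^ 2 + x 1 ^ 2 := by rw [hs, norm_sq_plane]
  have hw : moserMap i z = (!₂[(s - 1) / (s + 1), 2 * x 0 / (s + 1), 2 * x 1 / (s + 1)],
      !₂[⟪x, y⟫, (s + 1) / 2 * y 0 - ⟪x, y⟫ * x 0, (s + 1) / 2 * y 1 - ⟪x, y⟫ * x 1]) := by
    rw [hs, hx, hy]; rfl
  have hcot : moserMap i z ∈ cotangentSphere := by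
    rw [mem_cotangentSphere_iff_coord, hw]
    constructor
    · simp; field_simp; linear_combination (-4) * hs2
    · simp [inner_plane]; field_simp
      linear_combination 2 * (x 0 * y 0 + x 1 * y 1) * hs2
  have hpos : position i (moserMap i z) = z.1 := by
    have : z.1 = primary i + y := by rw [hy]; simp
    rw [position_eq, this, hw]
    congr 1
    ext j
    fin_cases j <;> simp [displacement] <;> field_simp <;> ring
  have hne : z.1 ≠ primary i := (hz.1 i).1
  have h1 := dist_pos.2 hne
  rw [← hpos, dist_position_primary hcot] at h1
  have h2 : (moserMap i z).1 0 ≠ 1 := fun h2 => by simp [h2] at h1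
  have h3 : (moserMap i z).2 ≠ 0 := fun h3 => by simp [h3] at h1
  have hmom : momentum (moserMap i z) = z.2 := by
    have : z.2 = -x := by rw [hx, neg_neg]
    rw [this, hw]
    have h4 : 1 - (s - 1) / (s + 1) = 2 / (s + 1) := by field_simp; ring
    ext j
    fin_cases j <;> simp [momentum, h4] <;> field_simp
  refine ⟨hcot, ⟨h3, by rw [hpos]; exact hq⟩, ?_⟩
  rw [regularizedHamiltonian_eq i c hcot h2 h3, hpos, hmom, hz.2, sub_self, mul_zero]

/-- A point of the regularized level off the collision fiber comes from the energy level. -/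
theorem mem_energyLevel {w : Space × Space} (hw : w ∈ innerLevel i c) (h : w.1 0 ≠ 1) :
    (position i w, momentum w) ∈ energyLevel c := by
  have hc := halfDisc_subset i hw.2.1.2
  have h0 : 0 < 1 - w.1 0 := sub_pos.2 (lt_of_le_of_ne (le_one_of_mem hw.1) h)
  have hn := norm_pos_iff.2 hw.2.1.1
  have hne : position i w ≠ primary i := by
    rw [← dist_pos, dist_position_primary hw.1]; exact mul_pos h0 hn
  refine ⟨fun j => ⟨?_, ne_antipode hc j⟩, ?_⟩
  · have : j = i ∨ j = other i := by
      fin_cases i <;> fin_cases j <;> simp [other]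
    rcases this with rfl | rfl
    · exact hne
    · exact ne_primary_other hc
  · have h1 := regularizedHamiltonian_eq i c hw.1 h hw.2.1.1
    rw [hw.2.2, eq_comm, mul_eq_zero, or_iff_right (mul_pos h0 hn).ne', sub_eq_zero] at h1
    exact h1

/-- The energy component around a primary is not empty: the level contains a curve, over a curve
in the unit cotangent bundle that tends to the collision fiber, whose position tends to the
primary. -/
theorem energyComponent_nonempty (i : Fin 2) (hc : c < -1) : (energyComponent i c).Nonempty := by
  obtain ⟨ρ, hρ, hρS⟩ := (isRadialLevel_innerLevel i hc).exists_continuousOn_radius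
  obtain ⟨u, hu⟩ : ∃ u : ℝ → Space × Space, u = fun t =>
      (!₂[(t ^ 2 - 1) / (t ^ 2 + 1), 2 * t / (t ^ 2 + 1), 0], !₂[0, 0, 1]) := ⟨_, rfl⟩
  have ht : ∀ t : ℝ, t ^ 2 + 1 ≠ 0 := fun t => by positivity
  have huc : Continuous u := by
    rw [hu]
    refine Continuous.prodMk ?_ continuous_const
    refine (PiLp.continuous_toLp 2 _).comp (continuous_pi fun j => ?_)
    fin_cases j <;> simp <;> fun_prop (disch := assumption)
  have huS : ∀ t, u t ∈ unitCotangentSphere := fun t => by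
    rw [mem_unitCotangentSphere_iff, hu]
    have := ht t
    refine ⟨?_, ?_, ?_⟩ <;> simp
    field_simp; ring
  have hρc : Continuous fun t => ρ (u t) := by
    rw [← continuousOn_univ]
    exact hρ.comp huc.continuousOn fun t _ => huS t
  obtain ⟨w, hw⟩ : ∃ w : ℝ → Space × Space, w = fun t => ((u t).1, ρ (u t) • (u t).2) := ⟨_, rfl⟩
  have hwS : ∀ t, w t ∈ innerLevel i c := fun t => by
    rw [← hρS, hw]; exact ⟨u t, huS t, rfl⟩
  have hwc : Continuous w := by
    rw [hw]; exact huc.fst.prodMk (hρc.smul huc.snd)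
  have hw1 : ∀ t, 1 - (w t).1 0 = 2 / (t ^ 2 + 1) := fun t => by
    rw [hw, hu]; have := ht t; simp; field_simp; ring
  have hw1' : ∀ t, (w t).1 0 ≠ 1 := fun t h => by
    have h1 := hw1 t
    rw [h, sub_self, eq_comm, div_eq_zero_iff] at h1
    exact h1.elim two_ne_zero (ht t)
  obtain ⟨z, hz⟩ : ∃ z : ℝ → Plane × Plane, z = fun t => (position i (w t), momentum (w t)) :=
    ⟨_, rfl⟩
  have hzE : ∀ t, z t ∈ energyLevel c := fun t => by
    rw [hz]; exact mem_energyLevel (hwS t) (hw1' t)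
  have hzc : Continuous z := by
    rw [hz]
    refine ((contDiff_position i).continuous.comp hwc).prodMk ?_
    refine (PiLp.continuous_toLp 2 _).comp (continuous_pi fun j => ?_)
    have h1 : ∀ j : Fin 3, Continuous fun t => (w t).1 j := fun j =>
      (by fun_prop : Continuous fun w : Space × Space => w.1 j).comp hwc
    have h2 : ∀ t, 1 - (w t).1 0 ≠ 0 := fun t => sub_ne_zero.2 (hw1' t).symm
    fin_cases j
    · exact ((h1 1).div (continuous_const.sub (h1 0)) h2).neg
    · exact ((h1 2).div (continuous_const.sub (h1 0)) h2).neg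
  have hcomp : range z ⊆ connectedComponentIn (energyLevel c) (z 0) :=
    (isPreconnected_range hzc).subset_connectedComponentIn (mem_range_self 0)
      (range_subset_iff.2 hzE)
  refine ⟨z 0, hzE 0, ?_⟩
  obtain ⟨M, hM⟩ := isCompact_unitCotangentSphere.exists_bound_of_continuousOn hρ
  have hlim : Tendsto (fun t => (z t).1) atTop (𝓝 (primary i)) := by
    rw [tendsto_iff_dist_tendsto_zero]
    have h1 : Tendsto (fun t : ℝ => 2 / (t ^ 2 + 1) * M) atTop (𝓝 0) := by
      have h2 : Tendsto (fun t : ℝ => t ^ 2 + 1) atTop atTop :=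
        tendsto_atTop_add_const_right _ _ (tendsto_pow_atTop two_ne_zero)
      simpa using (h2.const_div_atTop 2).mul_const M
    refine squeeze_zero (fun _ => dist_nonneg) (fun t => ?_) h1
    rw [hz]
    simp only
    rw [dist_position_primary (hwS t).1, hw1]
    refine mul_le_mul_of_nonneg_left ?_ (by positivity)
    have h3 : ‖(u t).2‖ = 1 := (huS t).2
    rw [hw]
    simp only
    rw [norm_smul, h3, mul_one]
    exact hM _ (huS t)
  exact mem_closure_of_tendsto hlim (.of_forall fun t =>
    mem_image_of_mem _ (hcomp (mem_range_self t)))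

theorem regularizedComponent_eq (i : Fin 2) (hc : c < -1) :
    regularizedComponent i c = innerLevel i c := by
  have h : ∀ z ∈ energyComponent i c,
      connectedComponentIn (regularizedLevel i c) (moserMap i z) = innerLevel i c := fun z hz =>
    connectedComponentIn_regularizedLevel hc (moserMap_mem i hz.1 (fst_mem_halfDisc hc hz))
  rw [regularizedComponent, iUnion₂_congr h]
  exact biUnion_const (energyComponent_nonempty i hc) _

end CurvedThreeBody

end

theorem mainTheorem2 (c : ℝ)
    (hc : c < CurvedThreeBody.hamiltonian CurvedThreeBody.lagrangePoint) (i : Fin 2) :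
    IsCompact (CurvedThreeBody.regularizedComponent i c) ∧
    CurvedThreeBody.IsHypersurface (CurvedThreeBody.regularizedComponent i c) ∧
    CurvedThreeBody.IsFiberwiseStarShaped (CurvedThreeBody.regularizedComponent i c) ∧
    CurvedThreeBody.IsContactType (CurvedThreeBody.regularizedComponent i c) ∧
    CurvedThreeBody.AreDiffeomorphic
      (modelWithCornersSelf ℝ (CurvedThreeBody.Space × CurvedThreeBody.Space))
      (modelWithCornersSelf ℝ (CurvedThreeBody.Space × CurvedThreeBody.Space))
      (CurvedThreeBody.regularizedComponent i c) CurvedThreeBody.unitCotangentSphere ∧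
    CurvedThreeBody.AreDiffeomorphic
      (modelWithCornersSelf ℝ (CurvedThreeBody.Space × CurvedThreeBody.Space))
      (modelWithCornersSelf ℝ (EuclideanSpace ℝ (Fin 3)))
      (CurvedThreeBody.regularizedComponent i c)
      (Set.univ : Set CurvedThreeBody.RealProjectiveThreeSpace) := by
  rw [CurvedThreeBody.hamiltonian_lagrangePoint] at hc
  have h := CurvedThreeBody.isRadialLevel_innerLevel i hc
  rw [CurvedThreeBody.regularizedComponent_eq i hc]
  exact ⟨h.isCompact, h.isHypersurface, h.isFiberwiseStarShaped, h.isContactType,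
    h.areDiffeomorphic_unitCotangentSphere,
    h.areDiffeomorphic_unitCotangentSphere.trans
      CurvedThreeBody.areDiffeomorphic_realProjectiveThreeSpace⟩
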